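/- **Notation.** Let $d\ge 1$ and $1\le k\le d+1$ be integers, $T^d=\{x\in\mathbb R^d: x_i\ge 0,\ |x|\le 1\}$ with $|x|=x_1+\cdots+x_d$, and $x_{d+1}:=1-|x|$. Let $e_0=0$ and let $e_1,\dots,e_d$ be the standard basis of $\mathbb R^d$. Let $\gamma\in\mathbb R^{d+1-k}$ with all $\gamma_i>-1$, and write $x^\gamma=\prod_{i=1}^{d+1-k}x_i^{\gamma_i}$, $\mathbf m_k=\{d-k+2,\dots,d\}$, $\mathbf m_k^+=\{d-k+2,\dots,d+1\}$, $x_A=\prod_{i\in A}x_i$, and $\partial^I=\prod_{i\in I}\partial_{x_i}$ for $I\subset\{1,\dots,d\}$. For $g\in\mathbb R^{d+1}$ with all $g_i>-1$ let $W_g(x)=\prod_{i=1}^{d+1}x_i^{g_i}$, and let $\mathcal V_n^d(W_g)$ be the space of real polynomials of degree at most $n$ that are orthogonal in $L^2(T^d,W_g\,dx)$ to all polynomials of degree at most $n-1$. For $S\subset\{1,\dots,d+1\}$ with $|S|<d$ choose $r\notin S$, with $r=d+1$ if $d+1\notin S$ and $r$ arbitrary otherwise, and let $H_{n,S}^d(W_g)$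 be the span of the polynomials $$\prod_{i=1}^{d+1}x_i^{-g_i}\ \prod_{i\ne r}D_i^{\nu_i}\Big[x_r^{g_r+n}\prod_{i\ne r}x_i^{g_i+\nu_i}\Big],\qquad \nu\in\mathbb N_0^{\{1,\dots,d+1\}\setminus\{r\}},\ \sum_i\nu_i=n,\ \nu_\ell=0\text{ for }\ell\in S,$$ where $D_i=\partial_{x_i}$ if $r=d+1$, and $D_i=\partial_{x_i}-\partial_{x_r}$ $(i\le d)$, $D_{d+1}=-\partial_{x_r}$ if $r\le d$. Put $H_{n,S}^d(W_g)=\{0\}$ if $|S|\ge d$. Spaces with a negative index $n$ are $\{0\}$. The results below hold for every choice of the indices $r$. For $A\subset\mathbf m_k^+$ let $(\gamma,\mathbf 1_A)\in\mathbb R^{d+1}$ be the vector with entries $\gamma_i$ for $i\le d+1-k$, $1$ for $i\in A$ and $0$ for $i\in\mathbf m_k^+\setminus A$. Define $\mathcal U_0^d(W_{\gamma,-\mathbf 1_k})=\mathrm{span}\{1\}$; if $1\le k\le d$ and $n\ge1$, $$\mathcal U_n^d(W_{\gamma,-\mathbf 1_k})=x_{\mathbf m_k^+}\mathcal V_{n-k}^d\big(W_{(\gamma,\mathbf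 1_{\mathbf m_k^+})}\big)+\sum_{A\subsetneq\mathbf m_k^+}x_A\,H^d_{n-|A|,\ \mathbf m_k^+\setminus A}\big(W_{(\gamma,\mathbf 1_A)}\big);$$ if $k=d+1$ and $n\ge 2$, the same formula holds with the sum restricted to $2\le|A|\le d$; and if $k=d+1$, $n=1$, $$\mathcal U_1^d(W_{-\mathbf 1})=\mathrm{span}\{x_1+c_1,\dots,x_d+c_d\},\qquad c_j=-\frac{\lambda_{j,0}}{\lambda_{0,0}+\lambda_{1,0}+\cdots+\lambda_{d,0}}.$$ Let $\lambda,\lambda_i,\lambda_I,\lambda_{j,0}\ge 0$. Define bilinear forms on $\mathbb R[x_1,\dots,x_d]$ as follows. Put $$B_k(f,g)=\int_{\Sigma_k}f\,g\,x^\gamma\,dx_1\cdots dx_{d-k},\qquad \Sigma_k=\{x\in T^d:x_i=0\ \text{for}\ i\in\mathbf m_k^+\},$$ where $x_{d-k+1}=1-x_1-\cdots-x_{d-k}$ on $\Sigma_k$, and $B_d(f,g)=f(e_1)g(e_1)$. For $k=1$, $$\langle f,g\rangle_{\gamma,-1}=\sum_{i=1}^d\int_{T^d}x_i\,\partial_if\,\partial_ig\,x^\gamma\,dx+\lambda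 B_1(f,g).$$ For $k\ge2$ put $$M_k(f,g)=\int_{T^d}\partial^{\mathbf m_k}f\,\partial^{\mathbf m_k}g\,(1-|x|)^{k-2}x^\gamma\,dx+\sum_{\emptyset\ne I\subsetneq\mathbf m_k}\lambda_I\int_{\{x\in T^d:\,x_\ell=0,\ \ell\in\mathbf m_k\setminus I\}}\partial^If\,\partial^Ig\,(1-|x|)^{|I|-1}x^\gamma,$$ where the integrals over faces are with respect to Lebesgue measure in the remaining variables. For $2\le k\le d$, $$\langle f,g\rangle_{\gamma,-\mathbf 1_k}=M_k(f,g)+\sum_{i=1}^{d-k+1}\lambda_i\int_{\{x\in T^d:\,x_\ell=0,\ \ell\in\mathbf m_k\}}x_i\,\partial_if\,\partial_ig\,x^\gamma\,dx_1\cdots dx_{d-k+1}+\lambda B_k(f,g),$$ and for $k=d+1$, $\ \langle f,g\rangle_{-\mathbf 1}=M_{d+1}(f,g)+\sum_{j=0}^d\lambda_{j,0}f(e_j)g(e_j)$. **Theorem.** (i) $\langle\cdot,\cdot\rangle_{\gamma,-\mathbf 1_k}$ is an inner product on $\mathbb R[x_1,\dots,x_d]$ if those of the parameters $\lambda,\lambda_i,\lambda_I$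 that occur in it are positive and, when $k=d+1$, at least one of $\lambda_{0,0},\dots,\lambda_{d,0}$ is positive. (ii) Whenever $\langle\cdot,\cdot\rangle_{\gamma,-\mathbf 1_k}$ is an inner product (in particular under the conditions in (i)), $\mathcal U_n^d(W_{\gamma,-\mathbf 1_k})$ is, for every $n\ge0$, exactly the space of orthogonal polynomials of degree $n$ for it: the set of all polynomials of degree at most $n$ that are orthogonal to every polynomial of degree at most $n-1$. (iii) If $k=1$ and $n\ge1$, then $\mathcal U_n^d(W_{\gamma,-1})=x_{d+1}\mathcal V_{n-1}^d(W_{(\gamma,1)})\oplus H_{n,\{d+1\}}^d(W_{(\gamma,0)})$ is a direct sum, and its two summands are orthogonal with respect to $\langle\cdot,\cdot\rangle_{\gamma,-1}$. -/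

import Mathlib

open MeasureTheory MvPolynomial

noncomputable section

namespace SimplexSobolev

/-! Indices are zero-based: `Fin d` indexes the coordinates `x_1, …, x_d`, and `Fin (d+1)` indexes
`x_1, …, x_d, x_{d+1}` with `x_{d+1} = 1 - |x|` at position `Fin.last d`. -/

/-- The solid simplex `{u : u_i ≥ 0, ∑ u_i ≤ 1}` in the variables `ι`. -/
def simplex (ι : Type*) [Fintype ι] : Set (ι → ℝ) :=
  {u | (∀ i, 0 ≤ u i) ∧ ∑ i, u i ≤ 1}

/-- The numbers `x_1, …, x_d, x_{d+1} = 1 - |x|`. -/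
def bary {d : ℕ} (x : Fin d → ℝ) : Fin (d + 1) → ℝ :=
  Fin.snoc (α := fun _ => ℝ) x (1 - ∑ i, x i)

/-- `x_1, …, x_d, x_{d+1} = 1 - |x|` as polynomials. -/
def baryPoly (d : ℕ) : Fin (d + 1) → MvPolynomial (Fin d) ℝ :=
  Fin.snoc (α := fun _ => MvPolynomial (Fin d) ℝ) X (1 - ∑ i, X i)

/-- `x_A = ∏_{i ∈ A} x_i` for a set `A` of indices in `{1, …, d+1}`. -/
def baryProd {d : ℕ} (A : Finset (Fin (d + 1))) : MvPolynomial (Fin d) ℝ :=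
  ∏ i ∈ A, baryPoly d i

/-- The vertices `e_0 = 0, e_1, …, e_d` of the simplex. -/
def vertex {d : ℕ} : Fin (d + 1) → (Fin d → ℝ) :=
  Fin.cons (α := fun _ => Fin d → ℝ) 0 (fun j => Pi.single j 1)

/-- The weight `x_1^{g_1} ⋯ x_d^{g_d} (1 - |x|)^{g_{d+1}}`. -/
def weight {d : ℕ} (g : Fin (d + 1) → ℝ) (x : Fin d → ℝ) : ℝ :=
  ∏ i, bary x i ^ g i

/-! ### Orthogonal polynomials -/

/-- `B` is an inner product on the space of real polynomials in `d` variables. -/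
def IsInnerProduct {d : ℕ} (B : MvPolynomial (Fin d) ℝ → MvPolynomial (Fin d) ℝ → ℝ) : Prop :=
  ∃ c : InnerProductSpace.Core ℝ (MvPolynomial (Fin d) ℝ), ∀ f g, c.inner f g = B f g

/-- `p` has degree at most `n` and is `B`-orthogonal to all polynomials of degree at most `n - 1`. -/
def IsOrthogonalPoly {d : ℕ} (B : MvPolynomial (Fin d) ℝ → MvPolynomial (Fin d) ℝ → ℝ)
    (n : ℕ) (p : MvPolynomial (Fin d) ℝ) : Prop :=
  p.totalDegree ≤ n ∧ ∀ q : MvPolynomial (Fin d) ℝ, q.totalDegree < n → B p q = 0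

/-- `∫_{T^d} f q W_g dx` (the normalising constant does not affect orthogonality). -/
def weightForm {d : ℕ} (g : Fin (d + 1) → ℝ) (f q : MvPolynomial (Fin d) ℝ) : ℝ :=
  ∫ x in simplex (Fin d), eval x f * eval x q * weight g x

/-- `V_n^d(W_g)`, the space of orthogonal polynomials of degree `n` for the weight `W_g`
(used for `g_i > -1` only; then the spanning set is itself a subspace). -/
def V {d : ℕ} (n : ℕ) (g : Fin (d + 1) → ℝ) : Submodule ℝ (MvPolynomial (Fin d) ℝ) :=
  Submodule.span ℝ {p | IsOrthogonalPoly (weightForm g) n p}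

/-! ### The Rodrigues formula and the spaces `H` -/

/-- The directions of `∂_1, …, ∂_d`, and `0` for the index `d+1`. -/
def coordDir {d : ℕ} : Fin (d + 1) → (Fin d → ℝ) :=
  Fin.snoc (α := fun _ => Fin d → ℝ) (fun j => Pi.single j 1) 0

/-- The Rodrigues expression in the variables `x_i`, `i ≠ r`, where `ν_r = 0`:
`∏_i x_i^{-g_i} · ∏_{i ≠ r} D_i^{ν_i} [x_r^{g_r + |ν|} ∏_{i ≠ r} x_i^{g_i + ν_i}]`,
where `i` and `r` run over `{1, …, d+1}` and `D_i` is the partial derivative with respect to `x_i`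
when all `x_j`, `j ≠ r`, are taken as independent variables. In the original coordinates,
`D_i = ∂_i` if `r = d+1`; if `r ≤ d`, then `D_i = ∂_i - ∂_r` for `i ≤ d` and `D_{d+1} = -∂_r`. -/
def rodrigues {d : ℕ} (g : Fin (d + 1) → ℝ) (r : Fin (d + 1)) (ν : Fin (d + 1) → ℕ)
    (x : Fin d → ℝ) : ℝ :=
  (∏ i, bary x i ^ (-g i)) *
    (List.finRange (d + 1)).foldr
      (fun i F => (fun (G : (Fin d → ℝ) → ℝ) (y : Fin d → ℝ) =>
        lineDeriv ℝ G y (coordDir i - coordDir r))^[ν i] F)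
      (fun y => ∏ i, bary y i ^ (g i + if i = r then ((∑ j, ν j : ℕ) : ℝ) else (ν i : ℝ))) x

/-- `p` is the polynomial given by the Rodrigues formula (on the open simplex). -/
def IsRodriguesPoly {d : ℕ} (g : Fin (d + 1) → ℝ) (r : Fin (d + 1)) (ν : Fin (d + 1) → ℕ)
    (p : MvPolynomial (Fin d) ℝ) : Prop :=
  ∀ x : Fin d → ℝ, (∀ i, 0 < bary x i) → eval x p = rodrigues g r ν x

/-- `H_{n,S}^d(W_g)`: the span of the Rodrigues polynomials with indices `|ν| = n` and `ν_ℓ = 0` for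
`ℓ ∈ S`, where `r ∉ S` is the index left out; zero by convention if `|S| ≥ d`. -/
def H {d : ℕ} (n : ℕ) (g : Fin (d + 1) → ℝ) (S : Finset (Fin (d + 1))) (r : Fin (d + 1)) :
    Submodule ℝ (MvPolynomial (Fin d) ℝ) :=
  if d ≤ S.card then ⊥
  else Submodule.span ℝ {p | ∃ ν : Fin (d + 1) → ℕ,
    ∑ i, ν i = n ∧ ν r = 0 ∧ (∀ l ∈ S, ν l = 0) ∧ IsRodriguesPoly g r ν p}

/-- `r S` is an admissible index to leave out in the definition of `H_{n,S}`: the index `d+1` if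
`d+1 ∉ S`, and any index outside `S` if `d+1 ∈ S`. -/
def IsPivotChoice {d : ℕ} (r : Finset (Fin (d + 1)) → Fin (d + 1)) : Prop :=
  ∀ S : Finset (Fin (d + 1)), S.card < d → r S ∉ S ∧ (Fin.last d ∉ S → r S = Fin.last d)

/-! ### The spaces `U` -/

/-- The vector `(γ, ε)`: `γ ∈ ℝ^{d+1-k}` followed by the last `k` entries of `ε ∈ ℝ^{d+1}`. -/
def pad {d k : ℕ} (γ : Fin (d + 1 - k) → ℝ) (ε : Fin (d + 1) → ℝ) : Fin (d + 1) → ℝ :=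
  fun i => if h : (i : ℕ) < d + 1 - k then γ ⟨i, h⟩ else ε i

/-- `m_k^+ = {d-k+2, …, d+1}`, the indices of the parameters equal to `-1`. -/
def mPlus (d k : ℕ) : Finset (Fin (d + 1)) :=
  Finset.univ.filter fun i => d + 1 - k ≤ (i : ℕ)

/-- `x_A V_{n-|A|}^d(W_g)`, zero if `n < |A|`. -/
def mulV {d : ℕ} (n : ℕ) (g : Fin (d + 1) → ℝ) (A : Finset (Fin (d + 1))) :
    Submodule ℝ (MvPolynomial (Fin d) ℝ) :=
  if A.card ≤ n then (V (n - A.card) g).map (LinearMap.mulLeft ℝ (baryProd A)) else ⊥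

/-- `x_A H_{n-|A|,S}^d(W_g)`, zero if `n < |A|`. -/
def mulH {d : ℕ} (n : ℕ) (g : Fin (d + 1) → ℝ) (A S : Finset (Fin (d + 1)))
    (r : Finset (Fin (d + 1)) → Fin (d + 1)) : Submodule ℝ (MvPolynomial (Fin d) ℝ) :=
  if A.card ≤ n then (H (n - A.card) g S (r S)).map (LinearMap.mulLeft ℝ (baryProd A)) else ⊥

/-- The indicator vector of `A`. -/
def ind {d : ℕ} (A : Finset (Fin (d + 1))) : Fin (d + 1) → ℝ :=
  fun i => if i ∈ A then 1 else 0

/-- `U_n^d(W_{γ,-1_k})`. The positions of the ones in a permutation of `(0_{k-j}, 1_j)` form a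
subset `A` of `m_k^+` with `j` elements, and the zeros are at `m_k^+ \ A`. `Λ_0, …, Λ_d` are the
coefficients of the values at `e_0, …, e_d`; they matter for `k = d+1` and `n = 1` only. -/
def U {d k : ℕ} (γ : Fin (d + 1 - k) → ℝ) (Λ : Fin (d + 1) → ℝ)
    (r : Finset (Fin (d + 1)) → Fin (d + 1)) (n : ℕ) : Submodule ℝ (MvPolynomial (Fin d) ℝ) :=
  if n = 0 then Submodule.span ℝ {1}
  else if k ≤ d then
    mulV n (pad γ 1) (mPlus d k) ⊔
      ⨆ A ∈ (mPlus d k).ssubsets, mulH n (pad γ (ind A)) A (mPlus d k \ A) r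
  else if n = 1 then
    Submodule.span ℝ (Set.range fun j : Fin d => X j + C (-(Λ j.succ / ∑ i, Λ i)))
  else
    mulV n 1 Finset.univ ⊔
      ⨆ A ∈ (Finset.univ : Finset (Finset (Fin (d + 1)))).filter
        (fun A => 2 ≤ A.card ∧ A.card ≤ d), mulH n (ind A) A Aᶜ r

/-! ### The bilinear forms -/

/-- `m_k = {d-k+2, …, d}`. -/
def mSet (d k : ℕ) : Finset (Fin d) :=
  Finset.univ.filter fun i => d + 1 - k ≤ (i : ℕ)

/-- `x_1^{γ_1} ⋯ x_{d+1-k}^{γ_{d+1-k}}`. -/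
def gpow {d k : ℕ} (γ : Fin (d + 1 - k) → ℝ) (x : Fin d → ℝ) : ℝ :=
  ∏ i : Fin d, if h : (i : ℕ) < d + 1 - k then x i ^ γ ⟨i, h⟩ else 1

/-- `∂^{|I|} f / ∂x^I`, each variable in `I` differentiated once. -/
def pdiff {d : ℕ} (I : Finset (Fin d)) (f : MvPolynomial (Fin d) ℝ) : MvPolynomial (Fin d) ℝ :=
  (List.finRange d).foldr (fun i p => if i ∈ I then pderiv i p else p) f

/-- The integral of `h` over the face of `T^d` on which `x_i = 0` for `i ∉ F`, with respect to
Lebesgue measure in the variables `x_i`, `i ∈ F`. -/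
def faceIntegral {d : ℕ} (F : Finset (Fin d)) (h : (Fin d → ℝ) → ℝ) : ℝ :=
  ∫ u in simplex F, h (fun i => if hi : i ∈ F then u ⟨i, hi⟩ else 0)

/-- The integral of `h` over the face of `T^d` on which `x_{d-k+2} = … = x_d = x_{d+1} = 0`, with
respect to Lebesgue measure in `x_1, …, x_{d-k}`, where `x_{d-k+1} = 1 - x_1 - … - x_{d-k}`. If
`k = d`, the face is the point `e_1` and the value is `h(e_1)`. -/
def topFaceIntegral {d : ℕ} (k : ℕ) (h : (Fin d → ℝ) → ℝ) : ℝ :=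
  ∫ u in simplex (Fin (d - k)), h (fun i =>
    if hi : (i : ℕ) < d - k then u ⟨i, hi⟩ else if (i : ℕ) = d - k then 1 - ∑ j, u j else 0)

/-- The terms with mixed derivatives, for `k ≥ 2`:
`∫_{T^d} ∂^{m_k}f ∂^{m_k}g (1-|x|)^{k-2} x^γ dx`, plus the sum over nonempty proper subsets `I` of
`m_k` of `L_I` times
`∫ ∂^I f ∂^I g (1-|x|)^{|I|-1} x^γ` over the face `x_ℓ = 0`, `ℓ ∈ m_k \ I`. -/
def mixedForm {d k : ℕ} (γ : Fin (d + 1 - k) → ℝ) (L : Finset (Fin d) → ℝ)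
    (f g : MvPolynomial (Fin d) ℝ) : ℝ :=
  (∫ x in simplex (Fin d), eval x (pdiff (mSet d k) f) * eval x (pdiff (mSet d k) g) *
      (1 - ∑ i, x i) ^ (k - 2) * gpow γ x) +
    ∑ I ∈ (mSet d k).ssubsets.filter (fun I => I.Nonempty),
      L I * faceIntegral (mSet d k \ I)ᶜ (fun x =>
        eval x (pdiff I f) * eval x (pdiff I g) * (1 - ∑ i, x i) ^ (I.card - 1) * gpow γ x)

/-- The bilinear form `⟨f, g⟩_{γ,-1_k}` for `1 ≤ k ≤ d+1`, with coefficients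
`l` (integral over the face of `x_1 + ⋯ + x_{d+1-k} = 1`), `a_i` (first derivatives), `L_I`
(mixed derivatives) and `Λ_0, …, Λ_d` (values at `e_0, …, e_d`). -/
def form {d k : ℕ} (γ : Fin (d + 1 - k) → ℝ) (l : ℝ) (a : Fin (d + 1 - k) → ℝ)
    (L : Finset (Fin d) → ℝ) (Λ : Fin (d + 1) → ℝ) (f g : MvPolynomial (Fin d) ℝ) : ℝ :=
  if k = 1 then
    (∑ i : Fin d, ∫ x in simplex (Fin d),
        x i * eval x (pderiv i f) * eval x (pderiv i g) * gpow γ x) +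
      l * topFaceIntegral k (fun x => eval x f * eval x g * gpow γ x)
  else if k ≤ d then
    mixedForm γ L f g +
      (∑ i : Fin d, if h : (i : ℕ) < d + 1 - k then
        a ⟨i, h⟩ * faceIntegral (mSet d k)ᶜ (fun x =>
          x i * eval x (pderiv i f) * eval x (pderiv i g) * gpow γ x) else 0) +
      l * topFaceIntegral k (fun x => eval x f * eval x g * gpow γ x)
  else
    mixedForm γ L f g + ∑ j : Fin (d + 1), Λ j * (eval (vertex j) f * eval (vertex j) g)

end SimplexSobolev

end

open SimplexSobolev

/-!
The proof works in homogeneous coordinates `y_1, …, y_{d+1}`. The homomorphism `dehom`, which sends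
`y_i` to the barycentric coordinate `x_i`, identifies polynomials of degree at most `n` with forms of
degree `n`. By the Dirichlet integral, integration against `∏ x_i^{b_i - 1}` becomes, on forms of a
fixed degree and up to a positive constant, the functional `gammaMoment b`, which sends `y^α` to
`∏ (b_i)_{α_i}`. The functional is defined for all real `b`. When `b_i = 0` it annihilates the
multiples of `y_i`, so that integrals over faces, and for `k = d` the value at `e_1`, are degenerate
cases of one family, and integration by parts is an algebraic identity. The functional
`simplexMoment b` is the integral over the simplex itself, normalised so that `1` has the value `1`,
and `exists_form_eq` expresses the bilinear form by means of it.

In these coordinates the Rodrigues formula becomes the recursion `rodPoly`. If `ν` vanishes on `S`, the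
resulting polynomial does not involve the variables of `S`, and it is orthogonal to lower degree
whatever the exponents at `S` are. Both facts are recorded in `IsFaceOrth`.

*Orthogonality.* Let `x_A h` be one of the summands of `U_n`. In a term of the form that belongs to
the face of `I ⊆ m_k`, three things can happen. If `A` has an index other than `d+1` outside `I`, that
variable vanishes on the face. If `I` has an index outside `A` and `d+1 ∉ A`, the derivative
annihilates `x_A h`. In the remaining cases integration by parts reduces the term to the orthogonality
of `h` for the weight `(γ, 1_A)`. This is `IsSummand.momentForm_eq_zero`.

*Spanning.* A polynomial `x_A p` is congruent modulo lower degree to a combination of summands: on the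
face where the variables of `m_k^+ \ A` vanish, the Rodrigues polynomials span modulo lower degree,
by duality with the monomials in all variables but one, and the error has the form `x_i x_A q`
with `i ∉ A`, to which induction applies (`baryProd_mul_mem`). For an inner product, orthogonality and
spanning determine the space (`mem_U_iff_of_le`).

*Positivity.* The form is a sum of squares. If it vanishes at `f`, each square gives the vanishing of
the monomials of `f` with a given set of variables from `m_k`, and the last terms of the form give the
vanishing of the constant term (`momentForm_self`).

*The case `k = 1`.* After integration by parts, the mixed inner product of `x_{d+1} v` with an
orthogonal polynomial `h` for `(γ, 0)` contains `∑ (y_i ∂_i^2 + b_i ∂_i) h`. This form has degree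
`n - 1` and is orthogonal to itself, hence is zero (`sum_X_mul_pderiv_pderiv_eq_zero`).
-/

noncomputable section

namespace SimplexSobolev

/-! ### Polynomials of bounded degree -/

section Degree

variable {σ : Type*}

/-- The polynomials all of whose monomials have degree less than `n`; for `n = 0` the zero space. -/
def degLT (σ : Type*) (n : ℕ) : Submodule ℝ (MvPolynomial σ ℝ) :=
  restrictSupport ℝ {α | α.degree < n}

lemma mem_degLT {n : ℕ} {p : MvPolynomial σ ℝ} :
    p ∈ degLT σ n ↔ ∀ α : σ →₀ ℕ, n ≤ α.degree → coeff α p = 0 := by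
  rw [degLT, mem_restrictSupport_iff]
  constructor
  · intro h α hα
    by_contra hc
    exact absurd (h (Finset.mem_coe.2 (mem_support_iff.2 hc))) (not_lt.2 hα)
  · intro h α hα
    by_contra hc
    exact (mem_support_iff.1 (Finset.mem_coe.1 hα)) (h α (not_lt.1 hc))

lemma mem_degLT_succ {n : ℕ} {p : MvPolynomial σ ℝ} :
    p ∈ degLT σ (n + 1) ↔ p.totalDegree ≤ n := by
  rw [degLT, mem_restrictSupport_iff, totalDegree, Finset.sup_le_iff]
  exact forall₂_congr fun α _ => by
    rw [Set.mem_ofPred_eq, Nat.lt_succ_iff]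
    rfl

lemma mem_degLT_zero {p : MvPolynomial σ ℝ} : p ∈ degLT σ 0 ↔ p = 0 := by
  rw [mem_degLT]
  exact ⟨fun h => by ext α; simpa using h α (Nat.zero_le _), fun h => by simp [h]⟩

lemma mem_degLT_of_totalDegree_lt {n : ℕ} {p : MvPolynomial σ ℝ} (h : p.totalDegree < n) :
    p ∈ degLT σ n := by
  obtain ⟨m, rfl⟩ : ∃ m, n = m + 1 := ⟨n - 1, by omega⟩
  exact mem_degLT_succ.2 (by omega)

lemma degLT_mono {m n : ℕ} (h : m ≤ n) : degLT σ m ≤ degLT σ n := fun _ hp =>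
  mem_degLT.2 fun α hα => mem_degLT.1 hp α (h.trans hα)

lemma mul_mem_degLT {m n : ℕ} {p q : MvPolynomial σ ℝ} (hp : p ∈ degLT σ (m + 1))
    (hq : q ∈ degLT σ n) : p * q ∈ degLT σ (m + n) := by
  cases n with
  | zero => rw [mem_degLT_zero.1 hq, mul_zero]; exact zero_mem _
  | succ n =>
    rw [← add_assoc, mem_degLT_succ]
    exact (totalDegree_mul p q).trans (add_le_add (mem_degLT_succ.1 hp) (mem_degLT_succ.1 hq))

lemma X_mul_mem_degLT {n : ℕ} (i : σ) {q : MvPolynomial σ ℝ} (hq : q ∈ degLT σ n) :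
    X i * q ∈ degLT σ (n + 1) := by
  rw [add_comm]
  exact mul_mem_degLT (mem_degLT_succ.2 (totalDegree_X i).le) hq

lemma pderiv_mem_degLT {n : ℕ} (i : σ) {q : MvPolynomial σ ℝ} (hq : q ∈ degLT σ n) :
    pderiv i q ∈ degLT σ (n - 1) := by
  rw [mem_degLT] at hq ⊢
  intro α hα
  rw [coeff_pderiv, hq _ (by simp only [map_add, Finsupp.degree_single]; omega), zero_mul]

lemma IsHomogeneous.mem_degLT {n : ℕ} {p : MvPolynomial σ ℝ} (hp : p.IsHomogeneous n) :
    p ∈ degLT σ (n + 1) := mem_degLT_succ.2 hp.totalDegree_le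

lemma IsHomogeneous.X_mul_pderiv {n : ℕ} {p : MvPolynomial σ ℝ} (hp : p.IsHomogeneous n)
    (i j : σ) : (X i * pderiv j p).IsHomogeneous n := by
  cases n with
  | zero =>
    rw [totalDegree_eq_zero_iff_eq_C.1 (Nat.le_zero.1 hp.totalDegree_le), pderiv_C, mul_zero]
    exact isHomogeneous_zero _ _ _
  | succ n =>
    have := (isHomogeneous_X ℝ i).mul (hp.pderiv (i := j))
    rwa [Nat.add_sub_cancel, add_comm] at this

lemma pderiv_pderiv_comm (i j : σ) (p : MvPolynomial σ ℝ) :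
    pderiv i (pderiv j p) = pderiv j (pderiv i p) := by
  ext α
  rcases eq_or_ne i j with rfl | h
  · rfl
  · simp only [coeff_pderiv, Finsupp.add_apply, Finsupp.single_eq_of_ne h,
      Finsupp.single_eq_of_ne h.symm, add_right_comm α]
    push_cast
    ring

end Degree

/-! ### The moment functional of a product of Gamma weights -/

section Moment

variable {σ : Type*} [Fintype σ]

/-- The linear functional with moments `y^α ↦ ∏ i, (b_i)_{α_i}` (rising factorials). For `b_i > 0`
it is, up to a constant, integration against `∏ y_i^{b_i - 1} e^{-y_i}` over the positive orthant;
the value `b_i = 0` stands for the restriction to the hyperplane `y_i = 0`. -/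
def gammaMoment (b : σ → ℝ) : MvPolynomial σ ℝ →ₗ[ℝ] ℝ :=
  (basisMonomials σ ℝ).constr ℝ fun α => ∏ i, (ascPochhammer ℝ (α i)).eval (b i)

lemma gammaMoment_monomial (b : σ → ℝ) (α : σ →₀ ℕ) (c : ℝ) :
    gammaMoment b (monomial α c) = c * ∏ i, (ascPochhammer ℝ (α i)).eval (b i) := by
  have h : monomial α c = c • basisMonomials σ ℝ α := by
    rw [coe_basisMonomials, smul_monomial, smul_eq_mul, mul_one]
  rw [h, map_smul, gammaMoment, Module.Basis.constr_basis, smul_eq_mul]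

lemma ascPochhammer_succ_eval_left (n : ℕ) (x : ℝ) :
    (ascPochhammer ℝ (n + 1)).eval x = x * (ascPochhammer ℝ n).eval (x + 1) := by
  simp [ascPochhammer_succ_left]

variable [DecidableEq σ]

lemma prod_ascPochhammer_erase (b : σ → ℝ) (α : σ → ℕ) (i : σ) :
    ∏ j, (ascPochhammer ℝ (α j)).eval (b j) =
      (ascPochhammer ℝ (α i)).eval (b i) *
        ∏ j ∈ Finset.univ.erase i, (ascPochhammer ℝ (α j)).eval (b j) :=
  (Finset.mul_prod_erase _ _ (Finset.mem_univ i)).symm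

lemma gammaMoment_X_mul (b : σ → ℝ) (i : σ) (u : MvPolynomial σ ℝ) :
    gammaMoment b (X i * u) = b i * gammaMoment (b + Pi.single i 1) u := by
  induction u using MvPolynomial.induction_on' with
  | add p q hp hq => rw [mul_add, map_add, map_add, hp, hq, mul_add]
  | monomial α c =>
    rw [X, monomial_mul, one_mul, gammaMoment_monomial, gammaMoment_monomial,
      prod_ascPochhammer_erase _ _ i, prod_ascPochhammer_erase _ (⇑α) i]
    have h : ∏ j ∈ Finset.univ.erase i,
        (ascPochhammer ℝ ((Finsupp.single i 1 + α : σ →₀ ℕ) j)).eval (b j) =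
        ∏ j ∈ Finset.univ.erase i,
          (ascPochhammer ℝ (α j)).eval ((b + Pi.single i 1 : σ → ℝ) j) := by
      refine Finset.prod_congr rfl fun j hj => ?_
      simp [Finset.ne_of_mem_erase hj]
    rw [h]
    simp only [Finsupp.add_apply, Finsupp.single_eq_same, Pi.add_apply, Pi.single_eq_same]
    rw [add_comm 1, ascPochhammer_succ_eval_left]
    ring

/-- Integration by parts in the variable `y_i`. -/
lemma gammaMoment_pderiv (b : σ → ℝ) (i : σ) (u : MvPolynomial σ ℝ) :
    gammaMoment (b + Pi.single i 1) (pderiv i u) =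
      gammaMoment (b + Pi.single i 1) u - gammaMoment b u := by
  induction u using MvPolynomial.induction_on' with
  | add p q hp hq => simp only [map_add, hp, hq]; ring
  | monomial α c =>
    rw [pderiv_monomial, gammaMoment_monomial, gammaMoment_monomial, gammaMoment_monomial,
      prod_ascPochhammer_erase _ _ i, prod_ascPochhammer_erase _ (⇑α) i,
      prod_ascPochhammer_erase b (⇑α) i]
    have h1 : ∏ j ∈ Finset.univ.erase i,
        (ascPochhammer ℝ ((α - Finsupp.single i 1 : σ →₀ ℕ) j)).eval ((b + Pi.single i 1 : σ → ℝ) j) =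
        ∏ j ∈ Finset.univ.erase i, (ascPochhammer ℝ (α j)).eval (b j) := by
      refine Finset.prod_congr rfl fun j hj => ?_
      simp [Finset.ne_of_mem_erase hj]
    have h2 : ∏ j ∈ Finset.univ.erase i,
        (ascPochhammer ℝ (α j)).eval ((b + Pi.single i 1 : σ → ℝ) j) =
        ∏ j ∈ Finset.univ.erase i, (ascPochhammer ℝ (α j)).eval (b j) := by
      refine Finset.prod_congr rfl fun j hj => ?_
      simp [Finset.ne_of_mem_erase hj]
    rw [h1, h2]
    simp only [Finsupp.tsub_apply, Finsupp.single_eq_same, Pi.add_apply, Pi.single_eq_same]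
    rcases Nat.eq_zero_or_pos (α i) with h0 | hpos
    · simp [h0]
    · obtain ⟨n, hn⟩ : ∃ n, α i = n + 1 := ⟨α i - 1, by omega⟩
      rw [hn, Nat.add_sub_cancel, ascPochhammer_succ_eval_left n (b i), ascPochhammer_succ_eval]
      push_cast
      ring

lemma gammaMoment_X_mul_pderiv (b : σ → ℝ) (i : σ) (u : MvPolynomial σ ℝ) :
    gammaMoment b (X i * pderiv i u) = gammaMoment b (X i * u) - b i * gammaMoment b u := by
  rw [gammaMoment_X_mul, gammaMoment_pderiv, gammaMoment_X_mul, mul_sub]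

lemma gammaMoment_eq_zero_of_X_dvd {b : σ → ℝ} {i : σ} (hb : b i = 0) {u : MvPolynomial σ ℝ}
    (hu : X i ∣ u) : gammaMoment b u = 0 := by
  obtain ⟨v, rfl⟩ := hu
  rw [gammaMoment_X_mul, hb, zero_mul]

end Moment

/-! ### The Rodrigues polynomials in homogeneous coordinates -/

section Rodrigues

variable {σ : Type*} [DecidableEq σ]

/-- The homogeneous polynomial `P` with
`y^{b-1} P = ∏_{i ∈ L} (∂_i - ∂_r) [y^{b-1} ∏_{i ∈ L} y_i y_r]`. -/
def rodPoly (r : σ) : List σ → (σ → ℝ) → MvPolynomial σ ℝ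
  | [], _ => 1
  | i :: L, b =>
    C (b i) * (X r * rodPoly r L (b + Pi.single i 1 + Pi.single r 1)) -
      C (b r) * (X i * rodPoly r L (b + Pi.single i 1 + Pi.single r 1)) +
      X i * (X r * pderiv i (rodPoly r L (b + Pi.single i 1 + Pi.single r 1)) -
        X r * pderiv r (rodPoly r L (b + Pi.single i 1 + Pi.single r 1)))

lemma rodPoly_isHomogeneous (r : σ) (L : List σ) (b : σ → ℝ) :
    (rodPoly r L b).IsHomogeneous L.length := by
  induction L generalizing b with
  | nil => exact isHomogeneous_one _ _
  | cons i L ih =>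
    have h := ih (b + Pi.single i 1 + Pi.single r 1)
    rw [rodPoly, List.length_cons]
    have hX : ∀ (j : σ) {p : MvPolynomial σ ℝ}, p.IsHomogeneous L.length →
        (X j * p).IsHomogeneous (L.length + 1) := fun j p hp => by
      rw [add_comm]; exact (isHomogeneous_X ℝ j).mul hp
    have hC : ∀ (c : ℝ) {p : MvPolynomial σ ℝ}, p.IsHomogeneous (L.length + 1) →
        (C c * p).IsHomogeneous (L.length + 1) := fun c p hp => by
      simpa using (isHomogeneous_C σ c).mul hp
    exact ((hC _ (hX r h)).sub (hC _ (hX i h))).add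
      (hX i ((IsHomogeneous.X_mul_pderiv h r i).sub (IsHomogeneous.X_mul_pderiv h r r)))

lemma pderiv_rodPoly_eq_zero {r j : σ} {L : List σ} (hr : j ≠ r) (hL : j ∉ L) (b : σ → ℝ) :
    pderiv j (rodPoly r L b) = 0 := by
  induction L generalizing b with
  | nil => exact pderiv_one
  | cons i L ih =>
    obtain ⟨hi, hL⟩ := not_or.1 (mt List.mem_cons.2 hL)
    have h := ih hL (b + Pi.single i 1 + Pi.single r 1)
    rw [rodPoly]
    simp only [map_add, map_sub, pderiv_mul, pderiv_C, pderiv_X_of_ne hr.symm,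
      pderiv_X_of_ne (Ne.symm hi), h, pderiv_pderiv_comm j, map_zero]
    ring

lemma rodPoly_congr {r : σ} {L : List σ} {b b' : σ → ℝ} (hr : b r = b' r)
    (hL : ∀ i ∈ L, b i = b' i) : rodPoly r L b = rodPoly r L b' := by
  induction L generalizing b b' with
  | nil => rfl
  | cons i L ih =>
    have hi : b i = b' i := hL i (by simp)
    have h : rodPoly r L (b + Pi.single i 1 + Pi.single r 1) =
        rodPoly r L (b' + Pi.single i 1 + Pi.single r 1) :=
      ih (by simp [hr]) fun j hj => by simp [hL j (by simp [hj])]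
    rw [rodPoly, rodPoly, h, hr, hi]

variable [Fintype σ]

lemma gammaMoment_rodPoly_cons (b : σ → ℝ) (i r : σ) (hir : i ≠ r) (L : List σ)
    (q : MvPolynomial σ ℝ) :
    gammaMoment b (rodPoly r (i :: L) b * q) =
      -(b i * b r * gammaMoment (b + Pi.single i 1 + Pi.single r 1)
        (rodPoly r L (b + Pi.single i 1 + Pi.single r 1) * (pderiv i q - pderiv r q))) := by
  rw [rodPoly]
  set P := rodPoly r L (b + Pi.single i 1 + Pi.single r 1)
  have hi := gammaMoment_X_mul_pderiv b i (X r * P * q)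
  have hr := gammaMoment_X_mul_pderiv b r (X i * P * q)
  have hs : gammaMoment b (X i * (X r * (P * (pderiv i q - pderiv r q)))) =
      b i * b r * gammaMoment (b + Pi.single i 1 + Pi.single r 1)
        (P * (pderiv i q - pderiv r q)) := by
    rw [gammaMoment_X_mul, gammaMoment_X_mul]
    simp [hir.symm, mul_assoc]
  have e1 : (C (b i) * (X r * P) - C (b r) * (X i * P) +
      X i * (X r * pderiv i P - X r * pderiv r P)) * q =
      b i • (X r * P * q) - b r • (X i * P * q) + X i * pderiv i (X r * P * q) -
        X r * pderiv r (X i * P * q) - X i * (X r * (P * (pderiv i q - pderiv r q))) := by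
    simp only [smul_eq_C_mul, pderiv_mul, pderiv_X_of_ne hir, pderiv_X_of_ne hir.symm]
    ring
  rw [e1, map_sub, map_sub, map_add, map_sub, map_smul, map_smul, hi, hr, hs, smul_eq_mul,
    smul_eq_mul, show X i * (X r * P * q) = X r * (X i * P * q) by ring]
  ring

/-- The Rodrigues polynomials are orthogonal to all polynomials of lower degree, whatever the
weight in the variables they do not involve. -/
lemma gammaMoment_rodPoly_mul_eq_zero {r : σ} {L : List σ} (hr : r ∉ L) (b : σ → ℝ)
    {q : MvPolynomial σ ℝ} (hq : q ∈ degLT σ L.length) :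
    gammaMoment b (rodPoly r L b * q) = 0 := by
  induction L generalizing b q with
  | nil => rw [mem_degLT_zero.1 hq, mul_zero, map_zero]
  | cons i L ih =>
    obtain ⟨hi, hL⟩ := not_or.1 (mt List.mem_cons.2 hr)
    have h : ∀ j, pderiv j q ∈ degLT σ L.length := fun j => by
      simpa using pderiv_mem_degLT j hq
    rw [gammaMoment_rodPoly_cons b i r (Ne.symm hi), ih hL _ (sub_mem (h i) (h r)), mul_zero,
      neg_zero]

/-- The Rodrigues polynomials are dual to the monomials without the variable `y_r`. -/
lemma exists_gammaMoment_rodPoly_monomial {r : σ} {L : List σ} (hr : r ∉ L) {b : σ → ℝ}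
    (hb : ∀ i, 0 < b i) : ∃ c : ℝ, c ≠ 0 ∧ ∀ μ : σ →₀ ℕ, μ r = 0 → μ.degree = L.length →
      gammaMoment b (rodPoly r L b * monomial μ 1) =
        if ∀ i, μ i = L.count i then c else 0 := by
  induction L generalizing b with
  | nil =>
    refine ⟨1, one_ne_zero, fun μ _ hμ => ?_⟩
    obtain rfl : μ = 0 := (Finsupp.degree_eq_zero_iff μ).1 hμ
    simp [rodPoly, one_def, gammaMoment_monomial, -monomial_zero']
  | cons i L ih =>
    obtain ⟨hi, hL⟩ := not_or.1 (mt List.mem_cons.2 hr)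
    have hb' : ∀ j, 0 < (b + Pi.single i 1 + Pi.single r 1 : σ → ℝ) j := fun j => by
      have h1 : 0 ≤ Pi.single (M := fun _ => ℝ) i 1 j := by rw [Pi.single_apply]; split_ifs <;> simp
      have h2 : 0 ≤ Pi.single (M := fun _ => ℝ) r 1 j := by rw [Pi.single_apply]; split_ifs <;> simp
      simp only [Pi.add_apply]
      linarith [hb j]
    obtain ⟨c, hc, h⟩ := ih hL hb'
    refine ⟨-(b i * b r * ((L.count i + 1 : ℕ) * c)), ?_, fun μ hμr hμ => ?_⟩
    · exact neg_ne_zero.2 (mul_ne_zero (mul_ne_zero (hb i).ne' (hb r).ne')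
        (mul_ne_zero (Nat.cast_ne_zero.2 (Nat.succ_ne_zero _)) hc))
    · rw [gammaMoment_rodPoly_cons b i r (Ne.symm hi), pderiv_monomial, pderiv_monomial, hμr]
      rw [Nat.cast_zero, mul_zero, monomial_zero, sub_zero, one_mul]
      rcases Nat.eq_zero_or_pos (μ i) with h0 | hpos
      · rw [h0, Nat.cast_zero, monomial_zero, mul_zero, map_zero, mul_zero, neg_zero, if_neg]
        intro hall
        have := hall i
        simp [h0] at this
      · have hle : Finsupp.single i 1 ≤ μ := Finsupp.single_le_iff.2 hpos
        have hμ' : μ = (μ - Finsupp.single i 1) + Finsupp.single i 1 :=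
          (tsub_add_cancel_of_le hle).symm
        have e : monomial (μ - Finsupp.single i 1) (μ i : ℝ) =
            (μ i : ℝ) • monomial (μ - Finsupp.single i 1) (1 : ℝ) := by
          rw [smul_monomial, smul_eq_mul, mul_one]
        rw [e, mul_smul_comm, map_smul, h _ (by simp [hμr]) (by
          rw [hμ', map_add, Finsupp.degree_single, List.length_cons] at hμ
          omega), smul_eq_mul]
        have hiff : (∀ j, (μ - Finsupp.single i 1 : σ →₀ ℕ) j = L.count j) ↔
            ∀ j, μ j = (i :: L).count j := by
          refine forall_congr' fun j => ?_
          rcases eq_or_ne i j with rfl | hij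
          · simp; omega
          · simp [hij, Finsupp.single_eq_of_ne hij.symm]
        by_cases hall : ∀ j, μ j = (i :: L).count j
        · rw [if_pos (hiff.2 hall), if_pos hall, hall i, List.count_cons_self]
        · rw [if_neg (mt hiff.1 hall), if_neg hall]
          simp

end Rodrigues

/-! ### Rodrigues polynomials span modulo the sum of the variables -/

/-- Orthogonal projection to a finite-dimensional subspace on which a bilinear form is definite. -/
lemma exists_mem_forall_apply_sub_eq_zero {V : Type*} [AddCommGroup V] [Module ℝ V]
    (B : V →ₗ[ℝ] V →ₗ[ℝ] ℝ) (K : Submodule ℝ V) [FiniteDimensional ℝ K]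
    (hB : ∀ k ∈ K, B k k = 0 → k = 0) (v : V) : ∃ k ∈ K, ∀ w ∈ K, B (v - k) w = 0 := by
  let F : K →ₗ[ℝ] Module.Dual ℝ K := (B.domRestrict₁₂ K K)
  have hinj : Function.Injective F := by
    rw [← LinearMap.ker_eq_bot, LinearMap.ker_eq_bot']
    intro k hk
    exact Subtype.ext (hB k k.2 (DFunLike.congr_fun hk k))
  have hsurj : Function.Surjective F :=
    (LinearMap.injective_iff_surjective_of_finrank_eq_finrank
      Subspace.dual_finrank_eq.symm).1 hinj
  obtain ⟨k, hk⟩ := hsurj ((B v).domRestrict K)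
  refine ⟨k, k.2, fun w hw => ?_⟩
  have := DFunLike.congr_fun hk ⟨w, hw⟩
  rw [map_sub, LinearMap.sub_apply, sub_eq_zero]
  exact this.symm

section Span

variable {σ : Type*}

/-- The polynomials in the variables `y_i`, `i ∈ T`, homogeneous of degree `m`. -/
def homOn (T : Finset σ) (m : ℕ) : Submodule ℝ (MvPolynomial σ ℝ) :=
  restrictSupport ℝ {α | α.degree = m ∧ ∀ i ∉ T, α i = 0}

/-- The polynomials in the variables `y_i`, `i ∈ T`, homogeneous of degree `m - 1`; zero if
`m = 0`. -/
def homOnPred (T : Finset σ) (m : ℕ) : Submodule ℝ (MvPolynomial σ ℝ) :=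
  restrictSupport ℝ {α | α.degree + 1 = m ∧ ∀ i ∉ T, α i = 0}

lemma restrictSupport_induction {s : Set (σ →₀ ℕ)} {K : Submodule ℝ (MvPolynomial σ ℝ)}
    (h : ∀ α ∈ s, monomial α 1 ∈ K) : restrictSupport ℝ s ≤ K := by
  rw [restrictSupport_eq_span, Submodule.span_le]
  rintro _ ⟨α, hα, rfl⟩
  exact h α hα

lemma mem_restrictSupport {s : Set (σ →₀ ℕ)} {p : MvPolynomial σ ℝ} :
    p ∈ restrictSupport ℝ s ↔ ∀ α, coeff α p ≠ 0 → α ∈ s := by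
  rw [mem_restrictSupport_iff]
  exact forall_congr' fun α => by rw [Finset.mem_coe, mem_support_iff]

lemma mem_homOn {T : Finset σ} {m : ℕ} {p : MvPolynomial σ ℝ} :
    p ∈ homOn T m ↔ p.IsHomogeneous m ∧ ∀ i ∉ T, pderiv i p = 0 := by
  rw [homOn, mem_restrictSupport]
  constructor
  · refine fun h => ⟨fun α hα => ?_, fun i hi => ?_⟩
    · exact (DFunLike.congr_fun Finsupp.degree_eq_weight_one α).symm.trans (h α hα).1
    · ext α
      rw [coeff_pderiv, coeff_zero]
      by_contra hc
      simpa using (h _ (left_ne_zero_of_mul hc)).2 i hi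
  · rintro ⟨h1, h2⟩ α hα
    refine ⟨by rw [Finsupp.degree_eq_weight_one]; exact h1 hα, fun i hi => ?_⟩
    by_contra hc
    have hle : Finsupp.single i 1 ≤ α := Finsupp.single_le_iff.2 (Nat.pos_of_ne_zero hc)
    have := coeff_pderiv (i := i) p (α - Finsupp.single i 1)
    rw [h2 i hi, coeff_zero, tsub_add_cancel_of_le hle] at this
    exact (mul_ne_zero hα (by positivity)) this.symm

lemma homOnPred_succ (T : Finset σ) (m : ℕ) : homOnPred T (m + 1) = homOn T m := by
  simp only [homOnPred, homOn, Nat.add_right_cancel_iff]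

lemma homOnPred_zero (T : Finset σ) : homOnPred T 0 = ⊥ := by
  simp only [homOnPred, Nat.add_eq_zero_iff, one_ne_zero, and_false, false_and]
  rw [eq_bot_iff]
  exact restrictSupport_induction fun α hα => hα.elim

lemma mul_mem_homOn {T : Finset σ} {m n : ℕ} {p q : MvPolynomial σ ℝ} (hp : p ∈ homOn T m)
    (hq : q ∈ homOn T n) : p * q ∈ homOn T (m + n) := by
  rw [mem_homOn] at hp hq ⊢
  refine ⟨hp.1.mul hq.1, fun i hi => ?_⟩
  rw [pderiv_mul, hp.2 i hi, hq.2 i hi, zero_mul, mul_zero, add_zero]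

lemma sum_X_mem_homOn (T : Finset σ) : ∑ i ∈ T, X i ∈ homOn T 1 := by
  refine mem_homOn.2 ⟨IsHomogeneous.sum _ _ _ fun i _ => isHomogeneous_X ℝ i, fun i hi => ?_⟩
  rw [map_sum]
  exact Finset.sum_eq_zero fun j hj => pderiv_X_of_ne (ne_of_mem_of_not_mem hj hi)

lemma sum_X_mul_mem_homOn {T : Finset σ} {m : ℕ} {t : MvPolynomial σ ℝ}
    (ht : t ∈ homOnPred T m) : (∑ i ∈ T, X i) * t ∈ homOn T m := by
  cases m with
  | zero =>
    rw [homOnPred_zero, Submodule.mem_bot] at ht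
    rw [ht, mul_zero]
    exact zero_mem _
  | succ m =>
    rw [homOnPred_succ] at ht
    rw [add_comm]
    exact mul_mem_homOn (sum_X_mem_homOn T) ht

lemma rodPoly_mem_homOn [DecidableEq σ] {T : Finset σ} {r : σ} {L : List σ} (hr : r ∈ T)
    (hL : ∀ i ∈ L, i ∈ T) (b : σ → ℝ) : rodPoly r L b ∈ homOn T L.length :=
  mem_homOn.2 ⟨rodPoly_isHomogeneous r L b, fun _ hi =>
    pderiv_rodPoly_eq_zero (ne_of_mem_of_not_mem hr hi).symm (mt (hL _) hi) b⟩

/-- Modulo the sum of the variables, one of them can be eliminated. -/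
lemma homOn_le_sup [DecidableEq σ] {T : Finset σ} {r : σ} (hr : r ∈ T) (m : ℕ) :
    homOn T m ≤ (homOnPred T m).map (LinearMap.mulLeft ℝ (∑ i ∈ T, X i)) ⊔
      homOn (T.erase r) m := by
  set K := (homOnPred T m).map (LinearMap.mulLeft ℝ (∑ i ∈ T, X i)) ⊔ homOn (T.erase r) m
  suffices h : ∀ (j : ℕ) (α : σ →₀ ℕ), α r = j → α.degree = m → (∀ i ∉ T, α i = 0) →
      monomial α (1 : ℝ) ∈ K from
    restrictSupport_induction fun α hα => h _ α rfl hα.1 hα.2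
  intro j
  induction j with
  | zero =>
    intro α hj hm hT
    refine Submodule.mem_sup_right ((monomial_mem_restrictSupport ℝ).2 (Or.inl ⟨hm, fun i hi => ?_⟩))
    rcases eq_or_ne i r with rfl | hne
    · exact hj
    · exact hT i fun hiT => hi (Finset.mem_erase.2 ⟨hne, hiT⟩)
  | succ j ih =>
    intro α hj hm hT
    have hle : Finsupp.single r 1 ≤ α := Finsupp.single_le_iff.2 (by omega)
    set β := α - Finsupp.single r 1
    have hβ : α = Finsupp.single r 1 + β := (add_tsub_cancel_of_le hle).symm
    have hβr : β r = j := by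
      have := congrArg (· r) hβ
      simp only [Finsupp.add_apply, Finsupp.single_eq_same] at this
      omega
    have hβm : β.degree + 1 = m := by
      rw [← hm, hβ, map_add, Finsupp.degree_single, add_comm]
    have hβT : ∀ i ∉ T, β i = 0 := fun i hi => by
      have := congrArg (· i) hβ
      simp only [Finsupp.add_apply, hT i hi] at this
      omega
    have e : monomial α (1 : ℝ) = (∑ i ∈ T, X i) * monomial β 1 -
        ∑ i ∈ T.erase r, X i * monomial β 1 := by
      rw [← Finset.sum_mul, ← Finset.add_sum_erase T _ hr, add_mul, add_sub_cancel_right, X,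
        monomial_mul, one_mul, hβ]
    rw [e]
    refine sub_mem (Submodule.mem_sup_left (Submodule.mem_map_of_mem
      ((monomial_mem_restrictSupport ℝ).2 (Or.inl ⟨hβm, hβT⟩)))) (sum_mem fun i hi => ?_)
    obtain ⟨hir, hiT⟩ := Finset.mem_erase.1 hi
    rw [X, monomial_mul, one_mul]
    refine ih _ ?_ ?_ fun l hl => ?_
    · rw [Finsupp.add_apply, Finsupp.single_eq_of_ne (Ne.symm hir), hβr, zero_add]
    · rw [map_add, Finsupp.degree_single, add_comm, hβm]
    · rw [Finsupp.add_apply, hβT l hl, Finsupp.single_eq_of_ne (ne_of_mem_of_not_mem hiT hl).symm]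

lemma finiteDimensional_restrictSupport {s : Set (σ →₀ ℕ)} (hs : s.Finite) :
    FiniteDimensional ℝ (restrictSupport ℝ s) := by
  rw [restrictSupport_eq_span]
  exact FiniteDimensional.span_of_finite ℝ (hs.image _)

variable [Fintype σ]

lemma finite_degree_eq (m : ℕ) : {α : σ →₀ ℕ | α.degree = m}.Finite := by
  classical
  refine (Finset.finite_toSet (Finset.finsuppAntidiag Finset.univ m)).subset fun α hα => ?_
  rw [Finset.mem_coe, Finset.mem_finsuppAntidiag, ← Finsupp.degree_eq_sum]
  exact ⟨hα, Finset.subset_univ _⟩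

instance (T : Finset σ) (m : ℕ) : FiniteDimensional ℝ (homOnPred T m) :=
  finiteDimensional_restrictSupport ((finite_degree_eq (m - 1)).subset fun α hα => by
    have := hα.1
    change α.degree = m - 1
    omega)

instance (n : ℕ) : FiniteDimensional ℝ (degLT σ n) := by
  refine finiteDimensional_restrictSupport (((Set.finite_lt_nat n).biUnion
    fun m _ => finite_degree_eq (σ := σ) m).subset fun α hα => ?_)
  simp only [Set.mem_iUnion]
  exact ⟨α.degree, hα, rfl⟩

variable [DecidableEq σ]

/-- Multiplication by the sum of the variables only changes the moments by a constant (Euler's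
identity). -/
lemma exists_gammaMoment_sum_X_mul (b : σ → ℝ) (T : Finset σ) (m : ℕ) :
    ∃ c : ℝ, ∀ t ∈ homOn T m,
      gammaMoment b ((∑ i ∈ T, X i) * t) = c * gammaMoment b t := by
  refine ⟨m + ∑ i ∈ T, b i, fun t ht => ?_⟩
  suffices h : homOn T m ≤ LinearMap.ker (gammaMoment b ∘ₗ LinearMap.mulLeft ℝ (∑ i ∈ T, X i) -
      ((m : ℝ) + ∑ i ∈ T, b i) • gammaMoment b) from by
    have := h ht
    rw [LinearMap.mem_ker, LinearMap.sub_apply, sub_eq_zero] at this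
    exact this
  refine restrictSupport_induction fun α hα => ?_
  have hm : (m : ℝ) = ∑ i ∈ T, (α i : ℝ) := by
    rw [← hα.1, Finsupp.degree_eq_sum, Nat.cast_sum]
    exact (Finset.sum_subset (Finset.subset_univ T) fun i _ hi => by
      rw [hα.2 i hi, Nat.cast_zero]).symm
  rw [LinearMap.mem_ker, LinearMap.sub_apply, sub_eq_zero, LinearMap.comp_apply,
    LinearMap.mulLeft_apply, LinearMap.smul_apply, Finset.sum_mul, map_sum, hm,
    ← Finset.sum_add_distrib, smul_eq_mul, Finset.sum_mul]
  refine Finset.sum_congr rfl fun i _ => ?_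
  have h := gammaMoment_X_mul_pderiv b i (monomial α 1)
  rw [X_mul_pderiv_monomial, map_nsmul, nsmul_eq_mul] at h
  linarith

/-- The Rodrigues polynomials of degree `m` in the variables `y_i`, `i ∈ T`, span all homogeneous
polynomials modulo the multiples of the sum of the variables. `l μ` is a list in which `i` occurs
`μ i` times. -/
lemma exists_mem_span_rodPoly {T : Finset σ} {r : σ} (hr : r ∈ T) {b : σ → ℝ}
    (hb : ∀ i, 0 < b i) {m : ℕ}
    (hpos : ∀ z : MvPolynomial σ ℝ, z.IsHomogeneous m → gammaMoment b (z * z) = 0 → z = 0)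
    (l : (σ →₀ ℕ) → List σ) (hl : ∀ μ i, (l μ).count i = μ i)
    {q : MvPolynomial σ ℝ} (hq : q ∈ homOn T m) :
    ∃ p ∈ Submodule.span ℝ ((fun μ => rodPoly r (l μ) b) ''
        {μ | μ.degree = m ∧ ∀ i ∉ T.erase r, μ i = 0}),
      ∃ t ∈ homOnPred T m, q = p + (∑ i ∈ T, X i) * t := by
  let B : MvPolynomial σ ℝ →ₗ[ℝ] MvPolynomial σ ℝ →ₗ[ℝ] ℝ :=
    (LinearMap.mul ℝ (MvPolynomial σ ℝ)).compr₂ (gammaMoment b)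
  have hB : ∀ p q, B p q = gammaMoment b (p * q) := fun p q => rfl
  have hlen : ∀ μ : σ →₀ ℕ, (l μ).length = μ.degree := fun μ => by
    rw [Finsupp.degree_eq_sum, ← Finset.sum_congr rfl fun i _ => hl μ i,
      ← Multiset.coe_card, ← Multiset.sum_count_eq_card (s := Finset.univ) (by simp)]
    simp only [Multiset.coe_count]
  set K := (homOnPred T m).map (LinearMap.mulLeft ℝ (∑ i ∈ T, X i)) with hK
  have hKT : K ≤ homOn T m := by
    rintro _ ⟨t, ht, rfl⟩
    exact sum_X_mul_mem_homOn ht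
  obtain ⟨k, hk, hkorth⟩ := exists_mem_forall_apply_sub_eq_zero B K
    (fun k hk h => hpos k (mem_homOn.1 (hKT hk)).1 h) q
  let M : Finset (σ →₀ ℕ) := Finset.finsuppAntidiag (T.erase r) m
  have hM : ∀ μ : σ →₀ ℕ, μ ∈ M ↔ μ.degree = m ∧ ∀ i ∉ T.erase r, μ i = 0 := fun μ => by
    have hsub : μ.support ⊆ T.erase r ↔ ∀ i ∉ T.erase r, μ i = 0 := by
      refine forall_congr' fun i => ?_
      rw [Finsupp.mem_support_iff]
      exact not_imp_comm
    rw [Finset.mem_finsuppAntidiag, hsub]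
    refine and_congr_left fun h => ?_
    rw [Finsupp.degree_eq_sum, Finset.sum_subset (Finset.subset_univ _) fun i _ hi => h i hi]
  have hrl : ∀ μ ∈ M, r ∉ l μ := fun μ hμ => by
    rw [← List.count_eq_zero, hl, ((hM μ).1 hμ).2 r (by simp)]
  have hTl : ∀ μ ∈ M, ∀ i ∈ l μ, i ∈ T := fun μ hμ i hi => by
    by_contra hc
    have := List.count_pos_iff.2 hi
    rw [hl, ((hM μ).1 hμ).2 i (mt Finset.mem_of_mem_erase hc)] at this
    exact lt_irrefl _ this
  have hrodT : ∀ μ ∈ M, rodPoly r (l μ) b ∈ homOn T m := fun μ hμ => by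
    have := rodPoly_mem_homOn hr (hTl μ hμ) b
    rwa [hlen, ((hM μ).1 hμ).1] at this
  have hlrod : ∀ μ ∈ M, ∀ w ∈ K, B (rodPoly r (l μ) b) w = 0 := by
    rintro μ hμ _ ⟨t, ht, rfl⟩
    rw [hB, LinearMap.mulLeft_apply, mul_left_comm]
    cases m with
    | zero =>
      rw [homOnPred_zero] at ht
      rw [(Submodule.mem_bot ℝ).1 ht, mul_zero, mul_zero, map_zero]
    | succ m =>
      rw [homOnPred_succ] at ht
      obtain ⟨c, hc⟩ := exists_gammaMoment_sum_X_mul b T (m + 1 + m)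
      rw [hc _ (mul_mem_homOn (hrodT μ hμ) ht), gammaMoment_rodPoly_mul_eq_zero (hrl μ hμ),
        mul_zero]
      rw [hlen, ((hM μ).1 hμ).1]
      exact IsHomogeneous.mem_degLT (mem_homOn.1 ht).1
  choose! c hc0 hc using fun μ (hμ : μ ∈ M) => exists_gammaMoment_rodPoly_monomial (hrl μ hμ) hb
  set p := ∑ μ ∈ M, (gammaMoment b ((q - k) * monomial μ 1) / c μ) • rodPoly r (l μ) b with hp
  have hpT : p ∈ homOn T m := sum_mem fun μ hμ => Submodule.smul_mem _ _ (hrodT μ hμ)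
  have hz : q - k - p = 0 := by
    have hzT : q - k - p ∈ homOn T m := sub_mem (sub_mem hq (hKT hk)) hpT
    refine hpos _ (mem_homOn.1 hzT).1 ?_
    suffices h : homOn T m ≤ LinearMap.ker (B (q - k - p)) from h hzT
    refine (homOn_le_sup hr m).trans (sup_le (fun w hw => ?_) (restrictSupport_induction ?_))
    · rw [LinearMap.mem_ker, map_sub, LinearMap.sub_apply, hkorth w hw, hp, map_sum,
        LinearMap.sum_apply, Finset.sum_eq_zero, sub_zero]
      intro μ hμ
      rw [map_smul, LinearMap.smul_apply, hlrod μ hμ w hw, smul_zero]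
    · intro μ' hμ'
      have hμM : μ' ∈ M := (hM μ').2 hμ'
      rw [LinearMap.mem_ker, map_sub, LinearMap.sub_apply, hp, map_sum, LinearMap.sum_apply,
        Finset.sum_eq_single_of_mem μ' hμM]
      · rw [map_smul, LinearMap.smul_apply, hB, hB, hc μ' hμM μ' (hμ'.2 r (by simp))
          (hlen μ').symm, if_pos fun i => (hl μ' i).symm, smul_eq_mul,
          div_mul_cancel₀ _ (hc0 μ' hμM), sub_self]
      · intro μ hμ hne
        rw [map_smul, LinearMap.smul_apply, hB, hc μ hμ μ' (hμ'.2 r (by simp))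
          (by rw [hlen, hμ'.1, ((hM μ).1 hμ).1]), if_neg, smul_zero]
        exact fun hall => hne (Finsupp.ext fun i => by rw [hall i, hl])
  obtain ⟨t, ht, rfl⟩ := hk
  refine ⟨p, sum_mem fun μ hμ => Submodule.smul_mem _ _
    (Submodule.subset_span ⟨μ, (hM μ).1 hμ, rfl⟩), t, ht, ?_⟩
  rw [sub_sub, sub_eq_zero] at hz
  rw [hz, LinearMap.mulLeft_apply, add_comm]

end Span

/-! ### The Dirichlet integral over a simplex -/

section Dirichlet

open scoped ENNReal

/-- The density `t^{a-1}` on the positive half-line, extended by zero. -/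
def powDens (a t : ℝ) : ℝ≥0∞ := if 0 < t then ENNReal.ofReal (t ^ (a - 1)) else 0

lemma measurable_powDens (a : ℝ) : Measurable (powDens a) :=
  Measurable.ite measurableSet_Ioi (by fun_prop) measurable_const

/-- The Beta integral on the interval `(0, s)`. -/
lemma lintegral_powDens_mul {a c : ℝ} (ha : 0 < a) (hc : 0 < c) (s : ℝ) :
    ∫⁻ t, powDens a t * powDens c (s - t) =
      ENNReal.ofReal (ProbabilityTheory.beta a c) * powDens (a + c) s := by
  rcases le_or_gt s 0 with hs | hs
  · rw [powDens, if_neg hs.not_gt, mul_zero]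
    refine (lintegral_congr fun t => ?_).trans lintegral_zero
    rcases le_or_gt t 0 with ht | ht
    · rw [powDens, if_neg ht.not_gt, zero_mul]
    · rw [mul_comm, powDens, if_neg (by linarith), zero_mul]
  · have hβ := ProbabilityTheory.beta_pos ha hc
    have hmeas : Measurable fun t => powDens a t * powDens c (s - t) :=
      (measurable_powDens a).mul ((measurable_powDens c).comp (by fun_prop))
    have key : ∀ x, powDens a (s * x) * powDens c (s - s * x) =
        ENNReal.ofReal (s ^ (a + c - 2) * ProbabilityTheory.beta a c) *
          ProbabilityTheory.betaPDF a c x := by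
      intro x
      by_cases hx : 0 < x ∧ x < 1
      · have h1 : 0 < 1 - x := by linarith [hx.2]
        rw [ProbabilityTheory.betaPDF_of_pos_lt_one hx.1 hx.2, powDens, powDens,
          if_pos (mul_pos hs hx.1), show s - s * x = s * (1 - x) by ring, if_pos (mul_pos hs h1),
          ← ENNReal.ofReal_mul (Real.rpow_nonneg (mul_pos hs hx.1).le _),
          ← ENNReal.ofReal_mul (mul_nonneg (Real.rpow_nonneg hs.le _) hβ.le),
          Real.mul_rpow hs.le hx.1.le, Real.mul_rpow hs.le h1.le,
          show a + c - 2 = (a - 1) + (c - 1) by ring, Real.rpow_add hs]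
        congr 1
        field_simp
      · have h0 : powDens a (s * x) * powDens c (s - s * x) = 0 := by
          rw [powDens, powDens]
          by_cases hx0 : 0 < x
          · rw [if_neg (c := 0 < s - s * x), mul_zero]
            have : 1 ≤ x := not_lt.1 fun h => hx ⟨hx0, h⟩
            nlinarith
          · rw [if_neg, zero_mul]
            nlinarith
        rw [h0, ProbabilityTheory.betaPDF_eq, if_neg hx, ENNReal.ofReal_zero, mul_zero]
    rw [← Real.smul_map_volume_mul_left hs.ne', lintegral_smul_measure,
      lintegral_map hmeas (measurable_const_mul s)]
    simp_rw [key]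
    rw [lintegral_const_mul' _ _ ENNReal.ofReal_ne_top,
      ProbabilityTheory.lintegral_betaPDF_eq_one ha hc, mul_one, smul_eq_mul, abs_of_pos hs,
      powDens, if_pos hs, ← ENNReal.ofReal_mul hs.le, ← ENNReal.ofReal_mul hβ.le,
      show a + c - 2 = (a + c - 1) - 1 by ring, Real.rpow_sub_one hs.ne']
    congr 1
    field_simp

lemma measurable_prod_powDens {ι : Type*} [Fintype ι] (a : ι → ℝ) (c : ℝ) :
    Measurable fun u : ι → ℝ => (∏ i, powDens (a i) (u i)) * powDens c (1 - ∑ i, u i) :=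
  (Finset.measurable_prod _ fun i _ => (measurable_powDens (a i)).comp (measurable_pi_apply i)).mul
    ((measurable_powDens c).comp (by fun_prop))

lemma lintegral_prod_powDens_fin (n : ℕ) (a : Fin n → ℝ) (ha : ∀ i, 0 < a i) (c : ℝ)
    (hc : 0 < c) :
    ∫⁻ u : Fin n → ℝ, (∏ i, powDens (a i) (u i)) * powDens c (1 - ∑ i, u i) =
      ENNReal.ofReal ((∏ i, Real.Gamma (a i)) * Real.Gamma c / Real.Gamma (∑ i, a i + c)) := by
  induction n generalizing c with
  | zero =>
    rw [Measure.volume_pi_eq_dirac 0, lintegral_dirac]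
    simp [powDens, div_self (Real.Gamma_pos_of_pos hc).ne']
  | succ n ih =>
    have ha0 := ha 0
    have hS : 0 < ∑ i : Fin n, a i.succ + (a 0 + c) :=
      add_pos_of_nonneg_of_pos (Finset.sum_nonneg fun i _ => (ha _).le) (add_pos ha0 hc)
    rw [← (volume_preserving_piFinSuccAbove (fun _ => ℝ) 0).symm.lintegral_comp_emb
      (MeasurableEquiv.measurableEmbedding _), Measure.volume_eq_prod, lintegral_prod_symm]
    · have h : ∀ (u : Fin n → ℝ) (t : ℝ),
          (∏ i, powDens (a i) ((MeasurableEquiv.piFinSuccAbove (fun _ => ℝ) 0).symm (t, u) i)) *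
            powDens c (1 - ∑ i, (MeasurableEquiv.piFinSuccAbove (fun _ => ℝ) 0).symm (t, u) i) =
          (∏ i : Fin n, powDens (a i.succ) (u i)) *
            (powDens (a 0) t * powDens c ((1 - ∑ i, u i) - t)) := by
        intro u t
        simp only [MeasurableEquiv.piFinSuccAbove_symm_apply, Fin.insertNthEquiv_apply,
          Fin.insertNth_zero', Fin.prod_univ_succ, Fin.sum_univ_succ, Fin.cons_zero, Fin.cons_succ]
        rw [show 1 - (t + ∑ i, u i) = 1 - ∑ i, u i - t by ring]
        ring
      simp_rw [h]
      have h2 : ∀ u : Fin n → ℝ, ∫⁻ t, (∏ i : Fin n, powDens (a i.succ) (u i)) *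
          (powDens (a 0) t * powDens c ((1 - ∑ i, u i) - t)) =
          ENNReal.ofReal (ProbabilityTheory.beta (a 0) c) *
            ((∏ i : Fin n, powDens (a i.succ) (u i)) * powDens (a 0 + c) (1 - ∑ i, u i)) := by
        intro u
        rw [lintegral_const_mul, lintegral_powDens_mul ha0 hc]
        · ring
        · exact (measurable_powDens _).mul ((measurable_powDens _).comp (by fun_prop))
      simp_rw [h2]
      rw [lintegral_const_mul _ (measurable_prod_powDens _ _), ih _ (fun i => ha _) _
        (add_pos ha0 hc), ← ENNReal.ofReal_mul (ProbabilityTheory.beta_pos ha0 hc).le,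
        ProbabilityTheory.beta, Fin.prod_univ_succ, Fin.sum_univ_succ]
      congr 1
      have := (Real.Gamma_pos_of_pos (add_pos ha0 hc)).ne'
      rw [show a 0 + ∑ i : Fin n, a i.succ + c = ∑ i : Fin n, a i.succ + (a 0 + c) by ring]
      have := (Real.Gamma_pos_of_pos hS).ne'
      field_simp
    · exact ((measurable_prod_powDens a c).comp (MeasurableEquiv.measurable _)).aemeasurable

/-- The Dirichlet integral. -/
lemma lintegral_prod_powDens {ι : Type*} [Fintype ι] (a : ι → ℝ) (ha : ∀ i, 0 < a i) (c : ℝ)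
    (hc : 0 < c) :
    ∫⁻ u : ι → ℝ, (∏ i, powDens (a i) (u i)) * powDens c (1 - ∑ i, u i) =
      ENNReal.ofReal ((∏ i, Real.Gamma (a i)) * Real.Gamma c / Real.Gamma (∑ i, a i + c)) := by
  let e := (Fintype.equivFin ι).symm
  have h := lintegral_prod_powDens_fin _ (a ∘ e) (fun i => ha _) c hc
  rw [← (volume_measurePreserving_piCongrLeft (fun _ => ℝ) e).lintegral_comp_emb
    (MeasurableEquiv.measurableEmbedding _)]
  rw [← Equiv.prod_comp e, ← Equiv.sum_comp e]
  refine Eq.trans (lintegral_congr fun u => ?_) h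
  rw [← Equiv.prod_comp e, ← Equiv.sum_comp e]
  simp only [MeasurableEquiv.coe_piCongrLeft, Equiv.piCongrLeft_apply_apply, Function.comp_apply]

/-- The open solid simplex. -/
def openSimplex (ι : Type*) [Fintype ι] : Set (ι → ℝ) :=
  {u | (∀ i, 0 < u i) ∧ ∑ i, u i < 1}

variable {ι : Type*} [Fintype ι]

lemma isOpen_openSimplex : IsOpen (openSimplex ι) := by
  have h : openSimplex ι = (⋂ i, {u | 0 < u i}) ∩ {u | ∑ i, u i < 1} := by
    ext u; simp [openSimplex]
  rw [h]
  exact (isOpen_iInter_of_finite fun i => isOpen_lt continuous_const (continuous_apply i)).inter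
    (isOpen_lt (by fun_prop) continuous_const)

lemma openSimplex_subset : openSimplex ι ⊆ simplex ι := fun _ hu =>
  ⟨fun i => (hu.1 i).le, hu.2.le⟩

lemma isClosed_simplex : IsClosed (simplex ι) := by
  have h : simplex ι = (⋂ i, {u | 0 ≤ u i}) ∩ {u | ∑ i, u i ≤ 1} := by
    ext u; simp [simplex]
  rw [h]
  exact (isClosed_iInter fun i => isClosed_le continuous_const (continuous_apply i)).inter
    (isClosed_le (by fun_prop) continuous_const)

lemma convex_simplex : Convex ℝ (simplex ι) := by
  intro u hu v hv s t hs ht hst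
  refine ⟨fun i => add_nonneg (mul_nonneg hs (hu.1 i)) (mul_nonneg ht (hv.1 i)), ?_⟩
  have : ∑ i, (s • u + t • v) i = s * ∑ i, u i + t * ∑ i, v i := by
    simp [Finset.sum_add_distrib, Finset.mul_sum]
  rw [this]
  nlinarith [hu.2, hv.2, mul_le_mul_of_nonneg_left hu.2 hs, mul_le_mul_of_nonneg_left hv.2 ht]

lemma interior_simplex_subset : interior (simplex ι) ⊆ openSimplex ι := by
  intro u hu
  have hcont : Continuous fun t : ℝ => u + t • (1 : ι → ℝ) := by fun_prop
  have hev : ∀ᶠ t in nhds (0 : ℝ), u + t • (1 : ι → ℝ) ∈ simplex ι := by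
    refine hcont.continuousAt.eventually ?_
    have h0 : (fun t : ℝ => u + t • (1 : ι → ℝ)) 0 = u := by simp
    rw [h0]
    exact mem_interior_iff_mem_nhds.1 hu
  obtain ⟨ε, hε, h⟩ := Metric.eventually_nhds_iff.1 hev
  have hm := h (y := -(ε / 2)) (by rw [Real.dist_eq, sub_zero, abs_neg, abs_of_pos] <;> linarith)
  have hp := h (y := ε / 2) (by rw [Real.dist_eq, sub_zero, abs_of_pos] <;> linarith)
  refine ⟨fun i => ?_, ?_⟩
  · have := hm.1 i
    simp only [Pi.add_apply, Pi.smul_apply, Pi.one_apply, smul_eq_mul, mul_one] at this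
    linarith
  · have := hp.2
    simp only [Pi.add_apply, Pi.smul_apply, Pi.one_apply, smul_eq_mul, mul_one,
      Finset.sum_add_distrib, Finset.sum_const, nsmul_eq_mul, Finset.card_univ] at this
    rcases isEmpty_or_nonempty ι with h0 | h0
    · simp
    · have hcard : (0 : ℝ) < Fintype.card ι := Nat.cast_pos.2 Fintype.card_pos
      nlinarith

lemma simplex_ae_eq_openSimplex : simplex ι =ᵐ[volume] openSimplex ι := by
  have h : interior (simplex ι) =ᵐ[volume] simplex ι :=
    interior_ae_eq_of_null_frontier (convex_simplex.addHaar_frontier volume)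
  refine Filter.EventuallyLE.antisymm ?_ openSimplex_subset.eventuallyLE
  exact h.symm.le.trans interior_simplex_subset.eventuallyLE

/-- The barycentric coordinates of a point of the simplex: its coordinates, and `1 - ∑ u_i` for the
index `none`. -/
def optBary (u : ι → ℝ) : Option ι → ℝ := fun o => o.elim (1 - ∑ i, u i) u

lemma optBary_nonneg {u : ι → ℝ} (hu : u ∈ simplex ι) (o : Option ι) : 0 ≤ optBary u o := by
  cases o with
  | none => exact sub_nonneg.2 hu.2
  | some i => exact hu.1 i

lemma optBary_pos {u : ι → ℝ} (hu : u ∈ openSimplex ι) (o : Option ι) : 0 < optBary u o := by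
  cases o with
  | none => exact sub_pos.2 hu.2
  | some i => exact hu.1 i

lemma measurable_optBary (o : Option ι) : Measurable fun u : ι → ℝ => optBary u o := by
  cases o with
  | none => simp only [optBary, Option.elim_none]; fun_prop
  | some i => simp only [optBary, Option.elim_some]; fun_prop

lemma integral_prod_optBary_rpow (b : Option ι → ℝ) (hb : ∀ o, 0 < b o) :
    IntegrableOn (fun u => ∏ o, optBary u o ^ (b o - 1)) (simplex ι) ∧
      ∫ u in simplex ι, ∏ o, optBary u o ^ (b o - 1) =
        (∏ o, Real.Gamma (b o)) / Real.Gamma (∑ o, b o) := by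
  have hmeas : Measurable fun u : ι → ℝ => ∏ o, optBary u o ^ (b o - 1) :=
    Finset.measurable_prod _ fun o _ => (measurable_optBary o).pow_const _
  have hnn : 0 ≤ᵐ[volume.restrict (simplex ι)] fun u : ι → ℝ => ∏ o, optBary u o ^ (b o - 1) :=
    ae_restrict_of_forall_mem isClosed_simplex.measurableSet fun u hu =>
      Finset.prod_nonneg fun o _ => Real.rpow_nonneg (optBary_nonneg hu o) _
  have hS : 0 < ∑ o, b o := Finset.sum_pos (fun o _ => hb o) Finset.univ_nonempty
  have hlint : ∫⁻ u in simplex ι, ENNReal.ofReal (∏ o, optBary u o ^ (b o - 1)) =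
      ENNReal.ofReal ((∏ o, Real.Gamma (b o)) / Real.Gamma (∑ o, b o)) := by
    rw [setLIntegral_congr simplex_ae_eq_openSimplex,
      ← lintegral_indicator isOpen_openSimplex.measurableSet, Fintype.prod_option,
      Fintype.sum_option, mul_comm, add_comm,
      ← lintegral_prod_powDens (fun i => b (some i)) (fun i => hb _) (b none) (hb none)]
    refine lintegral_congr fun u => ?_
    by_cases hu : u ∈ openSimplex ι
    · rw [Set.indicator_of_mem hu, Fintype.prod_option, mul_comm,
        ENNReal.ofReal_mul (Finset.prod_nonneg fun i _ =>
          Real.rpow_nonneg (optBary_nonneg (openSimplex_subset hu) _) _),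
        ENNReal.ofReal_prod_of_nonneg fun i _ =>
          Real.rpow_nonneg (optBary_nonneg (openSimplex_subset hu) _) _]
      rw [powDens, if_pos (sub_pos.2 hu.2)]
      congr 1
      refine Finset.prod_congr rfl fun i _ => ?_
      rw [powDens, if_pos (hu.1 i)]
      rfl
    · rw [Set.indicator_of_notMem hu]
      symm
      by_cases h1 : ∀ i, 0 < u i
      · rw [powDens, if_neg, mul_zero]
        exact fun h => hu ⟨h1, sub_pos.1 h⟩
      · obtain ⟨i, hi⟩ := not_forall.1 h1
        rw [Finset.prod_eq_zero (Finset.mem_univ i) (by rw [powDens, if_neg hi]), zero_mul]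
  have hnn' : 0 ≤ (∏ o, Real.Gamma (b o)) / Real.Gamma (∑ o, b o) :=
    div_nonneg (Finset.prod_nonneg fun o _ => (Real.Gamma_pos_of_pos (hb o)).le)
      (Real.Gamma_pos_of_pos hS).le
  refine ⟨⟨hmeas.aestronglyMeasurable, ?_⟩, ?_⟩
  · rw [hasFiniteIntegral_iff_ofReal hnn, hlint]
    exact ENNReal.ofReal_lt_top
  · rw [integral_eq_lintegral_of_nonneg_ae hnn hmeas.aestronglyMeasurable, hlint,
      ENNReal.toReal_ofReal hnn']

/-- A continuous function whose square has vanishing weighted integral vanishes on the open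
simplex. -/
lemma eq_zero_of_integral_simplex_eq_zero {p w : (ι → ℝ) → ℝ} (hp : Continuous p)
    (hw : ∀ u ∈ simplex ι, 0 ≤ w u) (hw' : ∀ u ∈ openSimplex ι, w u ≠ 0)
    (hint : IntegrableOn (fun u => p u * p u * w u) (simplex ι))
    (h : ∫ u in simplex ι, p u * p u * w u = 0) : ∀ u ∈ openSimplex ι, p u = 0 := by
  rw [setIntegral_eq_zero_iff_of_nonneg_ae (ae_restrict_of_forall_mem
    isClosed_simplex.measurableSet fun u hu => mul_nonneg (mul_self_nonneg _) (hw u hu)) hint] at h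
  have h1 : p =ᵐ[volume.restrict (openSimplex ι)] 0 := by
    filter_upwards [ae_restrict_of_ae_restrict_of_subset openSimplex_subset h,
      ae_restrict_mem isOpen_openSimplex.measurableSet] with u hu hmem
    exact mul_self_eq_zero.1 ((mul_eq_zero.1 hu).resolve_right (hw' u hmem))
  exact fun u hu => Measure.eqOn_open_of_ae_eq h1 isOpen_openSimplex hp.continuousOn
    continuousOn_const hu

end Dirichlet

/-! ### Moments over a face of the simplex -/

section FaceMoment

variable {σ : Type*} [Fintype σ]

/-- The linear functional with moments `y^α ↦ ∏ i, (b_i)_{α_i} / (∑ i, b_i)_{|α|}`: the normalised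
integral against `∏ y_i^{b_i - 1}` over the face `{y_i = 0 for b_i = 0}` of the simplex
`{y ≥ 0, ∑ y_i = 1}`. -/
def simplexMoment (b : σ → ℝ) : MvPolynomial σ ℝ →ₗ[ℝ] ℝ :=
  (basisMonomials σ ℝ).constr ℝ fun α =>
    (∏ i, (ascPochhammer ℝ (α i)).eval (b i)) / (ascPochhammer ℝ α.degree).eval (∑ i, b i)

lemma simplexMoment_monomial (b : σ → ℝ) (α : σ →₀ ℕ) (c : ℝ) :
    simplexMoment b (monomial α c) = c * ((∏ i, (ascPochhammer ℝ (α i)).eval (b i)) /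
      (ascPochhammer ℝ α.degree).eval (∑ i, b i)) := by
  have h : monomial α c = c • basisMonomials σ ℝ α := by
    rw [coe_basisMonomials, smul_monomial, smul_eq_mul, mul_one]
  rw [h, map_smul, simplexMoment, Module.Basis.constr_basis, smul_eq_mul]

lemma simplexMoment_of_isHomogeneous (b : σ → ℝ) {m : ℕ} {P : MvPolynomial σ ℝ}
    (hP : P.IsHomogeneous m) :
    simplexMoment b P = gammaMoment b P / (ascPochhammer ℝ m).eval (∑ i, b i) := by
  suffices h : restrictSupport ℝ {α : σ →₀ ℕ | α.degree = m} ≤ LinearMap.ker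
      (simplexMoment b - ((ascPochhammer ℝ m).eval (∑ i, b i))⁻¹ • gammaMoment b) by
    have hmem : P ∈ restrictSupport ℝ {α : σ →₀ ℕ | α.degree = m} :=
      mem_restrictSupport.2 fun α hα =>
        (DFunLike.congr_fun Finsupp.degree_eq_weight_one α).trans (hP hα)
    have := h hmem
    rw [LinearMap.mem_ker, LinearMap.sub_apply, sub_eq_zero] at this
    rw [this, LinearMap.smul_apply, smul_eq_mul, inv_mul_eq_div]
  refine restrictSupport_induction fun α hα => ?_
  obtain rfl : α.degree = m := hα
  rw [LinearMap.mem_ker, LinearMap.sub_apply, sub_eq_zero, simplexMoment_monomial,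
    LinearMap.smul_apply, gammaMoment_monomial, smul_eq_mul, inv_mul_eq_div, one_mul, one_mul]

/-- Orthogonality of a homogeneous polynomial on the simplex follows from orthogonality with respect
to the Gamma weights, one degree at a time. -/
lemma simplexMoment_mul_eq_zero {b : σ → ℝ} {m M : ℕ} {P q : MvPolynomial σ ℝ}
    (hP : P.IsHomogeneous m) (h : ∀ q ∈ degLT σ M, gammaMoment b (P * q) = 0)
    (hq : q ∈ degLT σ M) : simplexMoment b (P * q) = 0 := by
  suffices hle : degLT σ M ≤ LinearMap.ker (simplexMoment b ∘ₗ LinearMap.mulLeft ℝ P) from hle hq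
  refine restrictSupport_induction fun α hα => ?_
  rw [LinearMap.mem_ker, LinearMap.comp_apply, LinearMap.mulLeft_apply,
    simplexMoment_of_isHomogeneous b (hP.mul (isHomogeneous_monomial (n := α.degree) 1 rfl)),
    h _ ((monomial_mem_restrictSupport ℝ).2 (Or.inl hα)), zero_div]

lemma gammaMoment_mul_eq_zero {b : σ → ℝ} {m M : ℕ} {P q : MvPolynomial σ ℝ}
    (hb : 0 < ∑ i, b i) (hP : P.IsHomogeneous m)
    (h : ∀ q ∈ degLT σ M, simplexMoment b (P * q) = 0) (hq : q ∈ degLT σ M) :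
    gammaMoment b (P * q) = 0 := by
  suffices hle : degLT σ M ≤ LinearMap.ker (gammaMoment b ∘ₗ LinearMap.mulLeft ℝ P) from hle hq
  refine restrictSupport_induction fun α hα => ?_
  have := h (monomial α 1) ((monomial_mem_restrictSupport ℝ).2 (Or.inl hα))
  rw [simplexMoment_of_isHomogeneous b
    (hP.mul (isHomogeneous_monomial (n := α.degree) 1 rfl)), div_eq_zero_iff] at this
  exact this.resolve_right (ascPochhammer_pos _ _ hb).ne'

lemma Gamma_add_nat {x : ℝ} (hx : 0 < x) (n : ℕ) :
    Real.Gamma (x + n) = Real.Gamma x * (ascPochhammer ℝ n).eval x := by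
  induction n with
  | zero => simp
  | succ n ih =>
    rw [Nat.cast_succ, ← add_assoc, Real.Gamma_add_one (by positivity), ih,
      ascPochhammer_succ_eval]
    ring

/-- Integrals of polynomials against Jacobi weights over a face of the simplex. The map `φ` selects
the barycentric coordinates `y_j` that are not identically zero on the face. -/
lemma exists_integral_eq_simplexMoment {ι : Type*} [Fintype ι] (φ : Option ι → σ)
    (hφ : Function.Injective φ) (y : (ι → ℝ) → σ → ℝ) (hy : ∀ u o, y u (φ o) = optBary u o)
    (hy0 : ∀ u, ∀ j ∉ Set.range φ, y u j = 0) (b : σ → ℝ) (hb : ∀ o, 0 < b (φ o))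
    (hb0 : ∀ j ∉ Set.range φ, b j = 0) :
    ∃ C : ℝ, 0 < C ∧ ∀ P : MvPolynomial σ ℝ,
      IntegrableOn (fun u => eval (y u) P * ∏ o, optBary u o ^ (b (φ o) - 1)) (simplex ι) ∧
      ∫ u in simplex ι, eval (y u) P * ∏ o, optBary u o ^ (b (φ o) - 1) =
        C * simplexMoment b P := by
  have hB : 0 < ∑ o, b (φ o) := Finset.sum_pos (fun o _ => hb o) Finset.univ_nonempty
  have hBs : ∑ o, b (φ o) = ∑ i, b i :=
    Fintype.sum_of_injective φ hφ _ _ hb0 fun _ => rfl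
  refine ⟨(∏ o, Real.Gamma (b (φ o))) / Real.Gamma (∑ o, b (φ o)),
    div_pos (Finset.prod_pos fun o _ => Real.Gamma_pos_of_pos (hb o)) (Real.Gamma_pos_of_pos hB),
    fun P => ?_⟩
  induction P using MvPolynomial.induction_on' with
  | add p q hp hq =>
    simp only [map_add, add_mul, mul_add]
    exact ⟨hp.1.add hq.1, by rw [integral_add hp.1 hq.1, hp.2, hq.2]⟩
  | monomial α c =>
    by_cases hα : ∀ j ∉ Set.range φ, α j = 0
    · have hαs : ∑ o, α (φ o) = α.degree := by
        rw [Finsupp.degree_eq_sum]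
        exact Fintype.sum_of_injective φ hφ _ _ hα fun _ => rfl
      obtain ⟨h1, h2⟩ := integral_prod_optBary_rpow (fun o => b (φ o) + α (φ o))
        fun o => by have := hb o; positivity
      have hcongr : Set.EqOn
          (fun u => c * ∏ o, optBary u o ^ (b (φ o) + α (φ o) - 1))
          (fun u => eval (y u) (monomial α c) * ∏ o, optBary u o ^ (b (φ o) - 1))
          (simplex ι) := by
        intro u hu
        have e1 : eval (y u) (monomial α c) = c * ∏ o, optBary u o ^ α (φ o) := by
          rw [eval_monomial, Finsupp.prod_fintype _ _ fun _ => pow_zero _]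
          congr 1
          refine (Fintype.prod_of_injective φ hφ _ _ (fun j hj => ?_) fun o => ?_).symm
          · rw [hα j hj, pow_zero]
          · rw [hy]
        simp only
        rw [e1, mul_assoc, ← Finset.prod_mul_distrib]
        congr 1
        refine Finset.prod_congr rfl fun o _ => ?_
        rcases (optBary_nonneg hu o).eq_or_lt with h0 | h0
        · rw [← h0]
          rcases Nat.eq_zero_or_pos (α (φ o)) with ha | ha
          · rw [ha, pow_zero, one_mul, Nat.cast_zero, add_zero]
          · have : (1 : ℝ) ≤ α (φ o) := Nat.one_le_cast.2 ha
            rw [zero_pow ha.ne', zero_mul, Real.zero_rpow]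
            linarith [hb o]
        · rw [mul_comm, ← Real.rpow_natCast, ← Real.rpow_add h0]
          congr 1
          ring
      refine ⟨(integrableOn_congr_fun hcongr isClosed_simplex.measurableSet).1 (h1.const_mul c), ?_⟩
      rw [← setIntegral_congr_fun isClosed_simplex.measurableSet hcongr, integral_const_mul, h2,
        simplexMoment_monomial, Finset.sum_add_distrib, ← Nat.cast_sum, hαs, Gamma_add_nat hB,
        Finset.prod_congr rfl fun o _ => Gamma_add_nat (hb o) (α (φ o)), Finset.prod_mul_distrib,
        ← hBs]
      rw [Fintype.prod_of_injective φ hφ (fun o => (ascPochhammer ℝ (α (φ o))).eval (b (φ o)))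
        (fun j => (ascPochhammer ℝ (α j)).eval (b j)) (fun j hj => by simp [hα j hj])
        fun _ => rfl]
      have := (Real.Gamma_pos_of_pos hB).ne'
      have := (ascPochhammer_pos α.degree _ hB).ne'
      field_simp
    · simp only [not_forall] at hα
      obtain ⟨j, hj, hαj⟩ := hα
      have e1 : ∀ u, eval (y u) (monomial α c) = 0 := fun u => by
        rw [eval_monomial, Finsupp.prod_fintype _ _ fun _ => pow_zero _,
          Finset.prod_eq_zero (Finset.mem_univ j), mul_zero]
        rw [hy0 u j hj, zero_pow hαj]
      have e2 : simplexMoment b (monomial α c) = 0 := by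
        rw [simplexMoment_monomial, Finset.prod_eq_zero (Finset.mem_univ j), zero_div, mul_zero]
        rw [hb0 j hj, ascPochhammer_eval_zero, if_neg hαj]
      simp only [e1, e2, zero_mul, mul_zero, integral_zero]
      exact ⟨integrableOn_zero, trivial⟩

end FaceMoment

/-! ### Integration by parts along the simplex -/

section Tangential

variable {σ : Type*}

/-- The iterated derivative `∏_{i ∈ L} (∂_i - ∂_z)` along the hyperplane `∑ y_i = 1`. -/
def tangDeriv (z : σ) (L : List σ) (p : MvPolynomial σ ℝ) : MvPolynomial σ ℝ :=
  L.foldr (fun i u => pderiv i u - pderiv z u) p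

lemma tangDeriv_nil (z : σ) (p : MvPolynomial σ ℝ) : tangDeriv z [] p = p := rfl

lemma tangDeriv_cons (z i : σ) (L : List σ) (p : MvPolynomial σ ℝ) :
    tangDeriv z (i :: L) p = pderiv i (tangDeriv z L p) - pderiv z (tangDeriv z L p) := rfl

lemma pderiv_tangDeriv_eq_zero {z i : σ} {p : MvPolynomial σ ℝ} (h : pderiv i p = 0)
    (L : List σ) : pderiv i (tangDeriv z L p) = 0 := by
  induction L with
  | nil => exact h
  | cons j L ih =>
    rw [tangDeriv_cons, map_sub, pderiv_pderiv_comm i, pderiv_pderiv_comm i, ih, map_zero,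
      map_zero, sub_zero]

lemma tangDeriv_eq_zero {z i : σ} {p : MvPolynomial σ ℝ} (hi : pderiv i p = 0)
    (hz : pderiv z p = 0) {L : List σ} (hL : i ∈ L) : tangDeriv z L p = 0 := by
  induction L with
  | nil => simp at hL
  | cons j L ih =>
    rw [tangDeriv_cons]
    rcases List.mem_cons.1 hL with rfl | hL
    · rw [pderiv_tangDeriv_eq_zero hi, pderiv_tangDeriv_eq_zero hz, sub_zero]
    · rw [ih hL, map_zero, map_zero, sub_zero]

lemma X_dvd_tangDeriv {z i : σ} (hiz : i ≠ z) {p : MvPolynomial σ ℝ} (h : X i ∣ p) {L : List σ}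
    (hL : i ∉ L) : X i ∣ tangDeriv z L p := by
  have aux : ∀ j ≠ i, ∀ u : MvPolynomial σ ℝ, X i ∣ u → X i ∣ pderiv j u := by
    rintro j hj _ ⟨v, rfl⟩
    rw [pderiv_mul, pderiv_X_of_ne hj.symm, zero_mul, zero_add]
    exact dvd_mul_right _ _
  induction L with
  | nil => exact h
  | cons j L ih =>
    obtain ⟨hj, hL⟩ := not_or.1 (mt List.mem_cons.2 hL)
    rw [tangDeriv_cons]
    exact dvd_sub (aux j (Ne.symm hj) _ (ih hL)) (aux z hiz.symm _ (ih hL))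

lemma IsHomogeneous.tangDeriv {z : σ} {n : ℕ} {p : MvPolynomial σ ℝ} (hp : p.IsHomogeneous n)
    (L : List σ) : (tangDeriv z L p).IsHomogeneous (n - L.length) := by
  induction L with
  | nil => exact hp
  | cons j L ih =>
    rw [tangDeriv_cons, List.length_cons, ← Nat.sub_sub]
    exact ih.pderiv.sub ih.pderiv

lemma sub_pderiv_mem_degLT {n : ℕ} (i z : σ) {q : MvPolynomial σ ℝ} (hq : q ∈ degLT σ n) :
    pderiv i q - pderiv z q ∈ degLT σ (n - 1) :=
  sub_mem (pderiv_mem_degLT i hq) (pderiv_mem_degLT z hq)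

lemma tangDeriv_mem_degLT {z : σ} {n : ℕ} {q : MvPolynomial σ ℝ} (hq : q ∈ degLT σ n)
    (L : List σ) : tangDeriv z L q ∈ degLT σ (n - L.length) := by
  induction L with
  | nil => exact hq
  | cons j L ih =>
    rw [tangDeriv_cons, List.length_cons, ← Nat.sub_sub]
    exact sub_pderiv_mem_degLT j z ih

lemma X_mul_pderiv_mem_degLT {n : ℕ} (i j : σ) {q : MvPolynomial σ ℝ} (hq : q ∈ degLT σ n) :
    X i * pderiv j q ∈ degLT σ n := by
  cases n with
  | zero => rw [mem_degLT_zero.1 hq, map_zero, mul_zero]; exact zero_mem _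
  | succ n => exact X_mul_mem_degLT i (pderiv_mem_degLT j hq)

lemma update_add_single [DecidableEq σ] (b : σ → ℝ) (z : σ) (s t : ℝ) :
    Function.update b z s + Pi.single z t = Function.update b z (s + t) := by
  ext i
  rcases eq_or_ne i z with rfl | hne
  · simp
  · simp [hne]

variable [Fintype σ] [DecidableEq σ]

lemma gammaMoment_X_pow_mul (b : σ → ℝ) (i : σ) (n : ℕ) (u : MvPolynomial σ ℝ) :
    gammaMoment b (X i ^ n * u) =
      (ascPochhammer ℝ n).eval (b i) * gammaMoment (b + Pi.single i (n : ℝ)) u := by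
  induction n generalizing b with
  | zero => simp
  | succ n ih =>
    rw [pow_succ', mul_assoc, gammaMoment_X_mul, ih, ascPochhammer_succ_eval_left, add_assoc,
      ← Pi.single_add, Pi.add_apply, Pi.single_eq_same, mul_assoc, add_comm (1 : ℝ) n]
    push_cast
    rfl

lemma gammaMoment_prod_X_mul (b : σ → ℝ) (A : Finset σ) (u : MvPolynomial σ ℝ) :
    gammaMoment b ((∏ i ∈ A, X i) * u) =
      (∏ i ∈ A, b i) * gammaMoment (b + fun i => if i ∈ A then 1 else 0) u := by
  induction A using Finset.induction_on generalizing u with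
  | empty =>
    simp only [Finset.prod_empty, Finset.notMem_empty, if_false, one_mul]
    congr 1
    congr 1
    ext i
    simp
  | insert a A ha ih =>
    rw [Finset.prod_insert ha, Finset.prod_insert ha, mul_comm (X a), mul_assoc, ih,
      gammaMoment_X_mul]
    have h : (b + fun i => if i ∈ A then (1 : ℝ) else 0) + Pi.single a 1 =
        b + fun i => if i ∈ insert a A then (1 : ℝ) else 0 := by
      ext i
      rcases eq_or_ne i a with rfl | hne
      · simp [ha]
      · simp [hne]
    rw [h]
    simp only [Pi.add_apply, ha, if_false, add_zero]
    ring

lemma gammaMoment_pderiv_of_X_dvd {b : σ → ℝ} {i : σ} (hb : b i = 1) {v : MvPolynomial σ ℝ}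
    (hv : X i ∣ v) : gammaMoment b (pderiv i v) = gammaMoment b v := by
  have h := gammaMoment_pderiv (b - Pi.single i 1) i v
  rwa [sub_add_cancel, gammaMoment_eq_zero_of_X_dvd (b := b - Pi.single i 1) (i := i)
    (by simp [hb]) hv, sub_zero] at h

lemma gammaMoment_update_pderiv (b : σ → ℝ) (z : σ) (j : ℕ) (v : MvPolynomial σ ℝ) :
    gammaMoment (Function.update b z ((j + 1 : ℕ) : ℝ)) (pderiv z v) =
      gammaMoment (Function.update b z ((j + 1 : ℕ) : ℝ)) v -
        gammaMoment (Function.update b z (j : ℝ)) v := by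
  have h := gammaMoment_pderiv (Function.update b z (j : ℝ)) z v
  rw [update_add_single] at h
  push_cast
  exact h

/-- Orthogonality of the mixed derivatives of `y_A y_z h` on the face with variables `J ∪ {z}` next
to those with `b_i > 0`. Each of the derivatives either lowers the exponent of `y_z` or the degree
of `q`, and the derivatives with respect to `y_i`, `i ∈ A`, preserve the difference of the two
gains. -/
lemma gammaMoment_tangDeriv_mul_eq_zero {z : σ} {A J : Finset σ} (hz : z ∉ J) (hAJ : A ⊆ J)
    {b : σ → ℝ} (hb : ∀ i ∈ A, b i = 1) {N : ℕ} {h : MvPolynomial σ ℝ}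
    (hJ : ∀ i ∈ J, i ∉ A → pderiv i h = 0)
    (hh : ∀ q ∈ degLT σ N, gammaMoment
      (Function.update (b + fun i => if i ∈ A then 1 else 0) z 2) (h * q) = 0)
    {L : List σ} (hL : L.Nodup) (hLJ : ∀ i ∈ L, i ∈ J) {j M : ℕ} (hLj : L.length ≤ j)
    {q : MvPolynomial σ ℝ} (hq : q ∈ degLT σ M)
    (hM : M + j ≤ N + 1 + (L.filter (· ∈ A)).length) :
    gammaMoment (Function.update b z (j : ℝ))
      (tangDeriv z L ((∏ i ∈ A, X i) * (X z * h)) * q) = 0 := by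
  have hzA : z ∉ A := fun hc => hz (hAJ hc)
  induction L generalizing j M q with
  | nil =>
    rw [tangDeriv_nil]
    cases j with
    | zero =>
      refine gammaMoment_eq_zero_of_X_dvd (i := z) (by simp) ?_
      exact ((dvd_mul_right _ _).mul_left _).mul_right _
    | succ j =>
      have hmem : X z ^ j * q ∈ degLT σ N := by
        refine degLT_mono ?_ (mul_mem_degLT (m := j)
          (IsHomogeneous.mem_degLT (isHomogeneous_X_pow z j)) hq)
        simp only [List.filter_nil, List.length_nil] at hM
        omega
      have h1 := hh _ hmem
      rw [mul_left_comm, gammaMoment_X_pow_mul, Function.update_self, mul_eq_zero] at h1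
      have h2 := h1.resolve_left (ascPochhammer_pos _ _ two_pos).ne'
      rw [update_add_single] at h2
      have h3 : Function.update b z ((j + 1 : ℕ) : ℝ) + (fun i => if i ∈ A then 1 else 0) +
          Pi.single z 1 = Function.update (b + fun i => if i ∈ A then 1 else 0) z (2 + (j : ℝ)) := by
        ext i
        rcases eq_or_ne i z with rfl | hne
        · simp [hzA]
          ring
        · simp [hne]
      rw [mul_assoc, gammaMoment_prod_X_mul, mul_assoc, gammaMoment_X_mul, h3, h2, mul_zero,
        mul_zero]
  | cons i L ih =>
    obtain ⟨hiL, hL⟩ := List.nodup_cons.1 hL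
    have hLJ' : ∀ i ∈ L, i ∈ J := fun l hl => hLJ l (List.mem_cons_of_mem _ hl)
    have hiJ : i ∈ J := hLJ i List.mem_cons_self
    have hiz : i ≠ z := ne_of_mem_of_not_mem hiJ hz
    obtain ⟨j, rfl⟩ : ∃ j', j = j' + 1 := ⟨j - 1, by rw [List.length_cons] at hLj; omega⟩
    rw [List.length_cons] at hLj
    rw [tangDeriv_cons]
    set u := tangDeriv z L ((∏ i ∈ A, X i) * (X z * h))
    rcases Nat.eq_zero_or_pos M with rfl | hMpos
    · rw [mem_degLT_zero.1 hq, mul_zero, map_zero]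
    by_cases hiA : i ∈ A
    · rw [List.filter_cons_of_pos (by simpa using hiA), List.length_cons] at hM
      have hdvd : X i ∣ u := X_dvd_tangDeriv hiz
        ((Finset.dvd_prod_of_mem _ hiA).mul_right _) hiL
      have e : (pderiv i u - pderiv z u) * q =
          pderiv i (u * q) - pderiv z (u * q) - u * (pderiv i q - pderiv z q) := by
        simp only [pderiv_mul]; ring
      have h1 := ih hL hLJ' (j := j) (by omega) hq (by omega)
      have h2 := ih hL hLJ' (j := j + 1) (by omega) (sub_pderiv_mem_degLT i z hq) (by omega)
      rw [e, map_sub, map_sub, gammaMoment_update_pderiv,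
        gammaMoment_pderiv_of_X_dvd (by simp [hiz, hb i hiA]) (hdvd.mul_right q), h1, h2]
      ring
    · rw [List.filter_cons_of_neg (by simpa using hiA)] at hM
      have hder : pderiv i u = 0 := by
        refine pderiv_tangDeriv_eq_zero ?_ L
        have h1 : pderiv i (∏ l ∈ A, X l : MvPolynomial σ ℝ) = 0 := by
          refine pderiv_eq_zero_of_notMem_vars fun hc => hiA ?_
          have := vars_prod (fun l => (X l : MvPolynomial σ ℝ)) hc
          simpa using this
        rw [pderiv_mul, pderiv_mul, h1, pderiv_X_of_ne hiz.symm, hJ i hiJ hiA]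
        simp
      have e : (pderiv i u - pderiv z u) * q = u * pderiv z q - pderiv z (u * q) := by
        rw [hder, pderiv_mul]; ring
      rw [e, map_sub, gammaMoment_update_pderiv, ih hL hLJ' (by omega) hq (by omega),
        ih hL hLJ' (by omega) hq (by omega),
        ih hL hLJ' (by omega) (pderiv_mem_degLT z hq) (by omega)]
      simp

/-- Orthogonality of the mixed derivatives of `y_A h` if neither `y_A` nor `h` involves `y_z`. -/
lemma gammaMoment_tangDeriv_mul_eq_zero_of_pderiv {z : σ} {A : Finset σ} (hz : z ∉ A)
    {b : σ → ℝ} (hb : ∀ i ∈ A, b i = 1) {N : ℕ} {h : MvPolynomial σ ℝ} (hhz : pderiv z h = 0)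
    (hh : ∀ q ∈ degLT σ N, gammaMoment (b + fun i => if i ∈ A then 1 else 0) (h * q) = 0)
    {L : List σ} (hL : L.Nodup) (hLA : ∀ i ∈ L, i ∈ A) {q : MvPolynomial σ ℝ}
    (hq : q ∈ degLT σ N) :
    gammaMoment b (tangDeriv z L ((∏ i ∈ A, X i) * h) * q) = 0 := by
  induction L generalizing q with
  | nil => rw [tangDeriv_nil, mul_assoc, gammaMoment_prod_X_mul, hh q hq, mul_zero]
  | cons i L ih =>
    obtain ⟨hiL, hL⟩ := List.nodup_cons.1 hL
    have hLA' : ∀ i ∈ L, i ∈ A := fun l hl => hLA l (List.mem_cons_of_mem _ hl)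
    have hiA : i ∈ A := hLA i List.mem_cons_self
    have hiz : i ≠ z := ne_of_mem_of_not_mem hiA hz
    rw [tangDeriv_cons]
    have hder : pderiv z (tangDeriv z L ((∏ i ∈ A, X i) * h)) = 0 := by
      refine pderiv_tangDeriv_eq_zero ?_ L
      have h1 : pderiv z (∏ l ∈ A, X l : MvPolynomial σ ℝ) = 0 := by
        refine pderiv_eq_zero_of_notMem_vars fun hc => hz ?_
        have := vars_prod (fun l => (X l : MvPolynomial σ ℝ)) hc
        simpa using this
      rw [pderiv_mul, h1, hhz, zero_mul, mul_zero, add_zero]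
    rw [hder, sub_zero]
    set u := tangDeriv z L ((∏ i ∈ A, X i) * h)
    have hdvd : X i ∣ u := X_dvd_tangDeriv hiz ((Finset.dvd_prod_of_mem _ hiA).mul_right _) hiL
    have e : pderiv i u * q = pderiv i (u * q) - u * pderiv i q := by
      rw [pderiv_mul]; ring
    rw [e, map_sub, gammaMoment_pderiv_of_X_dvd (hb i hiA) (hdvd.mul_right q), ih hL hLA' hq,
      ih hL hLA' (degLT_mono (Nat.sub_le _ _) (pderiv_mem_degLT i hq)), sub_zero]

/-- Integration by parts for the first-order terms, for `F` vanishing on `y_z = 0`. -/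
lemma gammaMoment_X_mul_sub_pderiv {b : σ → ℝ} {i z : σ} (hiz : i ≠ z) (hz : b z = 1)
    {F : MvPolynomial σ ℝ} (hF : X z ∣ F) (q : MvPolynomial σ ℝ) :
    gammaMoment b (X i * (pderiv i F - pderiv z F) * q) =
      -gammaMoment b (F * (X i * (pderiv i q - pderiv z q) + b i • q)) := by
  have e : X i * (pderiv i F - pderiv z F) * q = X i * pderiv i (F * q) -
      pderiv z (X i * (F * q)) - F * (X i * (pderiv i q - pderiv z q)) := by
    simp only [pderiv_mul, pderiv_X_of_ne hiz]
    ring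
  rw [e, map_sub, map_sub, gammaMoment_X_mul_pderiv,
    gammaMoment_pderiv_of_X_dvd hz ((hF.mul_right q).mul_left (X i)), mul_add, map_add,
    mul_smul_comm, map_smul, smul_eq_mul]
  ring

lemma gammaMoment_X_mul_pderiv_mul (b : σ → ℝ) (i : σ) (h q : MvPolynomial σ ℝ) :
    gammaMoment b (X i * pderiv i h * q) = gammaMoment b (h * (X i * q)) -
      b i * gammaMoment b (h * q) - gammaMoment b (h * (X i * pderiv i q)) := by
  have e : X i * pderiv i h * q = X i * pderiv i (h * q) - h * (X i * pderiv i q) := by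
    rw [pderiv_mul]; ring
  rw [e, map_sub, gammaMoment_X_mul_pderiv, show X i * (h * q) = h * (X i * q) by ring]

/-- A homogeneous polynomial orthogonal to all polynomials of lower degree is harmonic for the
operator `∑ i, (y_i ∂_i² + b_i ∂_i)`. -/
lemma sum_X_mul_pderiv_pderiv_eq_zero {b : σ → ℝ} {n : ℕ} {h : MvPolynomial σ ℝ}
    (hpos : ∀ p : MvPolynomial σ ℝ, p.IsHomogeneous (n - 1) → gammaMoment b (p * p) = 0 → p = 0)
    (hn : 1 ≤ n) (hh : h.IsHomogeneous n) (horth : ∀ q ∈ degLT σ n, gammaMoment b (h * q) = 0) :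
    ∑ i, (X i * pderiv i (pderiv i h) + b i • pderiv i h) = 0 := by
  have hhom : (∑ i, (X i * pderiv i (pderiv i h) + b i • pderiv i h)).IsHomogeneous (n - 1) :=
    IsHomogeneous.sum _ _ _ fun i _ => (IsHomogeneous.X_mul_pderiv hh.pderiv i i).add
      ((homogeneousSubmodule σ ℝ (n - 1)).smul_mem (b i) hh.pderiv)
  have key : ∀ q ∈ degLT σ n,
      gammaMoment b ((∑ i, (X i * pderiv i (pderiv i h) + b i • pderiv i h)) * q) = 0 := by
    intro q hq
    have h1 : ∀ i, gammaMoment b ((X i * pderiv i (pderiv i h) + b i • pderiv i h) * q) =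
        gammaMoment b (X i * pderiv i h * q) := by
      intro i
      have h2 : gammaMoment b (X i * pderiv i h * pderiv i q) = 0 := by
        have hq1 := pderiv_mem_degLT i hq
        rw [gammaMoment_X_mul_pderiv_mul, horth _ (X_mul_pderiv_mem_degLT i i hq),
          horth _ (degLT_mono (Nat.sub_le _ _) hq1),
          horth _ (degLT_mono (Nat.sub_le _ _) (X_mul_pderiv_mem_degLT i i hq1))]
        ring
      have h3 := gammaMoment_X_mul_pderiv b i (pderiv i h * q)
      rw [pderiv_mul, mul_add, map_add,
        show X i * (pderiv i h * pderiv i q) = X i * pderiv i h * pderiv i q by ring, h2] at h3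
      rw [add_mul, map_add, smul_mul_assoc, map_smul, smul_eq_mul, mul_assoc, mul_assoc]
      linarith
    rw [Finset.sum_mul, map_sum, Finset.sum_congr rfl fun i _ => h1 i, ← map_sum,
      ← Finset.sum_mul, hh.sum_X_mul_pderiv, smul_mul_assoc, map_nsmul, horth q hq, smul_zero]
  refine hpos _ hhom (key _ (degLT_mono ?_ (IsHomogeneous.mem_degLT hhom)))
  omega

end Tangential

/-! ### Homogeneous coordinates -/

section Dehom

variable {d : ℕ}

/-- The polynomial on the simplex obtained by substituting the barycentric coordinates. -/
def dehom (d : ℕ) : MvPolynomial (Fin (d + 1)) ℝ →ₐ[ℝ] MvPolynomial (Fin d) ℝ :=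
  aeval (baryPoly d)

lemma dehom_X (i : Fin (d + 1)) : dehom d (X i) = baryPoly d i := aeval_X _ _

lemma baryPoly_castSucc (i : Fin d) : baryPoly d i.castSucc = X i := by
  simp [baryPoly]

lemma baryPoly_last : baryPoly d (Fin.last d) = 1 - ∑ i, X i := by
  simp [baryPoly]

lemma bary_castSucc (x : Fin d → ℝ) (i : Fin d) : bary x i.castSucc = x i := by
  simp [bary]

lemma bary_last (x : Fin d → ℝ) : bary x (Fin.last d) = 1 - ∑ i, x i := by
  simp [bary]

lemma eval_baryPoly (x : Fin d → ℝ) (i : Fin (d + 1)) : eval x (baryPoly d i) = bary x i := by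
  induction i using Fin.lastCases with
  | last => simp [baryPoly_last, bary_last]
  | cast i => simp [baryPoly_castSucc, bary_castSucc]

lemma eval_dehom (x : Fin d → ℝ) (P : MvPolynomial (Fin (d + 1)) ℝ) :
    eval x (dehom d P) = eval (bary x) P := by
  induction P using MvPolynomial.induction_on with
  | C c => rw [dehom, aeval_C, algebraMap_eq, eval_C, eval_C]
  | add p q hp hq => simp only [map_add, hp, hq]
  | mul_X p i hp => rw [map_mul, map_mul, map_mul, hp, dehom_X, eval_baryPoly, eval_X]

lemma dehom_rename (p : MvPolynomial (Fin d) ℝ) :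
    dehom d (rename Fin.castSucc p) = p := by
  rw [dehom, aeval_rename, show baryPoly d ∘ Fin.castSucc = X from
    funext fun i => baryPoly_castSucc i, aeval_X_left_apply]

lemma dehom_sum_X : dehom d (∑ i, X i) = 1 := by
  rw [map_sum, Fin.sum_univ_castSucc]
  simp only [dehom_X, baryPoly_castSucc, baryPoly_last]
  ring

lemma dehom_prod_X (A : Finset (Fin (d + 1))) : dehom d (∏ i ∈ A, X i) = baryProd A := by
  simp only [map_prod, dehom_X, baryProd]

lemma pderiv_dehom (i : Fin d) (P : MvPolynomial (Fin (d + 1)) ℝ) :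
    pderiv i (dehom d P) = dehom d (pderiv i.castSucc P - pderiv (Fin.last d) P) := by
  induction P using MvPolynomial.induction_on with
  | C c => rw [dehom, aeval_C, algebraMap_eq, pderiv_C, pderiv_C, pderiv_C, sub_zero, map_zero]
  | add p q hp hq => simp only [map_add, hp, hq, map_sub]; ring
  | mul_X p j hp =>
    have hj : pderiv i (dehom d (X j)) =
        dehom d (pderiv i.castSucc (X j) - pderiv (Fin.last d) (X j)) := by
      rw [dehom_X]
      induction j using Fin.lastCases with
      | last =>
        rw [baryPoly_last, map_sub, pderiv_one, map_sum, pderiv_X_self,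
          pderiv_X_of_ne (Fin.castSucc_lt_last i).ne', Finset.sum_eq_single i,
          pderiv_X_self, zero_sub, zero_sub, map_neg, map_one]
        · intro j _ hj
          exact pderiv_X_of_ne hj
        · simp
      | cast j =>
        rw [baryPoly_castSucc, pderiv_X_of_ne (Fin.castSucc_lt_last j).ne, sub_zero]
        rcases eq_or_ne j i with rfl | hne
        · rw [pderiv_X_self, pderiv_X_self, map_one]
        · rw [pderiv_X_of_ne hne, pderiv_X_of_ne (fun h => hne (Fin.castSucc_injective d h)),
            map_zero]
    rw [map_mul, pderiv_mul, hp, hj]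
    simp only [pderiv_mul, map_sub, map_add, map_mul]
    ring

lemma totalDegree_baryPoly_le (i : Fin (d + 1)) : (baryPoly d i).totalDegree ≤ 1 := by
  induction i using Fin.lastCases with
  | last =>
    rw [baryPoly_last]
    refine (totalDegree_sub _ _).trans (max_le (by simp) ?_)
    exact totalDegree_finsetSum_le fun i _ => (totalDegree_X i).le
  | cast i => rw [baryPoly_castSucc, totalDegree_X]

lemma dehom_mem_degLT {n : ℕ} {P : MvPolynomial (Fin (d + 1)) ℝ} (hP : P ∈ degLT _ n) :
    dehom d P ∈ degLT _ n := by
  suffices h : degLT _ n ≤ (degLT (Fin d) n).comap (dehom d).toLinearMap from h hP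
  refine restrictSupport_induction fun α hα => ?_
  refine mem_degLT_of_totalDegree_lt (lt_of_le_of_lt ?_ hα)
  rw [AlgHom.toLinearMap_apply, dehom, aeval_monomial, map_one, one_mul,
    Finsupp.prod_fintype _ _ fun _ => pow_zero _, Finsupp.degree_eq_sum]
  refine (totalDegree_finsetProd _ _).trans (Finset.sum_le_sum fun i _ => ?_)
  refine (totalDegree_pow _ _).trans ?_
  exact (Nat.mul_le_mul_left _ (totalDegree_baryPoly_le i)).trans (mul_one _).le

lemma rename_mem_degLT {n : ℕ} {p : MvPolynomial (Fin d) ℝ} (hp : p ∈ degLT _ n) :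
    rename Fin.castSucc p ∈ degLT (Fin (d + 1)) n := by
  cases n with
  | zero => rw [mem_degLT_zero.1 hp, map_zero]; exact zero_mem _
  | succ n => exact mem_degLT_succ.2 ((totalDegree_rename_le _ _).trans (mem_degLT_succ.1 hp))

/-- A polynomial of degree at most `n` can be homogenised to degree `n`. -/
lemma exists_isHomogeneous_dehom_eq {n : ℕ} {p : MvPolynomial (Fin d) ℝ}
    (hp : p ∈ degLT _ (n + 1)) :
    ∃ P : MvPolynomial (Fin (d + 1)) ℝ, P.IsHomogeneous n ∧ dehom d P = p := by
  suffices h : degLT _ (n + 1) ≤ (homogeneousSubmodule (Fin (d + 1)) ℝ n).map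
      (dehom d).toLinearMap from h hp
  refine restrictSupport_induction fun α hα => ?_
  have hle : α.degree ≤ n := Nat.lt_succ_iff.1 hα
  refine ⟨rename Fin.castSucc (monomial α 1) * (∑ i, X i) ^ (n - α.degree), ?_, ?_⟩
  · have h1 : (rename Fin.castSucc (monomial α (1 : ℝ))).IsHomogeneous α.degree :=
      (isHomogeneous_monomial 1 rfl).rename_isHomogeneous
    have h2 : ((∑ i : Fin (d + 1), X i : MvPolynomial _ ℝ) ^ (n - α.degree)).IsHomogeneous
        (1 * (n - α.degree)) :=
      (IsHomogeneous.sum _ _ _ fun i _ => isHomogeneous_X ℝ i).pow _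
    have := h1.mul h2
    rwa [one_mul, Nat.add_sub_cancel' hle] at this
  · rw [AlgHom.toLinearMap_apply, map_mul, map_pow, dehom_sum_X, one_pow, mul_one, dehom_rename]

end Dehom

/-! ### The Rodrigues formula -/

section RodriguesFormula

variable {d : ℕ}

lemma hasDerivAt_eval_line {σ : Type*} [Fintype σ] (y δ : σ → ℝ) (P : MvPolynomial σ ℝ) :
    HasDerivAt (fun t : ℝ => eval (fun j => y j + t * δ j) P)
      (∑ j, δ j * eval y (pderiv j P)) 0 := by
  classical
  induction P using MvPolynomial.induction_on with
  | C c => simpa using hasDerivAt_const (0 : ℝ) c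
  | add p q hp hq =>
    simp only [map_add, mul_add, Finset.sum_add_distrib]
    exact hp.add hq
  | mul_X p i hp =>
    have h1 : HasDerivAt (fun t : ℝ => y i + t * δ i) (δ i) 0 := by
      simpa using ((hasDerivAt_id (0 : ℝ)).mul_const (δ i)).const_add (y i)
    have h2 := hp.mul h1
    simp only [map_mul, eval_X]
    refine h2.congr_deriv ?_
    simp only [pderiv_mul, map_add, map_mul, eval_X, pderiv_X, mul_add, zero_mul, add_zero]
    rw [Finset.sum_add_distrib, Finset.sum_mul]
    congr 1
    · exact Finset.sum_congr rfl fun j _ => by ring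
    · rw [Finset.sum_eq_single i]
      · simp; ring
      · intro j _ hj
        simp [hj.symm]
      · simp

lemma bary_add_smul (x : Fin d → ℝ) (t : ℝ) (i r j : Fin (d + 1)) :
    bary (x + t • (coordDir i - coordDir r)) j =
      bary x j + t * (Pi.single (M := fun _ => ℝ) i 1 j - Pi.single (M := fun _ => ℝ) r 1 j) := by
  have hlast : ∀ l : Fin (d + 1), ∑ m, coordDir l m =
      1 - Pi.single (M := fun _ => ℝ) l 1 (Fin.last d) := by
    intro l
    induction l using Fin.lastCases with
    | last => simp [coordDir]
    | cast l => simp [coordDir, (Fin.castSucc_lt_last l).ne']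
  have hcast : ∀ (l : Fin (d + 1)) (m : Fin d), coordDir l m =
      Pi.single (M := fun _ => ℝ) l 1 m.castSucc := by
    intro l m
    induction l using Fin.lastCases with
    | last => simp [coordDir, (Fin.castSucc_lt_last m).ne]
    | cast l => simp [coordDir, Pi.single_apply]
  induction j using Fin.lastCases with
  | last =>
    rw [bary_last, bary_last]
    simp only [Pi.add_apply, Pi.smul_apply, Pi.sub_apply, smul_eq_mul, Finset.sum_add_distrib,
      ← Finset.mul_sum, Finset.sum_sub_distrib, hlast]
    ring
  | cast j =>
    rw [bary_castSucc, bary_castSucc]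
    simp only [Pi.add_apply, Pi.smul_apply, Pi.sub_apply, smul_eq_mul, hcast]

lemma isOpen_bary_pos : IsOpen {x : Fin d → ℝ | ∀ i, 0 < bary x i} := by
  have h : ∀ i : Fin (d + 1), Continuous fun x : Fin d → ℝ => bary x i := by
    intro i
    induction i using Fin.lastCases with
    | last => simp only [bary_last]; fun_prop
    | cast i => simp only [bary_castSucc]; fun_prop
  simp only [Set.ofPred_forall]
  exact isOpen_iInter_of_finite fun i => isOpen_lt continuous_const (h i)

/-- Polynomials that agree on the open simplex are equal. -/
lemma eq_of_eval_eq {p q : MvPolynomial (Fin d) ℝ}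
    (h : ∀ x : Fin d → ℝ, (∀ i, 0 < bary x i) → eval x p = eval x q) : p = q := by
  refine funext_set (fun _ => Set.Ioo (0 : ℝ) (1 / (d + 1))) (fun _ => Set.Ioo_infinite
    (by positivity)) fun x hx => h x fun i => ?_
  have hx' : ∀ i, 0 < x i ∧ x i < 1 / (d + 1) := fun i => hx i (Set.mem_univ i)
  induction i using Fin.lastCases with
  | last =>
    rw [bary_last, sub_pos]
    calc ∑ i, x i ≤ ∑ _i : Fin d, (1 / (d + 1) : ℝ) :=
          Finset.sum_le_sum fun i _ => (hx' i).2.le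
      _ = d / (d + 1) := by
          rw [Finset.sum_const, Finset.card_univ, Fintype.card_fin, nsmul_eq_mul]; ring
      _ < 1 := by rw [div_lt_one (by positivity)]; linarith
  | cast i => rw [bary_castSucc]; exact (hx' i).1

/-- One differentiation in the Rodrigues formula. -/
lemma lineDeriv_prod_rpow_mul {x : Fin d → ℝ} (hx : ∀ i, 0 < bary x i) {i r : Fin (d + 1)}
    (hir : i ≠ r) (e : Fin (d + 1) → ℝ) (P : MvPolynomial (Fin (d + 1)) ℝ) :
    lineDeriv ℝ (fun y => (∏ j, bary y j ^ (e + Pi.single i 1 + Pi.single r 1 : Fin (d + 1) → ℝ) j) *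
        eval (bary y) P) x (coordDir i - coordDir r) =
      (∏ j, bary x j ^ e j) * eval (bary x) (C (e i + 1) * (X r * P) - C (e r + 1) * (X i * P) +
        X i * (X r * pderiv i P - X r * pderiv r P)) := by
  set δ : Fin (d + 1) → ℝ := Pi.single i 1 - Pi.single r 1 with hδ
  set e' : Fin (d + 1) → ℝ := e + Pi.single i 1 + Pi.single r 1 with he'
  have hsum : ∀ f : Fin (d + 1) → ℝ, ∑ j, δ j * f j = f i - f r := fun f => by
    simp [hδ, sub_mul, Finset.sum_sub_distrib, Pi.single_apply]
  have h1 : ∀ j, HasDerivAt (fun t : ℝ => (bary x j + t * δ j) ^ e' j)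
      (δ j * (e' j / bary x j) * bary x j ^ e' j) 0 := by
    intro j
    have h2 : HasDerivAt (fun t : ℝ => bary x j + t * δ j) (δ j) 0 := by
      simpa using ((hasDerivAt_id (0 : ℝ)).mul_const (δ j)).const_add (bary x j)
    have h3 := h2.rpow_const (p := e' j) (Or.inl (by simpa using (hx j).ne'))
    convert h3 using 1
    rw [zero_mul, add_zero, Real.rpow_sub_one (hx j).ne']
    ring
  have h4 := HasDerivAt.fun_finsetProd (u := Finset.univ) fun j _ => h1 j
  have h5 := h4.mul (hasDerivAt_eval_line (bary x) δ P)
  have hprod : ∏ j, bary x j ^ e' j = (∏ j, bary x j ^ e j) * (bary x i * bary x r) := by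
    have hs : ∀ l : Fin (d + 1), ∏ j, bary x j ^ (Pi.single (M := fun _ => ℝ) l 1 j) =
        bary x l := fun l => by
      rw [Finset.prod_eq_single l]
      · simp
      · intro j _ hj
        simp [hj]
      · simp
    rw [← hs i, ← hs r, ← Finset.prod_mul_distrib, ← Finset.prod_mul_distrib]
    refine Finset.prod_congr rfl fun j _ => ?_
    rw [← Real.rpow_add (hx j), ← Real.rpow_add (hx j), he', Pi.add_apply, Pi.add_apply, add_assoc]
  have hei : e' i = e i + 1 := by simp [he', hir.symm]
  have her : e' r = e r + 1 := by simp [he', hir.symm]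
  rw [lineDeriv]
  simp only [bary_add_smul]
  have h6 : ∀ t : ℝ, bary (x + t • (coordDir i - coordDir r)) = fun j => bary x j + t * δ j :=
    fun t => funext fun j => bary_add_smul x t i r j
  simp only [h6]
  refine h5.deriv.trans ?_
  have h7 : ∑ j, (∏ l ∈ Finset.univ.erase j, (bary x l + 0 * δ l) ^ e' l) •
      (δ j * (e' j / bary x j) * bary x j ^ e' j) =
      (∏ j, bary x j ^ e' j) * (e' i / bary x i - e' r / bary x r) := by
    rw [← hsum fun j => e' j / bary x j, Finset.mul_sum]
    refine Finset.sum_congr rfl fun j _ => ?_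
    rw [← Finset.mul_prod_erase Finset.univ _ (Finset.mem_univ j), smul_eq_mul]
    simp only [zero_mul, add_zero]
    ring
  rw [h7, hsum fun j => eval (bary x) (pderiv j P), hprod, hei, her]
  simp only [zero_mul, add_zero, map_add, map_sub, map_mul, eval_C, eval_X]
  rw [hprod]
  have := (hx i).ne'
  have := (hx r).ne'
  field_simp

lemma foldr_lineDeriv {r : Fin (d + 1)} {L : List (Fin (d + 1))} (hr : r ∉ L)
    (e : Fin (d + 1) → ℝ) (F : (Fin d → ℝ) → ℝ)
    (hF : ∀ x, (∀ i, 0 < bary x i) → F x =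
      ∏ j, bary x j ^ (e j + L.count j + if j = r then (L.length : ℝ) else 0))
    (x : Fin d → ℝ) (hx : ∀ i, 0 < bary x i) :
    L.foldr (fun i (G : (Fin d → ℝ) → ℝ) (y : Fin d → ℝ) =>
      lineDeriv ℝ G y (coordDir i - coordDir r)) F x =
      (∏ j, bary x j ^ e j) * eval (bary x) (rodPoly r L (e + 1)) := by
  induction L generalizing e x with
  | nil =>
    rw [List.foldr_nil, hF x hx]
    simp [rodPoly]
  | cons i L ih =>
    obtain ⟨hi, hL⟩ := not_or.1 (mt List.mem_cons.2 hr)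
    have hir : i ≠ r := Ne.symm hi
    have h := ih hL (e + Pi.single i 1 + Pi.single r 1) fun x hx => by
      rw [hF x hx]
      refine Finset.prod_congr rfl fun j _ => ?_
      congr 1
      simp only [Pi.add_apply, Pi.single_apply, List.count_cons, List.length_cons, beq_iff_eq,
        eq_comm (a := i)]
      by_cases hj : j = r
      · subst hj
        simp [hi]
        ring
      · by_cases hji : j = i
        · subst hji
          simp [hj]
          ring
        · simp [hj, hji]
    rw [List.foldr_cons]
    have hev : L.foldr (fun i (G : (Fin d → ℝ) → ℝ) (y : Fin d → ℝ) =>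
        lineDeriv ℝ G y (coordDir i - coordDir r)) F =ᶠ[nhds x]
        fun y => (∏ j, bary y j ^ (e + Pi.single i 1 + Pi.single r 1 : Fin (d + 1) → ℝ) j) *
          eval (bary y) (rodPoly r L (e + Pi.single i 1 + Pi.single r 1 + 1)) := by
      filter_upwards [isOpen_bary_pos.mem_nhds hx] with y hy
      exact h y hy
    rw [hev.lineDeriv_eq, lineDeriv_prod_rpow_mul hx hir, rodPoly]
    rw [show e + Pi.single i 1 + Pi.single r 1 + 1 = e + 1 + Pi.single i 1 + Pi.single r 1 by
      abel]
    rfl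

/-- The list in which the index `i` occurs `ν i` times, in increasing order. -/
def expList {n : ℕ} (ν : Fin n → ℕ) : List (Fin n) :=
  (List.finRange n).flatMap fun i => List.replicate (ν i) i

lemma count_expList {n : ℕ} (ν : Fin n → ℕ) (i : Fin n) : (expList ν).count i = ν i := by
  rw [expList, List.count_flatMap]
  have h : (List.count i ∘ fun j => List.replicate (ν j) j) = fun j => if j = i then ν j else 0 := by
    ext j
    simp [List.count_replicate]
  rw [h, ← Fin.sum_univ_def]
  simp

lemma length_expList {n : ℕ} (ν : Fin n → ℕ) : (expList ν).length = ∑ i, ν i := by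
  rw [expList, List.length_flatMap, Fin.sum_univ_def]
  simp

lemma foldr_iterate_eq_foldr_flatMap {α β : Type*} (op : α → β → β) (ν : α → ℕ) (l : List α)
    (b : β) : l.foldr (fun i => (op i)^[ν i]) b =
      (l.flatMap fun i => List.replicate (ν i) i).foldr op b := by
  have h : ∀ (n : ℕ) (i : α) (b : β), (List.replicate n i).foldr op b = (op i)^[n] b := by
    intro n i b
    induction n with
    | zero => rfl
    | succ n ih => rw [List.replicate_succ, List.foldr_cons, ih, Function.iterate_succ_apply']
  induction l with
  | nil => rfl
  | cons i l ih => rw [List.foldr_cons, ih, List.flatMap_cons, List.foldr_append, h]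

lemma rodrigues_eq {g : Fin (d + 1) → ℝ} {r : Fin (d + 1)} {ν : Fin (d + 1) → ℕ}
    (hν : ν r = 0) {x : Fin d → ℝ} (hx : ∀ i, 0 < bary x i) :
    rodrigues g r ν x = eval (bary x) (rodPoly r (expList ν) (g + 1)) := by
  have hr : r ∉ expList ν := by rw [← List.count_eq_zero, count_expList, hν]
  rw [rodrigues, foldr_iterate_eq_foldr_flatMap (fun i (G : (Fin d → ℝ) → ℝ) (y : Fin d → ℝ) =>
    lineDeriv ℝ G y (coordDir i - coordDir r)), ← expList, foldr_lineDeriv hr g _ _ x hx,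
    ← mul_assoc, ← Finset.prod_mul_distrib, Finset.prod_eq_one, one_mul]
  · intro i _
    rw [← Real.rpow_add (hx i), neg_add_cancel, Real.rpow_zero]
  · intro x hx
    refine Finset.prod_congr rfl fun j _ => ?_
    congr 1
    rw [count_expList, length_expList, add_assoc]
    congr 1
    split_ifs with h
    · rw [h, hν, Nat.cast_zero, zero_add]
    · rw [add_zero]

/-- The Rodrigues formula with exponents `ν` defines the polynomial `rodPoly` in barycentric
coordinates. -/
lemma isRodriguesPoly_iff {g : Fin (d + 1) → ℝ} {r : Fin (d + 1)} {ν : Fin (d + 1) → ℕ}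
    (hν : ν r = 0) {p : MvPolynomial (Fin d) ℝ} :
    IsRodriguesPoly g r ν p ↔ p = dehom d (rodPoly r (expList ν) (g + 1)) := by
  constructor
  · intro h
    exact eq_of_eval_eq fun x hx => by rw [h x hx, rodrigues_eq hν hx, eval_dehom]
  · rintro rfl x hx
    rw [rodrigues_eq hν hx, eval_dehom]

end RodriguesFormula

/-! ### Orthogonal polynomials on the full simplex -/

section FullSimplex

variable {d : ℕ}

lemma eval_smul_of_isHomogeneous {σ : Type*} [Fintype σ] {m : ℕ} {P : MvPolynomial σ ℝ}
    (hP : P.IsHomogeneous m) (c : ℝ) (y : σ → ℝ) : eval (c • y) P = c ^ m * eval y P := by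
  rw [eval_eq', eval_eq', Finset.mul_sum]
  refine Finset.sum_congr rfl fun α hα => ?_
  have hdeg : ∑ i, α i = m := by
    rw [← Finsupp.degree_eq_sum]
    exact (DFunLike.congr_fun Finsupp.degree_eq_weight_one α).trans (hP (mem_support_iff.1 hα))
  simp only [Pi.smul_apply, smul_eq_mul, mul_pow, Finset.prod_mul_distrib, Finset.prod_pow_eq_pow_sum,
    hdeg]
  ring

lemma sum_X_ne_zero : (∑ i, X i : MvPolynomial (Fin (d + 1)) ℝ) ≠ 0 := fun h => by
  have := dehom_sum_X (d := d)
  rw [h, map_zero] at this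
  exact zero_ne_one this

/-- On forms of a fixed degree, substitution of the barycentric coordinates is injective. -/
lemma eq_zero_of_dehom_eq_zero {m : ℕ} {P : MvPolynomial (Fin (d + 1)) ℝ}
    (hP : P.IsHomogeneous m) (h : dehom d P = 0) : P = 0 := by
  have key : P * ∑ i, X i = 0 := by
    refine MvPolynomial.funext fun y => ?_
    rw [map_mul, map_sum, map_zero]
    simp only [eval_X]
    by_cases hs : ∑ i, y i = 0
    · rw [hs, mul_zero]
    · set s := ∑ i, y i with hsdef
      have hy : y = s • bary fun i : Fin d => y i.castSucc / s := by
        ext j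
        rw [Pi.smul_apply, smul_eq_mul]
        induction j using Fin.lastCases with
        | last =>
          rw [bary_last, ← Finset.sum_div, mul_sub, mul_div_cancel₀ _ hs, hsdef,
            Fin.sum_univ_castSucc]
          ring
        | cast j => rw [bary_castSucc, mul_div_cancel₀ _ hs]
      rw [hy, eval_smul_of_isHomogeneous hP, ← eval_dehom, h, map_zero, mul_zero, zero_mul]
  exact (mul_eq_zero.1 key).resolve_right sum_X_ne_zero

/-- The index of a barycentric coordinate: `some i` stands for `x_i`, and `none` for `x_{d+1}`. -/
def optIndex (d : ℕ) (o : Option (Fin d)) : Fin (d + 1) := o.elim (Fin.last d) Fin.castSucc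

lemma optIndex_injective : Function.Injective (optIndex d) := by
  rintro (_ | i) (_ | j) h
  · rfl
  · exact absurd h (Fin.castSucc_lt_last j).ne'
  · exact absurd h (Fin.castSucc_lt_last i).ne
  · rw [Fin.castSucc_injective d h]

lemma range_optIndex (j : Fin (d + 1)) : j ∈ Set.range (optIndex d) := by
  induction j using Fin.lastCases with
  | last => exact ⟨none, rfl⟩
  | cast j => exact ⟨some j, rfl⟩

lemma bary_optIndex (x : Fin d → ℝ) (o : Option (Fin d)) : bary x (optIndex d o) = optBary x o := by
  cases o with
  | none => exact bary_last x
  | some i => exact bary_castSucc x i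

lemma prod_optIndex (f : Fin (d + 1) → ℝ) : ∏ o, f (optIndex d o) = ∏ i, f i := by
  rw [Fintype.prod_option, Fin.prod_univ_castSucc, mul_comm]
  rfl

lemma weight_eq (g : Fin (d + 1) → ℝ) (x : Fin d → ℝ) :
    weight g x = ∏ o, optBary x o ^ ((g + 1) (optIndex d o) - 1) := by
  rw [weight, ← prod_optIndex]
  exact Finset.prod_congr rfl fun o _ => by simp [bary_optIndex]

lemma mem_openSimplex_iff {x : Fin d → ℝ} : x ∈ openSimplex (Fin d) ↔ ∀ i, 0 < bary x i := by
  rw [openSimplex, Fin.forall_fin_succ']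
  simp only [bary_castSucc, bary_last, sub_pos]
  rfl

lemma exists_weightForm_eq {g : Fin (d + 1) → ℝ} (hg : ∀ i, -1 < g i) : ∃ C : ℝ, 0 < C ∧
    ∀ P Q, weightForm g (dehom d P) (dehom d Q) = C * simplexMoment (g + 1) (P * Q) ∧
      IntegrableOn (fun x => eval x (dehom d P) * eval x (dehom d Q) * weight g x)
        (simplex (Fin d)) := by
  obtain ⟨C, hC, h⟩ := exists_integral_eq_simplexMoment (optIndex d) optIndex_injective
    bary bary_optIndex (fun u j hj => absurd (range_optIndex j) hj) (g + 1)
    (fun o => by simp only [Pi.add_apply, Pi.one_apply]; linarith [hg (optIndex d o)])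
    (fun j hj => absurd (range_optIndex j) hj)
  refine ⟨C, hC, fun P Q => ?_⟩
  obtain ⟨h1, h2⟩ := h (P * Q)
  simp only [map_mul, ← weight_eq] at h1 h2
  simp only [weightForm, eval_dehom]
  exact ⟨h2, h1⟩

lemma eq_zero_of_weightForm_self {g : Fin (d + 1) → ℝ} (hg : ∀ i, -1 < g i)
    {p : MvPolynomial (Fin d) ℝ} (h : weightForm g p p = 0) : p = 0 := by
  obtain ⟨C, _, hC⟩ := exists_weightForm_eq hg
  have hint := (hC (rename Fin.castSucc p) (rename Fin.castSucc p)).2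
  simp only [dehom_rename] at hint
  have hz := eq_zero_of_integral_simplex_eq_zero (w := weight g) (MvPolynomial.continuous_eval p)
    (fun u hu => ?_) (fun u hu => ?_) hint h
  · exact eq_of_eval_eq fun x hx => by rw [hz x (mem_openSimplex_iff.2 hx), map_zero]
  · rw [weight_eq]
    exact Finset.prod_nonneg fun o _ => Real.rpow_nonneg (optBary_nonneg hu o) _
  · rw [weight_eq]
    exact Finset.prod_ne_zero_iff.2 fun o _ => (Real.rpow_pos_of_pos (optBary_pos hu o) _).ne'

lemma eq_zero_of_gammaMoment_self {b : Fin (d + 1) → ℝ} (hb : ∀ i, 0 < b i) {m : ℕ}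
    {z : MvPolynomial (Fin (d + 1)) ℝ} (hz : z.IsHomogeneous m) (h : gammaMoment b (z * z) = 0) :
    z = 0 := by
  have hg : ∀ i, -1 < (b - 1) i := fun i => by
    simp only [Pi.sub_apply, Pi.one_apply]; linarith [hb i]
  obtain ⟨C, _, hC⟩ := exists_weightForm_eq hg
  refine eq_zero_of_dehom_eq_zero hz (eq_zero_of_weightForm_self hg ?_)
  rw [(hC z z).1, sub_add_cancel, simplexMoment_of_isHomogeneous b (hz.mul hz), h, zero_div,
    mul_zero]

/-- Orthogonal polynomials for the weight `W_g`, homogenised to degree `n`. -/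
lemma exists_homogeneous_of_isOrthogonalPoly {g : Fin (d + 1) → ℝ} (hg : ∀ i, -1 < g i) {n : ℕ}
    {p : MvPolynomial (Fin d) ℝ} (hp : IsOrthogonalPoly (weightForm g) n p) :
    ∃ h : MvPolynomial (Fin (d + 1)) ℝ, h.IsHomogeneous n ∧ dehom d h = p ∧
      ∀ q ∈ degLT _ n, gammaMoment (g + 1) (h * q) = 0 := by
  obtain ⟨h, hh, rfl⟩ := exists_isHomogeneous_dehom_eq (mem_degLT_succ.2 hp.1)
  refine ⟨h, hh, rfl, fun q hq => ?_⟩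
  obtain ⟨C, hC0, hC⟩ := exists_weightForm_eq hg
  refine gammaMoment_mul_eq_zero (M := n) (Finset.sum_pos (fun i _ => ?_) Finset.univ_nonempty) hh
    (fun q hq => ?_) hq
  · simp only [Pi.add_apply, Pi.one_apply]; linarith [hg i]
  · cases n with
    | zero => rw [mem_degLT_zero.1 hq, mul_zero, map_zero]
    | succ n =>
      have := hp.2 (dehom d q) (Nat.lt_succ_iff.2 (mem_degLT_succ.1 (dehom_mem_degLT hq)))
      rw [(hC h q).1, mul_eq_zero] at this
      exact this.resolve_left hC0.ne'

/-- Every polynomial of degree at most `n` is an orthogonal polynomial up to lower-order terms. -/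
lemma exists_mem_V_sub_mem_degLT {g : Fin (d + 1) → ℝ} (hg : ∀ i, -1 < g i) {n : ℕ}
    {p : MvPolynomial (Fin d) ℝ} (hp : p ∈ degLT _ (n + 1)) :
    ∃ v ∈ V n g, p - v ∈ degLT _ n := by
  obtain ⟨C, hC0, hC⟩ := exists_weightForm_eq hg
  let R : MvPolynomial (Fin d) ℝ →ₗ[ℝ] MvPolynomial (Fin (d + 1)) ℝ :=
    (rename Fin.castSucc).toLinearMap
  let B : MvPolynomial (Fin d) ℝ →ₗ[ℝ] MvPolynomial (Fin d) ℝ →ₗ[ℝ] ℝ :=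
    ((LinearMap.mul ℝ (MvPolynomial (Fin (d + 1)) ℝ)).compr₂ (simplexMoment (g + 1))).compl₁₂ R R
  have hB : ∀ p q, weightForm g p q = C * B p q := fun p q => by
    have := (hC (rename Fin.castSucc p) (rename Fin.castSucc q)).1
    rwa [dehom_rename, dehom_rename] at this
  obtain ⟨k, hk, horth⟩ := exists_mem_forall_apply_sub_eq_zero B (degLT (Fin d) n)
    (fun k _ h => eq_zero_of_weightForm_self hg (by rw [hB, h, mul_zero])) p
  refine ⟨p - k, Submodule.subset_span ⟨?_, fun q hq => ?_⟩, by rwa [sub_sub_cancel]⟩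
  · exact mem_degLT_succ.1 (sub_mem hp (degLT_mono (Nat.le_succ n) hk))
  · rw [hB, horth q (mem_degLT_of_totalDegree_lt hq), mul_zero]

end FullSimplex

/-! ### The summands of the spaces `U` -/

section Summands

variable {d : ℕ}

/-- `h` is homogeneous of degree `m`, does not involve the variables `y_i`, `i ∈ S`, and is
orthogonal to all polynomials of lower degree for the weight `g`. -/
structure IsFaceOrth (g : Fin (d + 1) → ℝ) (S : Finset (Fin (d + 1))) (m : ℕ)
    (h : MvPolynomial (Fin (d + 1)) ℝ) : Prop where
  isHomogeneous : h.IsHomogeneous m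
  pderiv_eq_zero : ∀ i ∈ S, pderiv i h = 0
  orth : ∀ b : Fin (d + 1) → ℝ, (∀ i ∉ S, b i = g i + 1) → ∀ q ∈ degLT _ m,
    gammaMoment b (h * q) = 0

lemma mulV_le {g : Fin (d + 1) → ℝ} (hg : ∀ i, -1 < g i) {n : ℕ} {A : Finset (Fin (d + 1))}
    {W : Submodule ℝ (MvPolynomial (Fin d) ℝ)}
    (hW : A.card ≤ n → ∀ h, IsFaceOrth g ∅ (n - A.card) h → dehom d ((∏ i ∈ A, X i) * h) ∈ W) :
    mulV n g A ≤ W := by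
  rw [mulV]
  split_ifs with hA
  · rw [Submodule.map_le_iff_le_comap, V, Submodule.span_le]
    intro p hp
    obtain ⟨h, h1, rfl, h2⟩ := exists_homogeneous_of_isOrthogonalPoly hg hp
    have := hW hA h ⟨h1, fun i hi => absurd hi (Finset.notMem_empty i), fun b hb q hq => by
      rw [show b = g + 1 from funext fun i => hb i (Finset.notMem_empty i)]
      exact h2 q hq⟩
    rwa [map_mul, dehom_prod_X] at this
  · exact bot_le

lemma isFaceOrth_rodPoly {g : Fin (d + 1) → ℝ} {S : Finset (Fin (d + 1))} {r : Fin (d + 1)}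
    (hr : r ∉ S) {ν : Fin (d + 1) → ℕ} (hνr : ν r = 0) (hνS : ∀ i ∈ S, ν i = 0) :
    IsFaceOrth g S (∑ i, ν i) (rodPoly r (expList ν) (g + 1)) := by
  have hmem : ∀ i, ν i = 0 → i ∉ expList ν := fun i hi => by
    rw [← List.count_eq_zero, count_expList, hi]
  rw [← length_expList]
  refine ⟨rodPoly_isHomogeneous r _ _, fun i hi => pderiv_rodPoly_eq_zero
    (ne_of_mem_of_not_mem hi hr) (hmem i (hνS i hi)) _, fun b hb q hq => ?_⟩
  rw [rodPoly_congr (b := g + 1) (b' := b) (hb r hr).symm fun i hi => (hb i fun hiS =>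
    hmem i (hνS i hiS) hi).symm]
  exact gammaMoment_rodPoly_mul_eq_zero (hmem r hνr) b hq

lemma H_le {g : Fin (d + 1) → ℝ} {S : Finset (Fin (d + 1))} {r : Fin (d + 1)} {m : ℕ}
    (hr : S.card < d → r ∉ S) {W : Submodule ℝ (MvPolynomial (Fin d) ℝ)}
    (hW : ∀ h, IsFaceOrth g S m h → dehom d h ∈ W) : H m g S r ≤ W := by
  rw [H]
  split_ifs with hS
  · exact bot_le
  · rw [Submodule.span_le]
    rintro p ⟨ν, rfl, hνr, hνS, hp⟩
    rw [(isRodriguesPoly_iff hνr).1 hp]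
    exact hW _ (isFaceOrth_rodPoly (hr (not_le.1 hS)) hνr hνS)

lemma mulH_le {g : Fin (d + 1) → ℝ} {n : ℕ} {A S : Finset (Fin (d + 1))}
    {r : Finset (Fin (d + 1)) → Fin (d + 1)} (hr : S.card < d → r S ∉ S)
    {W : Submodule ℝ (MvPolynomial (Fin d) ℝ)}
    (hW : A.card ≤ n → ∀ h, IsFaceOrth g S (n - A.card) h → dehom d ((∏ i ∈ A, X i) * h) ∈ W) :
    mulH n g A S r ≤ W := by
  rw [mulH]
  split_ifs with hA
  · rw [Submodule.map_le_iff_le_comap]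
    refine H_le hr fun h hh => ?_
    have := hW hA h hh
    rwa [map_mul, dehom_prod_X] at this
  · exact bot_le

lemma baryProd_mem_degLT (A : Finset (Fin (d + 1))) : baryProd A ∈ degLT (Fin d) (A.card + 1) := by
  rw [mem_degLT_succ, baryProd]
  refine (totalDegree_finsetProd _ _).trans ((Finset.sum_le_sum fun i _ =>
    totalDegree_baryPoly_le i).trans ?_)
  simp

/-- The summands of `U_n` and the polynomials of degree less than `n` span all polynomials of degree
at most `n`. A polynomial `x_A p` is reduced to summands with larger `A`: on the face where the
remaining variables of `M` vanish, `p` agrees with a combination of Rodrigues polynomials up to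
lower-order terms. -/
lemma baryProd_mul_mem {M : Finset (Fin (d + 1))} {n : ℕ}
    (g : Finset (Fin (d + 1)) → Fin (d + 1) → ℝ) (hg : ∀ A i, -1 < g A i)
    {r : Finset (Fin (d + 1)) → Fin (d + 1)} (hr : ∀ S : Finset (Fin (d + 1)), S.card < d → r S ∉ S)
    {W : Submodule ℝ (MvPolynomial (Fin d) ℝ)} (hWV : mulV n (g M) M ≤ W)
    (hWH : ∀ A ⊂ M, (M \ A).card < d → mulH n (g A) A (M \ A) r ≤ W) (hWn : degLT _ n ≤ W)
    (hn : ∀ A ⊂ M, d ≤ (M \ A).card → A.card < n) (A : Finset (Fin (d + 1))) (hAM : A ⊆ M)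
    (hAn : A.card ≤ n) (p : MvPolynomial (Fin d) ℝ) (hp : p ∈ degLT _ (n - A.card + 1)) :
    baryProd A * p ∈ W := by
  induction hc : (M \ A).card using Nat.strong_induction_on generalizing A p with
  | _ c ih =>
  have hlow : ∀ q ∈ degLT (Fin d) (n - A.card), baryProd A * q ∈ W := fun q hq => by
    have := mul_mem_degLT (baryProd_mem_degLT A) hq
    rw [Nat.add_sub_cancel' hAn] at this
    exact hWn this
  rcases hAM.eq_or_ssubset with rfl | hss
  · obtain ⟨v, hv, hlv⟩ := exists_mem_V_sub_mem_degLT (hg A) hp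
    have h1 : baryProd A * v ∈ W := hWV (by
      rw [mulV, if_pos hAn]
      exact Submodule.mem_map_of_mem hv)
    have := add_mem h1 (hlow _ hlv)
    rwa [← mul_add, add_sub_cancel] at this
  set S := M \ A with hS
  have hins : ∀ i ∈ S, ∀ q ∈ degLT (Fin d) (n - A.card), baryPoly d i * (baryProd A * q) ∈ W := by
    intro i hi q hq
    rcases Nat.eq_zero_or_pos (n - A.card) with h0 | hpos
    · rw [h0] at hq
      rw [mem_degLT_zero.1 hq, mul_zero, mul_zero]
      exact zero_mem _
    · obtain ⟨hiM, hiA⟩ := Finset.mem_sdiff.1 hi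
      have hcard := Finset.card_insert_of_notMem hiA
      have := ih (M \ insert i A).card (by
          rw [← hc, hS]
          refine Finset.card_lt_card (Finset.ssubset_iff_subset_ne.2
            ⟨Finset.sdiff_subset_sdiff le_rfl (Finset.subset_insert i A), fun h => ?_⟩)
          have h' : i ∈ M \ insert i A := by rw [h]; exact hi
          simp at h') (insert i A) (Finset.insert_subset hiM hAM) (by omega) q (by
            rwa [hcard, show n - (A.card + 1) + 1 = n - A.card by omega]) rfl
      rwa [baryProd, Finset.prod_insert hiA, ← baryProd, mul_assoc] at this
  obtain ⟨P, hP, rfl⟩ := exists_isHomogeneous_dehom_eq hp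
  set j := n - A.card with hj
  suffices h : restrictSupport ℝ {α : Fin (d + 1) →₀ ℕ | α.degree = j} ≤
      W.comap (LinearMap.mulLeft ℝ (baryProd A) ∘ₗ (dehom d).toLinearMap) by
    refine h (x := P) (mem_restrictSupport.2 fun α hα => ?_)
    exact (DFunLike.congr_fun Finsupp.degree_eq_weight_one α).trans (hP hα)
  refine restrictSupport_induction fun α hα => ?_
  rw [Submodule.mem_comap, LinearMap.comp_apply, LinearMap.mulLeft_apply, AlgHom.toLinearMap_apply]
  by_cases hαS : ∃ i ∈ S, α i ≠ 0
  · obtain ⟨i, hi, hαi⟩ := hαS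
    have hle : Finsupp.single i 1 ≤ α := Finsupp.single_le_iff.2 (Nat.pos_of_ne_zero hαi)
    have hα' : monomial α (1 : ℝ) = X i * monomial (α - Finsupp.single i 1) 1 := by
      rw [X, monomial_mul, one_mul, add_tsub_cancel_of_le hle]
    rw [hα', map_mul, dehom_X, mul_left_comm]
    refine hins i hi _ (dehom_mem_degLT ((monomial_mem_restrictSupport ℝ).2 (Or.inl ?_)))
    have h1 : α.degree = j := hα
    rw [← add_tsub_cancel_of_le hle, map_add, Finsupp.degree_single] at h1
    change (α - Finsupp.single i 1).degree < j
    omega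
  · have hαS' : ∀ i ∉ Sᶜ, α i = 0 := fun i hi => by
      by_contra hne
      exact hαS ⟨i, by simpa using hi, hne⟩
    have hαT : monomial α (1 : ℝ) ∈ homOn Sᶜ j :=
      (monomial_mem_restrictSupport ℝ).2 (Or.inl ⟨hα, hαS'⟩)
    -- if at most one variable is left, then `j > 0`, and the variables sum to `1` modulo `x_S`
    obtain ⟨r', hr', hrS⟩ : ∃ r' ∈ Sᶜ, S.card < d → r' = r S := by
      by_cases hSd : S.card < d
      · exact ⟨r S, Finset.mem_compl.2 (hr S hSd), fun _ => rfl⟩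
      · have hjpos : A.card < n := hn A hss (not_lt.1 hSd)
        have h1 : α ≠ 0 := fun h0 => by
          have h2 : α.degree = j := hα
          rw [h0, map_zero] at h2
          omega
        obtain ⟨i, hi⟩ := Finsupp.ne_iff.1 h1
        exact ⟨i, by by_contra hiS; exact hi (hαS' i hiS), fun h => absurd h hSd⟩
    obtain ⟨p, hp, t, ht, hpt⟩ := exists_mem_span_rodPoly hr' (b := g A + 1)
      (fun i => by simp only [Pi.add_apply, Pi.one_apply]; linarith [hg A i])
      (fun z hz h => eq_zero_of_gammaMoment_self
        (fun i => by simp only [Pi.add_apply, Pi.one_apply]; linarith [hg A i]) hz h)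
      (fun μ => expList μ) (fun μ i => count_expList _ i) hαT
    rw [hpt, map_add, mul_add]
    refine add_mem ?_ ?_
    · suffices hle : Submodule.span ℝ ((fun μ : Fin (d + 1) →₀ ℕ =>
          rodPoly r' (expList μ) (g A + 1)) '' {μ | μ.degree = j ∧ ∀ i ∉ Sᶜ.erase r', μ i = 0}) ≤
          W.comap (LinearMap.mulLeft ℝ (baryProd A) ∘ₗ (dehom d).toLinearMap) from hle hp
      rw [Submodule.span_le]
      rintro _ ⟨μ, ⟨hμ1, hμ2⟩, rfl⟩
      rw [SetLike.mem_coe, Submodule.mem_comap, LinearMap.comp_apply, LinearMap.mulLeft_apply,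
        AlgHom.toLinearMap_apply]
      by_cases hSd : S.card < d
      · refine hWH A hss hSd ?_
        rw [mulH, if_pos hAn]
        refine Submodule.mem_map_of_mem ?_
        rw [H, if_neg (not_le.2 hSd), ← hrS hSd]
        have hμr : μ r' = 0 := hμ2 r' (by simp)
        refine Submodule.subset_span ⟨μ, ?_, hμr, fun i hi => hμ2 i ?_,
          (isRodriguesPoly_iff hμr).2 rfl⟩
        · rw [← Finsupp.degree_eq_sum, hμ1]
        · exact fun h => Finset.mem_compl.1 (Finset.mem_of_mem_erase h) hi
      · exfalso
        have hjpos : A.card < n := hn A hss (not_lt.1 hSd)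
        have hcard : Sᶜ.card ≤ 1 := by
          rw [Finset.card_compl, Fintype.card_fin]
          omega
        have hμ0 : μ = 0 := Finsupp.ext fun i => hμ2 i fun hi => by
          obtain ⟨hne, hi⟩ := Finset.mem_erase.1 hi
          exact hne (Finset.card_le_one.1 hcard i hi r' hr')
        rw [hμ0, map_zero] at hμ1
        omega
    · have htj : dehom d t ∈ degLT (Fin d) j := by
        cases hj' : j with
        | zero =>
          rw [hj', homOnPred_zero] at ht
          rw [(Submodule.mem_bot ℝ).1 ht, map_zero]
          exact zero_mem _
        | succ j' =>
          rw [hj', homOnPred_succ] at ht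
          exact dehom_mem_degLT (IsHomogeneous.mem_degLT (mem_homOn.1 ht).1)
      have hsum : dehom d (∑ i ∈ Sᶜ, X i) = 1 - ∑ i ∈ S, baryPoly d i := by
        rw [eq_sub_iff_add_eq, ← dehom_sum_X, ← Finset.sum_compl_add_sum S, map_add,
          map_sum (dehom d) _ S]
        simp only [dehom_X]
      rw [map_mul, hsum, sub_mul, one_mul, mul_sub, Finset.sum_mul, Finset.mul_sum]
      refine sub_mem (hlow _ htj) (sum_mem fun i hi => ?_)
      rw [mul_left_comm]
      exact hins i hi _ htj

end Summands

/-! ### The bilinear form in terms of moments -/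

section FormMoment

lemma simplexMoment_X_mul {σ : Type*} [Fintype σ] [DecidableEq σ] (b : σ → ℝ) (i : σ)
    (u : MvPolynomial σ ℝ) :
    simplexMoment b (X i * u) = b i / (∑ j, b j) * simplexMoment (b + Pi.single i 1) u := by
  induction u using MvPolynomial.induction_on' with
  | add p q hp hq => rw [mul_add, map_add, map_add, hp, hq, mul_add]
  | monomial α c =>
    have h1 : (X i * monomial α c).IsHomogeneous (1 + α.degree) :=
      (isHomogeneous_X ℝ i).mul (isHomogeneous_monomial c rfl)
    have h2 : (monomial α c).IsHomogeneous α.degree := isHomogeneous_monomial c rfl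
    rw [simplexMoment_of_isHomogeneous b h1, simplexMoment_of_isHomogeneous _ h2,
      gammaMoment_X_mul, add_comm 1 α.degree, ascPochhammer_succ_eval_left]
    simp only [Pi.add_apply, Finset.sum_add_distrib, Finset.sum_pi_single', Finset.mem_univ, if_true]
    rw [div_mul_div_comm]

lemma simplexMoment_C {σ : Type*} [Fintype σ] (b : σ → ℝ) (c : ℝ) :
    simplexMoment b (C c) = c := by
  rw [C_apply, simplexMoment_monomial]
  simp

lemma simplexMoment_mul_self {σ ι : Type*} [Fintype σ] [Fintype ι] (φ : Option ι → σ)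
    (hφ : Function.Injective φ) (y : (ι → ℝ) → σ → ℝ) (hyc : Continuous y)
    (hy : ∀ u o, y u (φ o) = optBary u o)
    (hy0 : ∀ u, ∀ j ∉ Set.range φ, y u j = 0) (b : σ → ℝ) (hb : ∀ o, 0 < b (φ o))
    (hb0 : ∀ j ∉ Set.range φ, b j = 0) (R : MvPolynomial σ ℝ) :
    0 ≤ simplexMoment b (R * R) ∧
      (simplexMoment b (R * R) = 0 → ∀ u ∈ openSimplex ι, eval (y u) R = 0) := by
  obtain ⟨C, hC, h⟩ := exists_integral_eq_simplexMoment φ hφ y hy hy0 b hb hb0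
  obtain ⟨h1, h2⟩ := h (R * R)
  simp only [map_mul] at h1 h2
  have hw : ∀ u ∈ simplex ι, 0 ≤ ∏ o, optBary u o ^ (b (φ o) - 1) := fun u hu =>
    Finset.prod_nonneg fun o _ => Real.rpow_nonneg (optBary_nonneg hu o) _
  constructor
  · refine nonneg_of_mul_nonneg_right ?_ hC
    rw [← h2]
    exact setIntegral_nonneg isClosed_simplex.measurableSet fun u hu =>
      mul_nonneg (mul_self_nonneg _) (hw u hu)
  · intro h0
    rw [h0, mul_zero] at h2
    exact eq_zero_of_integral_simplex_eq_zero ((MvPolynomial.continuous_eval R).comp hyc) hw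
      (fun u hu => Finset.prod_ne_zero_iff.2 fun o _ =>
        (Real.rpow_pos_of_pos (optBary_pos hu o) _).ne') h1 h2

variable {d k : ℕ}

lemma continuous_bary : Continuous fun x : Fin d → ℝ => bary x := by
  refine continuous_pi fun i => ?_
  induction i using Fin.lastCases with
  | last => simp only [bary_last]; fun_prop
  | cast i => simp only [bary_castSucc]; fun_prop

/-- The point of a face of the simplex with given coordinates `x_i`, `i ∈ F`, and `x_i = 0` for
`i ∉ F`. -/
def facePoint (F : Finset (Fin d)) (u : F → ℝ) : Fin d → ℝ :=
  fun i => if hi : i ∈ F then u ⟨i, hi⟩ else 0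

/-- The index in `{1, …, d+1}` of a barycentric coordinate on a face. -/
def faceIndex (F : Finset (Fin d)) (o : Option F) : Fin (d + 1) :=
  o.elim (Fin.last d) fun i => i.1.castSucc

lemma faceIndex_injective (F : Finset (Fin d)) : Function.Injective (faceIndex F) := by
  rintro (_ | i) (_ | j) h
  · rfl
  · exact absurd h (Fin.castSucc_lt_last j.1).ne'
  · exact absurd h (Fin.castSucc_lt_last i.1).ne
  · rw [Subtype.ext (Fin.castSucc_injective d h)]

lemma castSucc_notMem_of_notMem_range {F : Finset (Fin d)} {j : Fin (d + 1)}
    (hj : j ∉ Set.range (faceIndex F)) : ∃ i : Fin d, i ∉ F ∧ j = i.castSucc := by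
  induction j using Fin.lastCases with
  | last => exact absurd ⟨none, rfl⟩ hj
  | cast i => exact ⟨i, fun hi => hj ⟨some ⟨i, hi⟩, rfl⟩, rfl⟩

lemma sum_facePoint (F : Finset (Fin d)) (u : F → ℝ) : ∑ i, facePoint F u i = ∑ j, u j := by
  rw [← Finset.sum_subset (Finset.subset_univ F) fun i _ hi => by rw [facePoint, dif_neg hi],
    ← Finset.sum_coe_sort]
  exact Finset.sum_congr rfl fun i _ => by rw [facePoint, dif_pos i.2]

lemma continuous_facePoint (F : Finset (Fin d)) : Continuous (facePoint F) := by
  refine continuous_pi fun i => ?_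
  by_cases hi : i ∈ F
  · simp only [facePoint, dif_pos hi]; fun_prop
  · simp only [facePoint, dif_neg hi]; fun_prop

lemma bary_facePoint (F : Finset (Fin d)) (u : F → ℝ) (o : Option F) :
    bary (facePoint F u) (faceIndex F o) = optBary u o := by
  cases o with
  | none => exact (bary_last _).trans (by rw [sum_facePoint]; rfl)
  | some i => exact (bary_castSucc _ _).trans (by rw [facePoint, dif_pos i.2]; rfl)

lemma bary_facePoint_eq_zero (F : Finset (Fin d)) (u : F → ℝ) (j : Fin (d + 1))
    (hj : j ∉ Set.range (faceIndex F)) : bary (facePoint F u) j = 0 := by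
  obtain ⟨i, hi, rfl⟩ := castSucc_notMem_of_notMem_range hj
  rw [bary_castSucc, facePoint, dif_neg hi]

/-- The exponents, increased by one, of the weight `x^γ (1 - |x|)^{t-1}` on the face where `x_i = 0`
for `i ∈ m_k \ I`. -/
def faceExp (γ : Fin (d + 1 - k) → ℝ) (I : Finset (Fin d)) (t : ℝ) : Fin (d + 1) → ℝ :=
  Fin.snoc (α := fun _ => ℝ)
    (fun i : Fin d => if h : (i : ℕ) < d + 1 - k then γ ⟨i, h⟩ + 1 else if i ∈ I then 1 else 0) t

lemma faceExp_last (γ : Fin (d + 1 - k) → ℝ) (I : Finset (Fin d)) (t : ℝ) :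
    faceExp γ I t (Fin.last d) = t := by
  simp [faceExp]

lemma faceExp_castSucc (γ : Fin (d + 1 - k) → ℝ) (I : Finset (Fin d)) (t : ℝ) (i : Fin d) :
    faceExp γ I t i.castSucc =
      if h : (i : ℕ) < d + 1 - k then γ ⟨i, h⟩ + 1 else if i ∈ I then 1 else 0 := by
  simp [faceExp]

lemma mem_mSet {i : Fin d} : i ∈ mSet d k ↔ d + 1 - k ≤ (i : ℕ) := by
  simp [mSet]

lemma faceExp_pos {γ : Fin (d + 1 - k) → ℝ} (hγ : ∀ i, -1 < γ i) {I : Finset (Fin d)} {t : ℝ}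
    (ht : 0 < t) (o : Option ((mSet d k \ I)ᶜ : Finset (Fin d))) :
    0 < faceExp γ I t (faceIndex _ o) := by
  cases o with
  | none => exact ht.trans_eq (faceExp_last γ I t).symm
  | some i =>
    refine lt_of_lt_of_eq ?_ (faceExp_castSucc γ I t i.1).symm
    split_ifs with h hI
    · linarith [hγ ⟨i.1, h⟩]
    · exact one_pos
    · have := i.2
      simp only [Finset.mem_compl, Finset.mem_sdiff, mem_mSet, not_and, not_not] at this
      exact absurd (this (not_lt.1 h)) hI

lemma faceExp_eq_zero {γ : Fin (d + 1 - k) → ℝ} {I : Finset (Fin d)} {t : ℝ} (j : Fin (d + 1))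
    (hj : j ∉ Set.range (faceIndex (mSet d k \ I)ᶜ)) : faceExp γ I t j = 0 := by
  obtain ⟨i, hi, rfl⟩ := castSucc_notMem_of_notMem_range hj
  simp only [Finset.mem_compl, Finset.mem_sdiff, mem_mSet, not_not] at hi
  rw [faceExp_castSucc, dif_neg (not_lt.2 hi.1), if_neg hi.2]

lemma gpow_facePoint (γ : Fin (d + 1 - k) → ℝ) (I : Finset (Fin d)) (t : ℝ)
    (u : ((mSet d k \ I)ᶜ : Finset (Fin d)) → ℝ) :
    gpow γ (facePoint _ u) =
      ∏ i, u i ^ (faceExp γ I t (faceIndex (mSet d k \ I)ᶜ (some i)) - 1) := by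
  rw [gpow, ← Finset.prod_subset (Finset.subset_univ (mSet d k \ I)ᶜ), ← Finset.prod_coe_sort]
  · refine Finset.prod_congr rfl fun i _ => ?_
    have he : faceExp γ I t (faceIndex (mSet d k \ I)ᶜ (some i)) =
        if h : (i.1 : ℕ) < d + 1 - k then γ ⟨i.1, h⟩ + 1 else if i.1 ∈ I then 1 else 0 :=
      faceExp_castSucc γ I t i.1
    rw [he, facePoint, dif_pos i.2]
    split_ifs with h hI
    · rw [add_sub_cancel_right]
    · rw [sub_self, Real.rpow_zero]
    · have := i.2
      simp only [Finset.mem_compl, Finset.mem_sdiff, mem_mSet, not_and, not_not] at this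
      exact absurd (this (not_lt.1 h)) hI
  · intro i _ hi
    simp only [Finset.mem_compl, Finset.mem_sdiff, mem_mSet, not_not] at hi
    rw [dif_neg (not_lt.2 hi.1)]

lemma exists_faceIntegral_eq {γ : Fin (d + 1 - k) → ℝ} (hγ : ∀ i, -1 < γ i) (I : Finset (Fin d))
    {t : ℕ} (ht : 1 ≤ t) : ∃ C : ℝ, 0 < C ∧ ∀ P : MvPolynomial (Fin (d + 1)) ℝ,
      faceIntegral (mSet d k \ I)ᶜ (fun x => eval x (dehom d P) * (1 - ∑ i, x i) ^ (t - 1) *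
        gpow γ x) = C * simplexMoment (faceExp γ I t) P := by
  have ht0 : (0 : ℝ) < t := Nat.cast_pos.2 ht
  obtain ⟨C, hC, h⟩ := exists_integral_eq_simplexMoment (faceIndex (mSet d k \ I)ᶜ)
    (faceIndex_injective _) (fun u => bary (facePoint _ u)) (bary_facePoint _)
    (bary_facePoint_eq_zero _) (faceExp γ I t) (faceExp_pos hγ ht0) faceExp_eq_zero
  refine ⟨C, hC, fun P => ?_⟩
  rw [← (h P).2, faceIntegral]
  refine integral_congr_ae (Filter.Eventually.of_forall fun u => ?_)
  change eval (facePoint _ u) (dehom d P) * (1 - ∑ i, facePoint _ u i) ^ (t - 1) *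
    gpow γ (facePoint _ u) = _
  beta_reduce
  rw [eval_dehom, sum_facePoint, gpow_facePoint γ I t, Fintype.prod_option, mul_assoc]
  congr 2
  rw [show faceExp γ I t (faceIndex (mSet d k \ I)ᶜ none) = t from faceExp_last γ I t,
    ← Nat.cast_pred (Nat.lt_of_lt_of_le Nat.zero_lt_one ht), Real.rpow_natCast]
  rfl

lemma faceIntegral_univ (h : (Fin d → ℝ) → ℝ) :
    faceIntegral Finset.univ h = ∫ x in simplex (Fin d), h x := by
  let e : (Finset.univ : Finset (Fin d)) ≃ Fin d := Equiv.subtypeUnivEquiv fun i => Finset.mem_univ i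
  have hmp := volume_measurePreserving_piCongrLeft (fun _ => ℝ) e
  have hval : ∀ u i, MeasurableEquiv.piCongrLeft (fun _ => ℝ) e u i = u ⟨i, Finset.mem_univ i⟩ := by
    intro u i
    exact Equiv.piCongrLeft_apply_apply (fun _ => ℝ) e u ⟨i, Finset.mem_univ i⟩
  rw [← hmp.setIntegral_preimage_emb (MeasurableEquiv.measurableEmbedding _), faceIntegral]
  have hset : MeasurableEquiv.piCongrLeft (fun _ => ℝ) e ⁻¹' simplex (Fin d) =
      simplex (Finset.univ : Finset (Fin d)) := by
    ext u
    simp only [Set.mem_preimage, simplex, Set.mem_ofPred_eq, hval]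
    refine and_congr ⟨fun h i => h i.1, fun h i => h _⟩ ?_
    rw [← Finset.sum_coe_sort Finset.univ fun i : Fin d => u ⟨i, Finset.mem_univ i⟩]
  rw [hset]
  refine integral_congr_ae (Filter.Eventually.of_forall fun u => ?_)
  change h _ = h _
  congr 1
  ext i
  rw [hval, dif_pos (Finset.mem_univ i)]

/-- The index in `{1, …, d}` of a barycentric coordinate on the face
`x_{d-k+2} = … = x_{d+1} = 0`. -/
def topIndex (hk : 1 ≤ k) (hkd : k ≤ d) (o : Option (Fin (d - k))) : Fin d :=
  o.elim ⟨d - k, by omega⟩ fun i => ⟨i, by omega⟩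

/-- The point of the face `x_{d-k+2} = … = x_{d+1} = 0` with given first `d - k` coordinates. -/
def topPoint (k : ℕ) (u : Fin (d - k) → ℝ) : Fin d → ℝ := fun i =>
  if hi : (i : ℕ) < d - k then u ⟨i, hi⟩ else if (i : ℕ) = d - k then 1 - ∑ j, u j else 0

lemma topIndex_injective (hk : 1 ≤ k) (hkd : k ≤ d) : Function.Injective (topIndex hk hkd) := by
  rintro (_ | i) (_ | j) h
  · rfl
  · have := congrArg Fin.val h
    simp only [topIndex, Option.elim_none, Option.elim_some] at this
    omega
  · have := congrArg Fin.val h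
    simp only [topIndex, Option.elim_none, Option.elim_some] at this
    omega
  · have := congrArg Fin.val h
    simp only [topIndex, Option.elim_some] at this
    rw [Fin.ext this]

lemma mem_range_topIndex (hk : 1 ≤ k) (hkd : k ≤ d) (i : Fin d) :
    i ∈ Set.range (topIndex hk hkd) ↔ (i : ℕ) < d + 1 - k := by
  constructor
  · rintro ⟨_ | j, rfl⟩
    · simp only [topIndex, Option.elim_none]; omega
    · simp only [topIndex, Option.elim_some]; omega
  · intro h
    by_cases hi : (i : ℕ) < d - k
    · exact ⟨some ⟨i, hi⟩, rfl⟩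
    · exact ⟨none, Fin.ext (by simp only [topIndex, Option.elim_none]; omega)⟩

lemma topPoint_topIndex (hk : 1 ≤ k) (hkd : k ≤ d) (u : Fin (d - k) → ℝ)
    (o : Option (Fin (d - k))) : topPoint k u (topIndex hk hkd o) = optBary u o := by
  cases o with
  | none => simp [topPoint, topIndex, optBary]
  | some i => simp [topPoint, topIndex, optBary]

lemma topPoint_eq_zero (hk : 1 ≤ k) (hkd : k ≤ d) (u : Fin (d - k) → ℝ) {i : Fin d}
    (hi : i ∉ Set.range (topIndex hk hkd)) : topPoint k u i = 0 := by
  rw [mem_range_topIndex] at hi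
  rw [topPoint, dif_neg (by omega), if_neg (by omega)]

lemma bary_topPoint_last (hk : 1 ≤ k) (hkd : k ≤ d) (u : Fin (d - k) → ℝ) :
    bary (topPoint k u) (Fin.last d) = 0 := by
  rw [bary_last, ← Fintype.sum_of_injective (topIndex hk hkd) (topIndex_injective hk hkd)
    (optBary u) _ (fun i hi => topPoint_eq_zero hk hkd u hi)
    (fun o => (topPoint_topIndex hk hkd u o).symm), Fintype.sum_option]
  simp [optBary]

lemma exists_topFaceIntegral_eq {γ : Fin (d + 1 - k) → ℝ} (hγ : ∀ i, -1 < γ i) (hk : 1 ≤ k)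
    (hkd : k ≤ d) : ∃ C : ℝ, 0 < C ∧ ∀ P : MvPolynomial (Fin (d + 1)) ℝ,
      topFaceIntegral k (fun x => eval x (dehom d P) * gpow γ x) =
        C * simplexMoment (faceExp γ ∅ 0) P := by
  have hrange : ∀ j ∉ Set.range fun o => (topIndex hk hkd o).castSucc,
      j = Fin.last d ∨ ∃ i, i ∉ Set.range (topIndex hk hkd) ∧ j = i.castSucc := by
    intro j hj
    induction j using Fin.lastCases with
    | last => exact Or.inl rfl
    | cast i =>
      refine Or.inr ⟨i, ?_, rfl⟩
      rintro ⟨o, ho⟩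
      exact hj ⟨o, congrArg Fin.castSucc ho⟩
  have hexp : ∀ o, faceExp γ ∅ 0 (topIndex hk hkd o).castSucc =
      γ ⟨topIndex hk hkd o, (mem_range_topIndex hk hkd _).1 ⟨o, rfl⟩⟩ + 1 := fun o => by
    rw [faceExp_castSucc, dif_pos]
  have hy0 : ∀ u, ∀ j ∉ Set.range fun o => (topIndex hk hkd o).castSucc,
      bary (topPoint k u) j = 0 := fun u j hj => by
    rcases hrange j hj with rfl | ⟨i, hi, rfl⟩
    · exact bary_topPoint_last hk hkd u
    · rw [bary_castSucc, topPoint_eq_zero hk hkd u hi]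
  have hb0 : ∀ j ∉ Set.range fun o => (topIndex hk hkd o).castSucc, faceExp γ ∅ 0 j = 0 :=
    fun j hj => by
      rcases hrange j hj with rfl | ⟨i, hi, rfl⟩
      · exact faceExp_last γ ∅ 0
      · rw [mem_range_topIndex] at hi
        rw [faceExp_castSucc, dif_neg hi, if_neg (Finset.notMem_empty i)]
  obtain ⟨C, hC, h⟩ := exists_integral_eq_simplexMoment
    (fun o => (topIndex hk hkd o).castSucc)
    ((Fin.castSucc_injective d).comp (topIndex_injective hk hkd)) (fun u => bary (topPoint k u))
    (fun u o => by rw [bary_castSucc, topPoint_topIndex]) hy0 (faceExp γ ∅ 0)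
    (fun o => by rw [hexp]; linarith [hγ ⟨topIndex hk hkd o,
      (mem_range_topIndex hk hkd _).1 ⟨o, rfl⟩⟩]) hb0
  refine ⟨C, hC, fun P => ?_⟩
  rw [← (h P).2, topFaceIntegral]
  refine integral_congr_ae (Filter.Eventually.of_forall fun u => ?_)
  change eval (topPoint k u) (dehom d P) * gpow γ (topPoint k u) = _
  rw [eval_dehom]
  congr 1
  rw [gpow]
  refine (Fintype.prod_of_injective (topIndex hk hkd) (topIndex_injective hk hkd) _ _
    (fun i hi => ?_) fun o => ?_).symm
  · rw [mem_range_topIndex] at hi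
    rw [dif_neg hi]
  · rw [dif_pos ((mem_range_topIndex hk hkd _).1 ⟨o, rfl⟩), hexp, add_sub_cancel_right,
      topPoint_topIndex]
end FormMoment

section MomentForm

variable {d k : ℕ}

/-- The elements of `I ⊆ {1, …, d}` in increasing order, as indices in `{1, …, d+1}`. -/
def idxList (I : Finset (Fin d)) : List (Fin (d + 1)) :=
  ((List.finRange d).filter (· ∈ I)).map Fin.castSucc

lemma mem_idxList {I : Finset (Fin d)} {j : Fin (d + 1)} :
    j ∈ idxList I ↔ j ∈ I.map Fin.castSuccEmb := by
  simp [idxList]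

lemma nodup_idxList (I : Finset (Fin d)) : (idxList I).Nodup :=
  ((List.nodup_finRange d).filter _).map (Fin.castSucc_injective d)

lemma length_idxList (I : Finset (Fin d)) : (idxList I).length = I.card := by
  have h : (idxList I).toFinset = I.map Fin.castSuccEmb := by
    ext j
    rw [List.mem_toFinset, mem_idxList]
  rw [← List.toFinset_card_of_nodup (nodup_idxList I), h, Finset.card_map]

lemma length_filter_idxList {I : Finset (Fin d)} {A : Finset (Fin (d + 1))}
    (hA : A ⊆ I.map Fin.castSuccEmb) : ((idxList I).filter (· ∈ A)).length = A.card := by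
  have h : ((idxList I).filter (· ∈ A)).toFinset = A := by
    ext j
    rw [List.mem_toFinset, List.mem_filter, mem_idxList]
    simp only [decide_eq_true_eq, and_iff_right_iff_imp]
    exact fun hj => hA hj
  rw [← List.toFinset_card_of_nodup ((nodup_idxList I).filter _), h]

/-- Differentiation in the coordinates `x_i` is tangential differentiation in the homogeneous
ones. -/
lemma pdiff_dehom (I : Finset (Fin d)) (P : MvPolynomial (Fin (d + 1)) ℝ) :
    pdiff I (dehom d P) = dehom d (tangDeriv (Fin.last d) (idxList I) P) := by
  rw [pdiff, idxList]
  induction List.finRange d with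
  | nil => rfl
  | cons i L ih =>
    rw [List.foldr_cons, ih]
    split_ifs with hi
    · rw [List.filter_cons_of_pos (by simpa using hi), List.map_cons, tangDeriv_cons, pderiv_dehom]
    · rw [List.filter_cons_of_neg (by simpa using hi)]

/-- The nonempty subsets of `m_k`. -/
def mixedIdx (d k : ℕ) : Finset (Finset (Fin d)) :=
  (mSet d k).powerset.filter fun I => I.Nonempty

lemma mem_mixedIdx {I : Finset (Fin d)} : I ∈ mixedIdx d k ↔ I ⊆ mSet d k ∧ I.Nonempty := by
  simp [mixedIdx]

lemma mixedIdx_one : mixedIdx d 1 = ∅ := by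
  refine Finset.eq_empty_of_forall_notMem fun I hI => ?_
  obtain ⟨h, i, hi⟩ := mem_mixedIdx.1 hI
  have := mem_mSet.1 (h hi)
  omega

lemma card_mSet (hkd : k ≤ d + 1) : (mSet d k).card = k - 1 := by
  have h : (mSet d k).map Fin.valEmbedding = Finset.Ico (d + 1 - k) d := by
    ext i
    simp only [Finset.mem_map, mem_mSet, Fin.valEmbedding_apply, Finset.mem_Ico]
    constructor
    · rintro ⟨j, hj, rfl⟩
      exact ⟨hj, j.2⟩
    · rintro ⟨h1, h2⟩
      exact ⟨⟨i, h2⟩, h1, rfl⟩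
  rw [← Finset.card_map, h, Nat.card_Ico]
  omega

/-- The bilinear form of the theorem in homogeneous coordinates: the integrals become moment
functionals with suitable coefficients `α`, `β`, `c`, and the last sum contains the values at the
vertices. -/
def momentForm (γ : Fin (d + 1 - k) → ℝ) (α : Finset (Fin d) → ℝ) (β : Fin d → ℝ) (c : ℝ)
    (Λ : Fin (d + 1) → ℝ) (P Q : MvPolynomial (Fin (d + 1)) ℝ) : ℝ :=
  (∑ I ∈ mixedIdx d k, α I * simplexMoment (faceExp γ I I.card)
    (tangDeriv (Fin.last d) (idxList I) P * tangDeriv (Fin.last d) (idxList I) Q)) +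
  (∑ i : Fin d, β i * simplexMoment (faceExp γ ∅ 1)
    (X i.castSucc * (pderiv i.castSucc P - pderiv (Fin.last d) P) *
      (pderiv i.castSucc Q - pderiv (Fin.last d) Q))) +
  c * simplexMoment (faceExp γ ∅ 0) (P * Q) +
  ∑ j, Λ j * (eval (bary (vertex j)) P * eval (bary (vertex j)) Q)

lemma exists_mixedForm_eq {γ : Fin (d + 1 - k) → ℝ} (hγ : ∀ i, -1 < γ i) (hk : 2 ≤ k)
    (hkd : k ≤ d + 1) (L : Finset (Fin d) → ℝ) :
    ∃ α : Finset (Fin d) → ℝ, (∀ I ∈ mixedIdx d k, ∃ C, 0 < C ∧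
      α I = C * if I = mSet d k then 1 else L I) ∧ ∀ P Q,
      mixedForm γ L (dehom d P) (dehom d Q) = ∑ I ∈ mixedIdx d k, α I *
        simplexMoment (faceExp γ I I.card) (tangDeriv (Fin.last d) (idxList I) P *
          tangDeriv (Fin.last d) (idxList I) Q) := by
  choose! C hC0 hC using fun (I : Finset (Fin d)) (hI : I.Nonempty) =>
    exists_faceIntegral_eq (k := k) hγ I (Finset.card_pos.2 hI)
  refine ⟨fun I => C I * if I = mSet d k then 1 else L I, fun I hI =>
    ⟨C I, hC0 I (mem_mixedIdx.1 hI).2, rfl⟩, fun P Q => ?_⟩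
  have hcard : (mSet d k).card = k - 1 := card_mSet hkd
  have hne : (mSet d k).Nonempty := Finset.card_pos.1 (by omega)
  have hins : mixedIdx d k = insert (mSet d k) ((mSet d k).ssubsets.filter fun I => I.Nonempty) := by
    ext I
    rw [mem_mixedIdx, Finset.mem_insert, Finset.mem_filter, Finset.mem_ssubsets]
    constructor
    · rintro ⟨h1, h2⟩
      rcases h1.eq_or_ssubset with h | h
      · exact Or.inl h
      · exact Or.inr ⟨h, h2⟩
    · rintro (rfl | ⟨h1, h2⟩)
      · exact ⟨le_rfl, hne⟩
      · exact ⟨h1.subset, h2⟩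
  rw [mixedForm, hins, Finset.sum_insert (by simp)]
  congr 1
  · have h := hC (mSet d k) hne (tangDeriv (Fin.last d) (idxList (mSet d k)) P *
      tangDeriv (Fin.last d) (idxList (mSet d k)) Q)
    rw [Finset.sdiff_self, Finset.compl_empty, faceIntegral_univ] at h
    beta_reduce
    rw [if_pos rfl, mul_one, ← h]
    simp only [map_mul, pdiff_dehom, hcard, Nat.sub_sub]
  · refine Finset.sum_congr rfl fun I hI => ?_
    obtain ⟨h1, h2⟩ := Finset.mem_filter.1 hI
    beta_reduce
    rw [if_neg (Finset.mem_ssubsets.1 h1).ne, mul_comm (C I), mul_assoc, ← hC I h2]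
    simp only [map_mul, pdiff_dehom]

/-- The bilinear form as a moment form, with the signs of the coefficients. -/
lemma exists_form_eq {γ : Fin (d + 1 - k) → ℝ} (hγ : ∀ i, -1 < γ i) (hk : 1 ≤ k)
    (hd : 1 ≤ d) (hkd : k ≤ d + 1) (l : ℝ) (a : Fin (d + 1 - k) → ℝ) (L : Finset (Fin d) → ℝ)
    (Λ : Fin (d + 1) → ℝ) : ∃ (α : Finset (Fin d) → ℝ) (β : Fin d → ℝ) (c : ℝ)
      (Λ' : Fin (d + 1) → ℝ),
      (∀ P Q, form γ l a L Λ (dehom d P) (dehom d Q) = momentForm γ α β c Λ' P Q) ∧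
      (∀ I ∈ mixedIdx d k, ∃ C, 0 < C ∧ α I = C * if I = mSet d k then 1 else L I) ∧
      (∃ C, 0 < C ∧ ∀ i : Fin d, β i = C * if h : (i : ℕ) < d + 1 - k then
        (if k = 1 then 1 else a ⟨i, h⟩) else 0) ∧
      (k ≤ d → (∃ C, 0 < C ∧ c = C * l) ∧ Λ' = 0) ∧ (k = d + 1 → c = 0 ∧ Λ' = Λ) := by
  obtain ⟨C₁, hC₁, h1⟩ := exists_faceIntegral_eq (k := k) hγ ∅ le_rfl
  simp only [Finset.sdiff_empty, le_refl, tsub_eq_zero_of_le, pow_zero, mul_one, Nat.cast_one]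
    at h1
  have h1' : ∀ (i : Fin d) P Q, faceIntegral (mSet d k)ᶜ (fun x => x i *
      eval x (pderiv i (dehom d P)) * eval x (pderiv i (dehom d Q)) * gpow γ x) =
      C₁ * simplexMoment (faceExp γ ∅ 1)
        (X i.castSucc * (pderiv i.castSucc P - pderiv (Fin.last d) P) *
          (pderiv i.castSucc Q - pderiv (Fin.last d) Q)) := fun i P Q => by
    rw [← h1]
    simp only [map_mul, dehom_X, baryPoly_castSucc, eval_X, pderiv_dehom]
  set β : Fin d → ℝ := fun i => C₁ * if h : (i : ℕ) < d + 1 - k then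
    (if k = 1 then 1 else a ⟨i, h⟩) else 0 with hβ
  by_cases hk1 : k = 1
  · subst hk1
    obtain ⟨C₂, hC₂, h2⟩ := exists_topFaceIntegral_eq hγ le_rfl hd
    refine ⟨0, β, C₂ * l, 0, fun P Q => ?_, fun I hI => ?_, ⟨C₁, hC₁, fun i => rfl⟩,
      fun _ => ⟨⟨C₂, hC₂, rfl⟩, rfl⟩, fun h => by omega⟩
    · rw [form, if_pos rfl, momentForm, mixedIdx_one, Finset.sum_empty, zero_add]
      simp only [Pi.zero_apply, zero_mul, Finset.sum_const_zero, add_zero]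
      congr 1
      · refine Finset.sum_congr rfl fun i _ => ?_
        have hm : (mSet d 1)ᶜ = Finset.univ := by
          ext j
          have := j.2
          simp only [Finset.mem_compl, mem_mSet, Finset.mem_univ, iff_true, not_le]
          omega
        rw [← faceIntegral_univ, ← hm, h1', hβ]
        simp
      · rw [mul_comm C₂, mul_assoc, ← h2]
        simp only [map_mul]
    · rw [mixedIdx_one] at hI
      exact absurd hI (Finset.notMem_empty I)
  · obtain ⟨α, hα, h3⟩ := exists_mixedForm_eq hγ (by omega) hkd L
    by_cases hkd' : k ≤ d
    · obtain ⟨C₂, hC₂, h2⟩ := exists_topFaceIntegral_eq hγ hk hkd'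
      refine ⟨α, β, C₂ * l, 0, fun P Q => ?_, hα, ⟨C₁, hC₁, fun i => rfl⟩,
        fun _ => ⟨⟨C₂, hC₂, rfl⟩, rfl⟩, fun h => by omega⟩
      rw [form, if_neg hk1, if_pos hkd', momentForm, h3]
      simp only [Pi.zero_apply, zero_mul, Finset.sum_const_zero, add_zero]
      congr 1
      · congr 1
        refine Finset.sum_congr rfl fun i _ => ?_
        rw [hβ]
        split_ifs with h
        · simp only [dif_pos h]
          rw [h1']
          ring
        · simp only [dif_neg h, mul_zero, zero_mul]
      · rw [mul_comm C₂, mul_assoc, ← h2]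
        simp only [map_mul]
    · obtain rfl : k = d + 1 := by omega
      refine ⟨α, β, 0, Λ, fun P Q => ?_, hα, ⟨C₁, hC₁, fun i => rfl⟩,
        fun h => absurd h hkd', fun _ => ⟨rfl, rfl⟩⟩
      rw [form, if_neg hk1, if_neg hkd', momentForm, h3, zero_mul, add_zero]
      have hz : ∑ i : Fin d, β i * simplexMoment (faceExp γ ∅ 1)
          (X i.castSucc * (pderiv i.castSucc P - pderiv (Fin.last d) P) *
            (pderiv i.castSucc Q - pderiv (Fin.last d) Q)) = 0 :=
        Finset.sum_eq_zero fun i _ => by simp [hβ]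
      rw [hz, add_zero]
      simp only [eval_dehom]

end MomentForm

/-! ### Orthogonality -/

section Orthogonality

variable {d k : ℕ}

lemma castSucc_mem_mPlus {i : Fin d} : i.castSucc ∈ mPlus d k ↔ i ∈ mSet d k := by
  simp [mPlus, mSet]

lemma last_mem_mPlus (hk : 1 ≤ k) : Fin.last d ∈ mPlus d k := by
  simp only [mPlus, Finset.mem_filter, Finset.mem_univ, true_and, Fin.val_last]
  omega

lemma pad_of_mem {γ : Fin (d + 1 - k) → ℝ} {ε : Fin (d + 1) → ℝ} {i : Fin (d + 1)}
    (hi : i ∈ mPlus d k) : pad γ ε i = ε i := by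
  have : d + 1 - k ≤ (i : ℕ) := by simpa [mPlus] using hi
  rw [pad, dif_neg (by omega)]

lemma pad_castSucc {γ : Fin (d + 1 - k) → ℝ} {ε : Fin (d + 1) → ℝ} {i : Fin d}
    (hi : (i : ℕ) < d + 1 - k) : pad γ ε i.castSucc = γ ⟨i, hi⟩ := by
  rw [pad, dif_pos (show ((i.castSucc : Fin (d + 1)) : ℕ) < d + 1 - k from hi)]
  rfl

/-- A summand `x_A h` of `U_n`, in homogeneous coordinates: `h` does not involve the variables of
`m_k^+ \ A` and is orthogonal to lower degree for the weight with exponents `(γ, 1_A)`. -/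
structure IsSummand (γ : Fin (d + 1 - k) → ℝ) (n : ℕ) (A : Finset (Fin (d + 1)))
    (h : MvPolynomial (Fin (d + 1)) ℝ) : Prop where
  subset : A ⊆ mPlus d k
  card_le : A.card ≤ n
  isFaceOrth : IsFaceOrth (pad γ (ind A)) (mPlus d k \ A) (n - A.card) h

variable {γ : Fin (d + 1 - k) → ℝ} {n : ℕ} {A : Finset (Fin (d + 1))}
  {h : MvPolynomial (Fin (d + 1)) ℝ}

lemma IsSummand.isHomogeneous (H : IsSummand γ n A h) :
    ((∏ i ∈ A, X i) * h).IsHomogeneous n := by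
  have h1 : (∏ i ∈ A, X i : MvPolynomial (Fin (d + 1)) ℝ).IsHomogeneous (∑ _i ∈ A, 1) :=
    IsHomogeneous.prod A _ _ fun i _ => isHomogeneous_X ℝ i
  have := h1.mul H.isFaceOrth.isHomogeneous
  rwa [Finset.sum_const, smul_eq_mul, mul_one, Nat.add_sub_cancel' H.card_le] at this

lemma pderiv_prod_X_mul_eq_zero {i : Fin (d + 1)} (hi : i ∉ A) (hh : pderiv i h = 0) :
    pderiv i ((∏ j ∈ A, X j) * h) = 0 := by
  have h1 : pderiv i (∏ l ∈ A, X l : MvPolynomial (Fin (d + 1)) ℝ) = 0 := by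
    refine pderiv_eq_zero_of_notMem_vars fun hc => hi ?_
    have := vars_prod (fun l => (X l : MvPolynomial (Fin (d + 1)) ℝ)) hc
    simpa using this
  rw [pderiv_mul, h1, hh, zero_mul, mul_zero, add_zero]

/-- Orthogonality for the weight of a face on which `x_A h` does not vanish identically, after
division by `x_A`. -/
lemma IsSummand.orth (H : IsSummand γ n A h) {b : Fin (d + 1) → ℝ}
    (hb : ∀ (i : Fin d) (hi : (i : ℕ) < d + 1 - k), b i.castSucc = γ ⟨i, hi⟩ + 1)
    (hbA : ∀ i ∈ A, b i = 2) (hk : 1 ≤ k) {q : MvPolynomial (Fin (d + 1)) ℝ}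
    (hq : q ∈ degLT _ (n - A.card)) :
    gammaMoment b (h * q) = 0 := by
  refine H.isFaceOrth.orth b (fun i hi => ?_) q hq
  by_cases hiA : i ∈ A
  · rw [hbA i hiA, pad_of_mem (H.subset hiA), ind, if_pos hiA]
    norm_num
  · have hiM : i ∉ mPlus d k := fun hM => hi (Finset.mem_sdiff.2 ⟨hM, hiA⟩)
    induction i using Fin.lastCases with
    | last => exact absurd (last_mem_mPlus hk) hiM
    | cast i =>
      rw [castSucc_mem_mPlus, mem_mSet, not_le] at hiM
      rw [hb i hiM, pad_castSucc hiM]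

/-- The terms with mixed derivatives. -/
lemma IsSummand.gammaMoment_mixed (H : IsSummand γ n A h) (hk : 1 ≤ k) {I : Finset (Fin d)}
    (hI : I ∈ mixedIdx d k) {q : MvPolynomial (Fin (d + 1)) ℝ}
    (hq : q ∈ degLT _ (n - I.card)) :
    gammaMoment (faceExp γ I I.card)
      (tangDeriv (Fin.last d) (idxList I) ((∏ i ∈ A, X i) * h) * q) = 0 := by
  obtain ⟨hIm, hIne⟩ := mem_mixedIdx.1 hI
  set z := Fin.last d with hz
  set b := faceExp γ I I.card with hb
  set J := I.map Fin.castSuccEmb with hJ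
  have hJmem : ∀ i : Fin d, i.castSucc ∈ J ↔ i ∈ I := fun i => by simp [hJ]
  have hzJ : z ∉ J := by
    simp [hJ, hz]
  have hbz : b z = I.card := faceExp_last γ I _
  have hbγ : ∀ (i : Fin d) (hi : (i : ℕ) < d + 1 - k), b i.castSucc = γ ⟨i, hi⟩ + 1 :=
    fun i hi => by rw [hb, faceExp_castSucc, dif_pos hi]
  have hbm : ∀ i : Fin d, i ∈ mSet d k → b i.castSucc = if i ∈ I then 1 else 0 :=
    fun i hi => by rw [hb, faceExp_castSucc, dif_neg (not_lt.2 (mem_mSet.1 hi))]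
  have hbJ : ∀ i ∈ J, b i = 1 := by
    intro i hi
    obtain ⟨i, hi', rfl⟩ := Finset.mem_map.1 hi
    exact (hbm i (hIm hi')).trans (if_pos hi')
  have hJM : J ⊆ mPlus d k := by
    intro i hi
    obtain ⟨i, hi', rfl⟩ := Finset.mem_map.1 hi
    exact castSucc_mem_mPlus.2 (hIm hi')
  -- otherwise `x_A h` has a factor `x_i` that is not differentiated and vanishes on the face
  by_cases hAJ : A.erase z ⊆ J
  · have hAI : ∀ (i : Fin d), (i : ℕ) < d + 1 - k → i.castSucc ∉ A := fun i hi hiA => by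
      have := mem_mSet.1 (castSucc_mem_mPlus.1 (H.subset hiA))
      omega
    by_cases hzA : z ∈ A
    · rcases lt_or_ge n I.card with hnI | hnI
      · rw [Nat.sub_eq_zero_of_le hnI.le] at hq
        rw [mem_degLT_zero.1 hq, mul_zero, map_zero]
      have hcard := Finset.card_erase_add_one hzA
      have hAn := H.card_le
      have key := gammaMoment_tangDeriv_mul_eq_zero (z := z) (A := A.erase z) (J := J) (b := b)
        (N := n - A.card) (h := h) (L := idxList I) (j := I.card) (M := n - I.card) (q := q) hzJ hAJ
        (fun i hi => hbJ i (hAJ hi))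
        (fun i hi hiA => H.isFaceOrth.pderiv_eq_zero i (Finset.mem_sdiff.2 ⟨hJM hi, fun hc =>
          hiA (Finset.mem_erase.2 ⟨ne_of_mem_of_not_mem hi hzJ, hc⟩)⟩))
        (fun q hq => H.orth (fun i hi => ?_) (fun i hi => ?_) hk hq) (nodup_idxList I)
        (fun i hi => mem_idxList.1 hi) (length_idxList I).le hq
        (by rw [length_filter_idxList hAJ]; omega)
      · rwa [← hbz, Function.update_eq_self, ← mul_assoc, mul_comm _ (X z),
          Finset.mul_prod_erase A (fun i => (X i : MvPolynomial (Fin (d + 1)) ℝ)) hzA] at key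
      · rw [Function.update_of_ne (Fin.castSucc_lt_last i).ne, Pi.add_apply, hbγ i hi,
          if_neg fun hc => hAI i hi (Finset.mem_of_mem_erase hc), add_zero]
      · rcases eq_or_ne i z with rfl | hne
        · rw [Function.update_self]
        · have hiA : i ∈ A.erase z := Finset.mem_erase.2 ⟨hne, hi⟩
          rw [Function.update_of_ne hne, Pi.add_apply, hbJ i (hAJ hiA), if_pos hiA]
          norm_num
    · rw [Finset.erase_eq_of_notMem hzA] at hAJ
      have hzh : pderiv z h = 0 :=
        H.isFaceOrth.pderiv_eq_zero z (Finset.mem_sdiff.2 ⟨last_mem_mPlus hk, hzA⟩)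
      rcases hAJ.eq_or_ssubset with hEq | hss
      · refine gammaMoment_tangDeriv_mul_eq_zero_of_pderiv (N := n - A.card) hzA
          (fun i hi => hbJ i (hAJ hi)) hzh (fun q hq => H.orth (fun i hi => ?_) (fun i hi => ?_) hk hq)
          (nodup_idxList I) (fun i hi => hEq ▸ mem_idxList.1 hi) ?_
        · rw [Pi.add_apply, hbγ i hi, if_neg (hAI i hi), add_zero]
        · rw [Pi.add_apply, hbJ i (hAJ hi), if_pos hi]
          norm_num
        · rwa [hEq, hJ, Finset.card_map]
      -- a variable that does not occur in `x_A h` is differentiated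
      · obtain ⟨i, hiJ, hiA⟩ := Finset.exists_of_ssubset hss
        rw [tangDeriv_eq_zero (pderiv_prod_X_mul_eq_zero hiA (H.isFaceOrth.pderiv_eq_zero i
          (Finset.mem_sdiff.2 ⟨hJM hiJ, hiA⟩))) (pderiv_prod_X_mul_eq_zero hzA hzh)
          (mem_idxList.2 hiJ), zero_mul, map_zero]
  · obtain ⟨i, hiA, hiJ⟩ := Finset.not_subset.1 hAJ
    obtain ⟨hiz, hiA⟩ := Finset.mem_erase.1 hiA
    have hbi : b i = 0 := by
      induction i using Fin.lastCases with
      | last => exact absurd rfl hiz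
      | cast i => rw [hbm i (castSucc_mem_mPlus.1 (H.subset hiA)), if_neg (mt (hJmem i).2 hiJ)]
    exact gammaMoment_eq_zero_of_X_dvd hbi ((X_dvd_tangDeriv hiz
      ((Finset.dvd_prod_of_mem _ hiA).mul_right _) (mt mem_idxList.1 hiJ)).mul_right _)

/-- The terms with first derivatives. Only `A = ∅` and `A = {d+1}` contribute. -/
lemma IsSummand.gammaMoment_first (H : IsSummand γ n A h) (hk : 1 ≤ k) {i : Fin d}
    (hi : (i : ℕ) < d + 1 - k) {q : MvPolynomial (Fin (d + 1)) ℝ} (hq : q ∈ degLT _ (n - 1)) :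
    gammaMoment (faceExp γ ∅ 1) (X i.castSucc * (pderiv i.castSucc ((∏ i ∈ A, X i) * h) -
      pderiv (Fin.last d) ((∏ i ∈ A, X i) * h)) * q) = 0 := by
  set z := Fin.last d with hz
  set b := faceExp γ ∅ 1 with hb
  have hbz : b z = 1 := faceExp_last γ ∅ _
  have hbγ : ∀ (i : Fin d) (hi : (i : ℕ) < d + 1 - k), b i.castSucc = γ ⟨i, hi⟩ + 1 :=
    fun i hi => by rw [hb, faceExp_castSucc, dif_pos hi]
  have hiz : i.castSucc ≠ z := (Fin.castSucc_lt_last i).ne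
  by_cases hA : ∃ j ∈ A, j ≠ z
  · obtain ⟨j, hjA, hjz⟩ := hA
    have hjM := H.subset hjA
    have hji : j ≠ i.castSucc := by
      rintro rfl
      have := mem_mSet.1 (castSucc_mem_mPlus.1 hjM)
      omega
    have hbj : b j = 0 := by
      induction j using Fin.lastCases with
      | last => exact absurd rfl hjz
      | cast j =>
        rw [castSucc_mem_mPlus, mem_mSet] at hjM
        rw [hb, faceExp_castSucc, dif_neg (not_lt.2 hjM), if_neg (Finset.notMem_empty j)]
    have hdvd : X j ∣ tangDeriv z [i.castSucc] ((∏ i ∈ A, X i) * h) :=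
      X_dvd_tangDeriv hjz ((Finset.dvd_prod_of_mem _ hjA).mul_right _) (by simpa using hji)
    exact gammaMoment_eq_zero_of_X_dvd hbj ((hdvd.mul_left _).mul_right _)
  · have hA' : A ⊆ {z} := fun j hj => by
      by_contra hne
      exact hA ⟨j, hj, by simpa using hne⟩
    rcases Finset.subset_singleton_iff.1 hA' with rfl | rfl
    · have hzh : pderiv z h = 0 := H.isFaceOrth.pderiv_eq_zero z
        (Finset.mem_sdiff.2 ⟨last_mem_mPlus hk, Finset.notMem_empty z⟩)
      have horth : ∀ q ∈ degLT _ n, gammaMoment b (h * q) = 0 := fun q hq =>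
        H.orth hbγ (fun i hi => absurd hi (Finset.notMem_empty i)) hk (by simpa using hq)
      rcases Nat.eq_zero_or_pos n with rfl | hn
      · rw [mem_degLT_zero.1 hq, mul_zero, map_zero]
      have hmem := X_mul_mem_degLT i.castSucc hq
      rw [Nat.sub_add_cancel hn] at hmem
      rw [Finset.prod_empty, one_mul, hzh, sub_zero, gammaMoment_X_mul_pderiv_mul, horth _ hmem,
        horth _ (degLT_mono (Nat.sub_le _ _) hq),
        horth _ (degLT_mono (Nat.sub_le _ _) (X_mul_pderiv_mem_degLT _ _ hq))]
      ring
    · rw [Finset.prod_singleton, gammaMoment_X_mul_sub_pderiv hiz hbz (dvd_mul_right _ _),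
        mul_assoc, gammaMoment_X_mul]
      rw [H.orth (fun i hi => ?_) (fun i hi => ?_) hk, mul_zero, neg_zero]
      · rw [Finset.card_singleton, mul_sub]
        exact add_mem (sub_mem (X_mul_pderiv_mem_degLT _ _ hq) (X_mul_pderiv_mem_degLT _ _ hq))
          (Submodule.smul_mem _ _ hq)
      · rw [Pi.add_apply, hbγ i hi, Pi.single_eq_of_ne (Fin.castSucc_lt_last i).ne, add_zero]
      · rw [Finset.mem_singleton.1 hi, Pi.add_apply, hbz, Pi.single_eq_same]
        norm_num

/-- The term without derivatives. Only `A = ∅` contributes. -/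
lemma IsSummand.gammaMoment_top (H : IsSummand γ n A h) (hk : 1 ≤ k)
    {q : MvPolynomial (Fin (d + 1)) ℝ} (hq : q ∈ degLT _ n) :
    gammaMoment (faceExp γ ∅ 0) ((∏ i ∈ A, X i) * h * q) = 0 := by
  rcases A.eq_empty_or_nonempty with rfl | ⟨j, hj⟩
  · rw [Finset.prod_empty, one_mul]
    exact H.orth (fun i hi => by rw [faceExp_castSucc, dif_pos hi])
      (fun i hi => absurd hi (Finset.notMem_empty i)) hk (by simpa using hq)
  · refine gammaMoment_eq_zero_of_X_dvd (i := j) ?_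
      (((Finset.dvd_prod_of_mem _ hj).mul_right _).mul_right _)
    have hjM := H.subset hj
    induction j using Fin.lastCases with
    | last => exact faceExp_last γ ∅ 0
    | cast j =>
      rw [castSucc_mem_mPlus, mem_mSet] at hjM
      rw [faceExp_castSucc, dif_neg (not_lt.2 hjM), if_neg (Finset.notMem_empty j)]

lemma exists_bary_vertex_eq_zero (j : Fin (d + 1)) :
    ∃ i₀, ∀ i ≠ i₀, bary (vertex (d := d) j) i = 0 := by
  induction j using Fin.cases with
  | zero =>
    refine ⟨Fin.last d, fun i hi => ?_⟩
    induction i using Fin.lastCases with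
    | last => exact absurd rfl hi
    | cast i => rw [bary_castSucc]; rfl
  | succ j =>
    refine ⟨j.castSucc, fun i hi => ?_⟩
    have hv : vertex j.succ = Pi.single (M := fun _ => ℝ) j 1 := rfl
    rw [hv]
    induction i using Fin.lastCases with
    | last => rw [bary_last]; simp
    | cast i =>
      rw [bary_castSucc, Pi.single_eq_of_ne]
      rintro rfl
      exact hi rfl

/-- The summands of `U_n` are orthogonal to all polynomials of lower degree. -/
lemma IsSummand.momentForm_eq_zero (H : IsSummand γ n A h) (hk : 1 ≤ k)
    {α : Finset (Fin d) → ℝ} {β : Fin d → ℝ} {c : ℝ} {Λ : Fin (d + 1) → ℝ}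
    (hβ : ∀ i : Fin d, β i ≠ 0 → (i : ℕ) < d + 1 - k) (hΛ : Λ = 0 ∨ 2 ≤ A.card)
    {Q : MvPolynomial (Fin (d + 1)) ℝ} (hQ : Q ∈ degLT _ n) :
    momentForm γ α β c Λ ((∏ i ∈ A, X i) * h) Q = 0 := by
  have h1 : ∀ I ∈ mixedIdx d k, simplexMoment (faceExp γ I I.card)
      (tangDeriv (Fin.last d) (idxList I) ((∏ i ∈ A, X i) * h) *
        tangDeriv (Fin.last d) (idxList I) Q) = 0 := fun I hI => by
    have hQ' := tangDeriv_mem_degLT (z := Fin.last d) hQ (idxList I)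
    rw [length_idxList] at hQ'
    exact simplexMoment_mul_eq_zero (IsHomogeneous.tangDeriv H.isHomogeneous _)
      (fun q hq => H.gammaMoment_mixed hk hI hq) hQ'
  have h2 : ∀ i : Fin d, (i : ℕ) < d + 1 - k → simplexMoment (faceExp γ ∅ 1)
      (X i.castSucc * (pderiv i.castSucc ((∏ i ∈ A, X i) * h) -
        pderiv (Fin.last d) ((∏ i ∈ A, X i) * h)) *
        (pderiv i.castSucc Q - pderiv (Fin.last d) Q)) = 0 := fun i hi => by
    refine simplexMoment_mul_eq_zero (m := n) ?_ (fun q hq => H.gammaMoment_first hk hi hq)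
      (sub_pderiv_mem_degLT _ _ hQ)
    rw [mul_sub]
    exact (IsHomogeneous.X_mul_pderiv H.isHomogeneous _ _).sub
      (IsHomogeneous.X_mul_pderiv H.isHomogeneous _ _)
  have h3 : simplexMoment (faceExp γ ∅ 0) ((∏ i ∈ A, X i) * h * Q) = 0 :=
    simplexMoment_mul_eq_zero H.isHomogeneous (fun q hq => H.gammaMoment_top hk hq) hQ
  have h4 : ∀ j, Λ j * (eval (bary (vertex j)) ((∏ i ∈ A, X i) * h) *
      eval (bary (vertex j)) Q) = 0 := fun j => by
    rcases hΛ with rfl | hA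
    · rw [Pi.zero_apply, zero_mul]
    · obtain ⟨i₀, hi₀⟩ := exists_bary_vertex_eq_zero j
      obtain ⟨i, hi, hne⟩ := Finset.exists_mem_ne (show 1 < A.card by omega) i₀
      rw [map_mul, map_prod, Finset.prod_eq_zero hi (by rw [eval_X, hi₀ i hne]), zero_mul, zero_mul,
        mul_zero]
  rw [momentForm, Finset.sum_eq_zero fun I hI => by rw [h1 I hI, mul_zero],
    Finset.sum_eq_zero fun i _ => ?_, h3, Finset.sum_eq_zero fun j _ => h4 j]
  · simp
  · by_cases hi : β i = 0
    · rw [hi, zero_mul]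
    · rw [h2 i (hβ i hi), mul_zero]

end Orthogonality

/-! ### Positivity -/

section Positivity

variable {d k : ℕ}

lemma tangDeriv_add {σ : Type*} (z : σ) (L : List σ) (p q : MvPolynomial σ ℝ) :
    tangDeriv z L (p + q) = tangDeriv z L p + tangDeriv z L q := by
  induction L with
  | nil => rfl
  | cons i L ih =>
    simp only [tangDeriv_cons, ih, map_add]
    ring

lemma tangDeriv_smul {σ : Type*} (z : σ) (L : List σ) (c : ℝ) (p : MvPolynomial σ ℝ) :
    tangDeriv z L (c • p) = c • tangDeriv z L p := by
  induction L with
  | nil => rfl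
  | cons i L ih => simp only [tangDeriv_cons, ih, Derivation.map_smul, smul_sub]

section Bilinear

variable (γ : Fin (d + 1 - k) → ℝ) (α : Finset (Fin d) → ℝ) (β : Fin d → ℝ) (c : ℝ)
  (Λ : Fin (d + 1) → ℝ) (P P' Q : MvPolynomial (Fin (d + 1)) ℝ)

lemma momentForm_comm : momentForm γ α β c Λ P Q = momentForm γ α β c Λ Q P := by
  simp only [momentForm, mul_assoc, mul_comm (tangDeriv _ _ P), mul_comm P, mul_comm (eval _ P),
    mul_comm (pderiv _ P - pderiv _ P)]

lemma momentForm_add_left :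
    momentForm γ α β c Λ (P + P') Q = momentForm γ α β c Λ P Q + momentForm γ α β c Λ P' Q := by
  simp only [momentForm, tangDeriv_add, map_add, add_mul, mul_add, add_sub_add_comm,
    Finset.sum_add_distrib]
  ring

lemma momentForm_smul_left (s : ℝ) :
    momentForm γ α β c Λ (s • P) Q = s * momentForm γ α β c Λ P Q := by
  simp only [momentForm, tangDeriv_smul, Derivation.map_smul, map_smul, smul_mul_assoc,
    mul_smul_comm, ← smul_sub, smul_eq_mul, smul_eval, mul_add, Finset.mul_sum, mul_left_comm s, mul_assoc]

end Bilinear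

/-- A coefficient of `∂^I f` is a nonzero multiple of a coefficient of `f`. -/
lemma coeff_add_sum_eq_zero {I : Finset (Fin d)} {f : MvPolynomial (Fin d) ℝ} {δ : Fin d →₀ ℕ}
    (h : coeff δ (pdiff I f) = 0) :
    coeff (δ + ∑ i, if i ∈ I then Finsupp.single i 1 else 0) f = 0 := by
  rw [Fin.sum_univ_def]
  rw [pdiff] at h
  revert h
  induction List.finRange d generalizing δ with
  | nil => exact fun h => by simpa using h
  | cons i L ih =>
    intro h
    rw [List.foldr_cons] at h
    rw [List.map_cons, List.sum_cons, ← add_assoc]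
    refine ih ?_
    split_ifs at h ⊢ with hi
    · rw [coeff_pderiv, mul_eq_zero] at h
      exact h.resolve_right (by positivity)
    · rwa [add_zero]

lemma coeff_aeval_ite {F : Finset (Fin d)} {δ : Fin d →₀ ℕ} (hδ : ∀ i ∉ F, δ i = 0)
    (p : MvPolynomial (Fin d) ℝ) :
    coeff δ (aeval (fun i => if i ∈ F then (X i : MvPolynomial (Fin d) ℝ) else 0) p) =
      coeff δ p := by
  induction p using MvPolynomial.induction_on' with
  | monomial α s =>
    rw [aeval_monomial, algebraMap_eq]
    by_cases hα : ∀ i ∉ F, α i = 0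
    · rw [monomial_eq (s := α)]
      congr 2
      refine Finsupp.prod_congr fun i hi => ?_
      rw [if_pos (by_contra fun hF => Finsupp.mem_support_iff.1 hi (hα i hF))]
    · push Not at hα
      obtain ⟨i, hiF, hi⟩ := hα
      rw [Finsupp.prod, Finset.prod_eq_zero (Finsupp.mem_support_iff.2 hi)
        (by rw [if_neg hiF, zero_pow hi]), mul_zero, coeff_zero, coeff_monomial, if_neg]
      rintro rfl
      exact hi (hδ i hiF)
  | add p q hp hq => rw [map_add, coeff_add, coeff_add, hp, hq]

/-- A polynomial that vanishes on a face has no monomials in the free variables of that face. -/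
lemma coeff_eq_zero_of_eval_facePoint {F : Finset (Fin d)} {p : MvPolynomial (Fin d) ℝ}
    (h : ∀ u ∈ openSimplex F, eval (facePoint F u) p = 0) {δ : Fin d →₀ ℕ}
    (hδ : ∀ i ∉ F, δ i = 0) : coeff δ p = 0 := by
  set φ : MvPolynomial (Fin d) ℝ →ₐ[ℝ] MvPolynomial (Fin d) ℝ :=
    aeval fun i => if i ∈ F then X i else 0 with hφ
  have heval : ∀ x, eval x (φ p) = eval (facePoint F fun i => x i) p := fun x => by
    have : (aeval x).comp φ = aeval (facePoint F fun i => x i) := by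
      ext i
      by_cases hi : i ∈ F <;> simp [hφ, facePoint, hi]
    have := AlgHom.congr_fun this p
    simpa [MvPolynomial.aeval_eq_eval] using this
  have hzero : φ p = 0 := eq_of_eval_eq fun x hx => by
    rw [heval, map_zero]
    have hx' := mem_openSimplex_iff.2 hx
    refine h _ ⟨fun i => hx'.1 i, lt_of_le_of_lt ?_ hx'.2⟩
    rw [Finset.sum_coe_sort F fun i => x i]
    exact Finset.sum_le_sum_of_subset_of_nonneg (Finset.subset_univ F) fun i _ _ => (hx'.1 i).le
  rw [← coeff_aeval_ite hδ, ← hφ, hzero, coeff_zero]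

lemma simplexMoment_face_mul_self {γ : Fin (d + 1 - k) → ℝ} (hγ : ∀ i, -1 < γ i)
    (I : Finset (Fin d)) {t : ℝ} (ht : 0 < t) (R : MvPolynomial (Fin (d + 1)) ℝ) :
    0 ≤ simplexMoment (faceExp γ I t) (R * R) ∧
      (simplexMoment (faceExp γ I t) (R * R) = 0 → ∀ u ∈ openSimplex ((mSet d k \ I)ᶜ : Finset _),
        eval (facePoint _ u) (dehom d R) = 0) := by
  have := simplexMoment_mul_self (faceIndex (mSet d k \ I)ᶜ) (faceIndex_injective _)
    (fun u => bary (facePoint _ u)) (continuous_bary.comp (continuous_facePoint _))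
    (bary_facePoint _) (bary_facePoint_eq_zero _) (faceExp γ I t) (faceExp_pos hγ ht)
    faceExp_eq_zero R
  simpa only [eval_dehom] using this

lemma simplexMoment_face_X_mul_self {γ : Fin (d + 1 - k) → ℝ} (hγ : ∀ i, -1 < γ i) {i : Fin d}
    (hi : (i : ℕ) < d + 1 - k) (R : MvPolynomial (Fin (d + 1)) ℝ) :
    0 ≤ simplexMoment (faceExp γ ∅ 1) (X i.castSucc * R * R) ∧
      (simplexMoment (faceExp γ ∅ 1) (X i.castSucc * R * R) = 0 →
        ∀ u ∈ openSimplex ((mSet d k \ ∅)ᶜ : Finset _), eval (facePoint _ u) (dehom d R) = 0) := by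
  -- the factor `y_i` raises the exponent `γ_i` by one
  have hb : faceExp γ ∅ 1 + Pi.single i.castSucc 1 = faceExp (γ + Pi.single ⟨i, hi⟩ 1) ∅ 1 := by
    ext j
    induction j using Fin.lastCases with
    | last =>
      rw [Pi.add_apply, faceExp_last, faceExp_last, Pi.single_eq_of_ne (Fin.castSucc_lt_last i).ne',
        add_zero]
    | cast j =>
      rw [Pi.add_apply, faceExp_castSucc, faceExp_castSucc]
      rcases eq_or_ne j i with rfl | hne
      · rw [dif_pos hi, dif_pos hi, Pi.single_eq_same, Pi.add_apply, Pi.single_eq_same]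
      · rw [Pi.single_eq_of_ne ((Fin.castSucc_injective d).ne hne), add_zero]
        by_cases hj : (j : ℕ) < d + 1 - k
        · have hne' : (⟨j, hj⟩ : Fin (d + 1 - k)) ≠ ⟨i, hi⟩ := fun h =>
            hne (Fin.ext (Fin.mk.inj h))
          rw [dif_pos hj, dif_pos hj, Pi.add_apply, Pi.single_eq_of_ne hne', add_zero]
        · rw [dif_neg hj, dif_neg hj]
  have hnn : ∀ j, 0 ≤ faceExp γ ∅ 1 j := fun j => by
    by_cases hj : j ∈ Set.range (faceIndex (mSet d k \ ∅)ᶜ)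
    · obtain ⟨o, rfl⟩ := hj
      exact (faceExp_pos hγ one_pos o).le
    · rw [faceExp_eq_zero j hj]
  have hi0 : 0 < faceExp γ ∅ 1 i.castSucc := by
    rw [faceExp_castSucc, dif_pos hi]
    linarith [hγ ⟨i, hi⟩]
  have hpos : 0 < faceExp γ ∅ 1 i.castSucc / ∑ j, faceExp γ ∅ 1 j :=
    div_pos hi0 (hi0.trans_le (Finset.single_le_sum (fun j _ => hnn j) (Finset.mem_univ _)))
  have hγ' : ∀ j, -1 < (γ + Pi.single ⟨i, hi⟩ 1 : Fin (d + 1 - k) → ℝ) j := fun j => by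
    rw [Pi.add_apply]
    have : (0 : ℝ) ≤ (Pi.single ⟨i, hi⟩ 1 : Fin (d + 1 - k) → ℝ) j := by
      rw [Pi.single_apply]
      split_ifs <;> norm_num
    linarith [hγ j]
  obtain ⟨h1, h2⟩ := simplexMoment_face_mul_self hγ' ∅ one_pos R
  rw [mul_assoc, simplexMoment_X_mul, hb]
  exact ⟨mul_nonneg hpos.le h1, fun h => h2 ((mul_eq_zero.1 h).resolve_left hpos.ne')⟩

lemma simplexMoment_top_mul_self_nonneg {γ : Fin (d + 1 - k) → ℝ} (hγ : ∀ i, -1 < γ i)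
    (hk : 1 ≤ k) (hkd : k ≤ d) (R : MvPolynomial (Fin (d + 1)) ℝ) :
    0 ≤ simplexMoment (faceExp γ ∅ 0) (R * R) := by
  obtain ⟨C, hC, h⟩ := exists_topFaceIntegral_eq hγ hk hkd
  refine nonneg_of_mul_nonneg_right ?_ hC
  rw [← h, topFaceIntegral]
  refine setIntegral_nonneg isClosed_simplex.measurableSet fun u hu => mul_nonneg ?_ ?_
  · rw [map_mul, map_mul]
    exact mul_self_nonneg _
  · refine Finset.prod_nonneg fun i _ => ?_
    beta_reduce
    split_ifs with h1 h2 h3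
    · exact Real.rpow_nonneg (hu.1 _) _
    · exact Real.rpow_nonneg (sub_nonneg.2 hu.2) _
    · exact Real.rpow_nonneg le_rfl _
    · exact zero_le_one

/-- The form is a sum of squares; if it vanishes at `f`, then the first sum kills the monomials of
`f` that involve a variable of `m_k`, the second one kills all other monomials except the constant
term, and the last two terms kill the constant. -/
lemma momentForm_self {γ : Fin (d + 1 - k) → ℝ} (hγ : ∀ i, -1 < γ i) (hk : 1 ≤ k)
    {α : Finset (Fin d) → ℝ} (hα : ∀ I ∈ mixedIdx d k, 0 < α I) {β : Fin d → ℝ}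
    (hβ : ∀ i : Fin d, if (i : ℕ) < d + 1 - k then 0 < β i else β i = 0) {c : ℝ}
    {Λ : Fin (d + 1) → ℝ} (hΛ : ∀ j, 0 ≤ Λ j) (hc : 0 ≤ c) (hc' : k ≤ d ∨ c = 0)
    (hcΛ : 0 < c ∨ ∃ j, 0 < Λ j) (f : MvPolynomial (Fin d) ℝ) :
    0 ≤ momentForm γ α β c Λ (rename Fin.castSucc f) (rename Fin.castSucc f) ∧
      (momentForm γ α β c Λ (rename Fin.castSucc f) (rename Fin.castSucc f) = 0 → f = 0) := by
  set P := rename Fin.castSucc f with hP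
  have hPf : dehom d P = f := dehom_rename f
  have h1 : ∀ I ∈ mixedIdx d k, 0 ≤ α I * simplexMoment (faceExp γ I I.card)
      (tangDeriv (Fin.last d) (idxList I) P * tangDeriv (Fin.last d) (idxList I) P) := fun I hI =>
    mul_nonneg (hα I hI).le (simplexMoment_face_mul_self hγ I
      (Nat.cast_pos.2 (Finset.card_pos.2 (mem_mixedIdx.1 hI).2)) _).1
  have h2 : ∀ i ∈ Finset.univ, 0 ≤ β i * simplexMoment (faceExp γ ∅ 1)
      (X i.castSucc * (pderiv i.castSucc P - pderiv (Fin.last d) P) *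
        (pderiv i.castSucc P - pderiv (Fin.last d) P)) := fun i _ => by
    have hβi := hβ i
    split_ifs at hβi with hi
    · exact mul_nonneg hβi.le (simplexMoment_face_X_mul_self hγ hi _).1
    · rw [hβi, zero_mul]
  have h3 : 0 ≤ c * simplexMoment (faceExp γ ∅ 0) (P * P) := by
    rcases hc' with hkd | rfl
    · exact mul_nonneg hc (simplexMoment_top_mul_self_nonneg hγ hk hkd P)
    · rw [zero_mul]
  have h4 : ∀ j ∈ Finset.univ, 0 ≤ Λ j * (eval (bary (vertex j)) P * eval (bary (vertex j)) P) :=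
    fun j _ => mul_nonneg (hΛ j) (mul_self_nonneg _)
  have s1 := Finset.sum_nonneg h1
  have s2 := Finset.sum_nonneg h2
  have s4 := Finset.sum_nonneg h4
  refine ⟨by rw [momentForm]; positivity, fun h => ?_⟩
  rw [momentForm] at h
  have z1 := (Finset.sum_eq_zero_iff_of_nonneg h1).1 (by linarith)
  have z2 := (Finset.sum_eq_zero_iff_of_nonneg h2).1 (by linarith)
  have z3 : c * simplexMoment (faceExp γ ∅ 0) (P * P) = 0 := by linarith
  have z4 := (Finset.sum_eq_zero_iff_of_nonneg h4).1 (by linarith)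
  have hcoeff : ∀ δ : Fin d →₀ ℕ, δ ≠ 0 → coeff δ f = 0 := fun δ hδ => by
    set I := (mSet d k).filter fun i => δ i ≠ 0 with hI
    rcases I.eq_empty_or_nonempty with hI0 | hI0
    · obtain ⟨i, hi⟩ := Finsupp.ne_iff.1 hδ
      have him : ∀ j, j ∈ mSet d k → δ j = 0 := fun j hj => by
        by_contra hne
        exact Finset.notMem_empty j (hI0 ▸ Finset.mem_filter.2 ⟨hj, hne⟩)
      have hik : (i : ℕ) < d + 1 - k := by
        by_contra hlt
        exact hi (him i (mem_mSet.2 (not_lt.1 hlt)))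
      have hβi := hβ i
      rw [if_pos hik] at hβi
      have hv := (simplexMoment_face_X_mul_self hγ hik _).2
        ((mul_eq_zero.1 (z2 i (Finset.mem_univ i))).resolve_left hβi.ne')
      rw [← pderiv_dehom, hPf] at hv
      have hle : Finsupp.single i 1 ≤ δ := Finsupp.single_le_iff.2 (Nat.pos_of_ne_zero hi)
      have hz := coeff_eq_zero_of_eval_facePoint hv (δ := δ - Finsupp.single i 1) fun j hj => by
        simp only [Finset.sdiff_empty, Finset.mem_compl, not_not] at hj
        rw [Finsupp.tsub_apply, him j hj, Nat.zero_sub]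
      rw [coeff_pderiv, tsub_add_cancel_of_le hle, mul_eq_zero] at hz
      exact hz.resolve_right (by positivity)
    · have hIm : I ∈ mixedIdx d k := mem_mixedIdx.2 ⟨Finset.filter_subset _ _, hI0⟩
      have hv := (simplexMoment_face_mul_self hγ I (Nat.cast_pos.2 (Finset.card_pos.2 hI0)) _).2
        ((mul_eq_zero.1 (z1 I hIm)).resolve_left (hα I hIm).ne')
      rw [← pdiff_dehom, hPf] at hv
      set ε : Fin d →₀ ℕ := ∑ i, if i ∈ I then Finsupp.single i 1 else 0 with hε
      have hεj : ∀ j, ε j = if j ∈ I then 1 else 0 := fun j => by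
        rw [hε, Finsupp.finsetSum_apply, Finset.sum_eq_single j]
        · split_ifs <;> simp
        · intro i _ hij
          split_ifs <;> simp [hij]
        · exact fun h => absurd (Finset.mem_univ j) h
      have hle : ε ≤ δ := fun j => by
        rw [hεj]
        split_ifs with hj
        · exact Nat.pos_of_ne_zero (Finset.mem_filter.1 hj).2
        · exact Nat.zero_le _
      have hz := coeff_add_sum_eq_zero (coeff_eq_zero_of_eval_facePoint hv (δ := δ - ε)
        fun j hj => by
          simp only [Finset.mem_compl, Finset.mem_sdiff, not_not] at hj
          have : δ j = 0 := by
            by_contra hne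
            exact hj.2 (Finset.mem_filter.2 ⟨hj.1, hne⟩)
          rw [Finsupp.tsub_apply, this, Nat.zero_sub])
      rwa [← hε, tsub_add_cancel_of_le hle] at hz
  have hfC : f = C (coeff 0 f) := by
    ext δ
    rw [coeff_C]
    split_ifs with hδ
    · rw [hδ]
    · exact hcoeff δ (Ne.symm hδ)
  set s := coeff 0 f
  have hPs : P = C s := by rw [hP, hfC, rename_C]
  have hs : s * s = 0 := by
    rcases hcΛ with hc0 | ⟨j, hj⟩
    · rw [hPs, ← C_mul, simplexMoment_C] at z3
      exact (mul_eq_zero.1 z3).resolve_left hc0.ne'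
    · have := z4 j (Finset.mem_univ j)
      rw [hPs, eval_C] at this
      exact (mul_eq_zero.1 this).resolve_left hj.ne'
  rw [hfC, mul_self_eq_zero.1 hs, C_0]

variable {γ : Fin (d + 1 - k) → ℝ} {l : ℝ} {a : Fin (d + 1 - k) → ℝ} {L : Finset (Fin d) → ℝ}
  {Λ : Fin (d + 1) → ℝ}

lemma form_comm_add_smul (hγ : ∀ i, -1 < γ i) (hd : 1 ≤ d) (hk : 1 ≤ k) (hkd : k ≤ d + 1) :
    (∀ f g, form γ l a L Λ f g = form γ l a L Λ g f) ∧
    (∀ f f' g, form γ l a L Λ (f + f') g = form γ l a L Λ f g + form γ l a L Λ f' g) ∧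
    ∀ (s : ℝ) f g, form γ l a L Λ (s • f) g = s * form γ l a L Λ f g := by
  obtain ⟨α, β, c, Λ', h, -⟩ := exists_form_eq hγ hk hd hkd l a L Λ
  have h' : ∀ f g, form γ l a L Λ f g =
      momentForm γ α β c Λ' (rename Fin.castSucc f) (rename Fin.castSucc g) := fun f g => by
    rw [← h, dehom_rename, dehom_rename]
  refine ⟨fun f g => ?_, fun f f' g => ?_, fun s f g => ?_⟩
  · rw [h', h', momentForm_comm]
  · rw [h', h', h', map_add, momentForm_add_left]
  · rw [h', h', map_smul, momentForm_smul_left]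

lemma isInnerProduct_form (hγ : ∀ i, -1 < γ i) (hd : 1 ≤ d) (hk : 1 ≤ k) (hkd : k ≤ d + 1)
    (hl : k ≤ d → 0 < l) (ha : 2 ≤ k → ∀ i, 0 < a i)
    (hL : ∀ I : Finset (Fin d), I.Nonempty → I ⊂ mSet d k → 0 < L I) (hΛ : ∀ j, 0 ≤ Λ j)
    (hΛ' : k = d + 1 → ∃ j, 0 < Λ j) : IsInnerProduct (form γ l a L Λ) := by
  obtain ⟨hcomm, hadd, hsmul⟩ := form_comm_add_smul (l := l) (a := a) (L := L) (Λ := Λ) hγ hd hk hkd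
  have hpos : ∀ f, 0 ≤ form γ l a L Λ f f ∧ (form γ l a L Λ f f = 0 → f = 0) := fun f => by
    obtain ⟨α, β, c, Λ', h, hα, ⟨C, hC, hβ⟩, hkd', hkd''⟩ := exists_form_eq hγ hk hd hkd l a L Λ
    have hα' : ∀ I ∈ mixedIdx d k, 0 < α I := fun I hI => by
      obtain ⟨C, hC, hI'⟩ := hα I hI
      obtain ⟨h1, h2⟩ := mem_mixedIdx.1 hI
      rw [hI']
      refine mul_pos hC ?_
      split_ifs with heq
      · exact one_pos
      · exact hL I h2 (h1.ssubset_of_ne heq)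
    have hβ' : ∀ i : Fin d, if (i : ℕ) < d + 1 - k then 0 < β i else β i = 0 := fun i => by
      rw [hβ]
      split_ifs with hi hk1
      · rwa [mul_one]
      · exact mul_pos hC (ha (by omega) _)
      · rw [mul_zero]
    have hfin : 0 ≤ c ∧ (k ≤ d ∨ c = 0) ∧ (∀ j, 0 ≤ Λ' j) ∧ (0 < c ∨ ∃ j, 0 < Λ' j) := by
      rcases Nat.lt_or_ge d k with hlt | hle
      · obtain ⟨rfl, rfl⟩ := hkd'' (by omega)
        exact ⟨le_rfl, Or.inr rfl, hΛ, Or.inr (hΛ' (by omega))⟩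
      · obtain ⟨⟨C', hC', rfl⟩, rfl⟩ := hkd' hle
        have := mul_pos hC' (hl hle)
        exact ⟨this.le, Or.inl hle, fun _ => le_rfl, Or.inl this⟩
    have := momentForm_self hγ hk hα' hβ' hfin.2.2.1 hfin.1 hfin.2.1 hfin.2.2.2 f
    rwa [← h, dehom_rename] at this
  exact ⟨{
    inner := form γ l a L Λ
    conj_inner_symm := fun f g => hcomm g f
    re_inner_nonneg := fun f => (hpos f).1
    add_left := hadd
    smul_left := fun f g s => hsmul s f g
    definite := fun f => (hpos f).2 }, fun _ _ => rfl⟩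

end Positivity

/-! ### The orthogonal polynomials of the bilinear form -/

section OrthogonalSpaces

variable {d k : ℕ} {γ : Fin (d + 1 - k) → ℝ} {l : ℝ} {a : Fin (d + 1 - k) → ℝ}
  {L : Finset (Fin d) → ℝ} {Λ : Fin (d + 1) → ℝ} {r : Finset (Fin (d + 1)) → Fin (d + 1)}

lemma exists_bilin_eq_form (hγ : ∀ i, -1 < γ i) (hd : 1 ≤ d) (hk : 1 ≤ k) (hkd : k ≤ d + 1) :
    ∃ B : MvPolynomial (Fin d) ℝ →ₗ[ℝ] MvPolynomial (Fin d) ℝ →ₗ[ℝ] ℝ,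
      ∀ f g, form γ l a L Λ f g = B f g := by
  obtain ⟨hcomm, hadd, hsmul⟩ := form_comm_add_smul (l := l) (a := a) (L := L) (Λ := Λ) hγ hd hk hkd
  exact ⟨LinearMap.mk₂ ℝ (form γ l a L Λ) hadd hsmul
    (fun f g g' => by rw [hcomm, hadd, hcomm g, hcomm g'])
    (fun s f g => by rw [hcomm, hsmul, hcomm g, smul_eq_mul]), fun _ _ => rfl⟩

lemma IsSummand.form_eq_zero (hγ : ∀ i, -1 < γ i) (hd : 1 ≤ d) (hk : 1 ≤ k) (hkd : k ≤ d + 1)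
    {n : ℕ} {A : Finset (Fin (d + 1))} {h : MvPolynomial (Fin (d + 1)) ℝ} (H : IsSummand γ n A h)
    (hA : k ≤ d ∨ 2 ≤ A.card) {q : MvPolynomial (Fin d) ℝ} (hq : q ∈ degLT _ n) :
    form γ l a L Λ (dehom d ((∏ i ∈ A, X i) * h)) q = 0 := by
  obtain ⟨α, β, c, Λ', hform, -, ⟨C, -, hβ⟩, hkd', -⟩ := exists_form_eq hγ hk hd hkd l a L Λ
  rw [← dehom_rename q, hform]
  refine H.momentForm_eq_zero hk (fun i hi => ?_) (hA.imp_left fun h => (hkd' h).2)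
    (rename_mem_degLT hq)
  by_contra hlt
  rw [hβ, dif_neg hlt, mul_zero] at hi
  exact hi rfl

lemma mPlus_eq_univ : mPlus d (d + 1) = Finset.univ := by
  ext i
  simp [mPlus]

lemma card_mPlus (hkd : k ≤ d + 1) : (mPlus d k).card = k := by
  have h : (mPlus d k).map Fin.valEmbedding = Finset.Ico (d + 1 - k) (d + 1) := by
    ext i
    simp only [Finset.mem_map, mPlus, Finset.mem_filter, Finset.mem_univ, true_and,
      Fin.valEmbedding_apply, Finset.mem_Ico]
    constructor
    · rintro ⟨j, hj, rfl⟩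
      exact ⟨hj, j.2⟩
    · rintro ⟨h1, h2⟩
      exact ⟨⟨i, h2⟩, h1, rfl⟩
  rw [← Finset.card_map, h, Nat.card_Ico]
  omega

lemma pad_congr {ε ε' : Fin (d + 1) → ℝ} (h : ∀ i ∈ mPlus d k, ε i = ε' i) :
    pad γ ε = pad γ ε' := by
  ext i
  by_cases hi : i ∈ mPlus d k
  · rw [pad_of_mem hi, pad_of_mem hi, h i hi]
  · have : (i : ℕ) < d + 1 - k := by
      simp only [mPlus, Finset.mem_filter, Finset.mem_univ, true_and] at hi
      omega
    rw [pad, pad, dif_pos this, dif_pos this]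

lemma pad_of_eq (γ : Fin (d + 1 - (d + 1)) → ℝ) (ε : Fin (d + 1) → ℝ) : pad γ ε = ε := by
  ext i
  exact pad_of_mem (by rw [mPlus_eq_univ]; exact Finset.mem_univ i)

lemma pad_gt (hγ : ∀ i, -1 < γ i) {ε : Fin (d + 1) → ℝ} (hε : ∀ i, -1 < ε i) (i : Fin (d + 1)) :
    -1 < pad γ ε i := by
  rw [pad]
  split_ifs with h
  · exact hγ _
  · exact hε i

lemma ind_gt (A : Finset (Fin (d + 1))) (i : Fin (d + 1)) : -1 < ind A i := by
  rw [ind]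
  split_ifs <;> norm_num

/-- The indicator exponents `(γ, 1_A)` at `A = m_k^+` are the exponents `(γ, 1)`. -/
lemma pad_ind_mPlus : pad γ (ind (mPlus d k)) = pad γ 1 :=
  pad_congr fun i hi => by rw [ind, if_pos hi, Pi.one_apply]

/-- The space `U_n` outside the exceptional cases, uniformly in `k`: the sum over those `A` that
have at least two elements when `k = d + 1`. -/
lemma U_eq {n : ℕ} (hn : 1 ≤ n) (hkd : k ≤ d + 1) (hkn : k ≤ d ∨ 2 ≤ n) : U γ Λ r n =
    mulV n (pad γ (ind (mPlus d k))) (mPlus d k) ⊔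
      ⨆ A ∈ (mPlus d k).ssubsets.filter (fun A => k ≤ d ∨ 2 ≤ A.card),
        mulH n (pad γ (ind A)) A (mPlus d k \ A) r := by
  rw [U, if_neg (by omega), pad_ind_mPlus]
  by_cases hk : k ≤ d
  · rw [if_pos hk, Finset.filter_true_of_mem fun _ _ => Or.inl hk]
  · obtain rfl : k = d + 1 := by omega
    have h1 : (mPlus d (d + 1)).ssubsets.filter (fun A => d + 1 ≤ d ∨ 2 ≤ A.card) =
        (Finset.univ : Finset (Finset (Fin (d + 1)))).filter
          (fun A => 2 ≤ A.card ∧ A.card ≤ d) := by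
      ext A
      rw [Finset.mem_filter, Finset.mem_ssubsets, mPlus_eq_univ, Finset.ssubset_univ_iff,
        Finset.mem_filter, ← Finset.card_lt_iff_ne_univ, Fintype.card_fin]
      simp only [Finset.mem_univ, true_and]
      omega
    rw [if_neg hk, if_neg (by omega), h1, mPlus_eq_univ]
    simp only [pad_of_eq, Finset.compl_eq_univ_sdiff]

lemma U_le (hγ : ∀ i, -1 < γ i) (hr : IsPivotChoice r) {n : ℕ} (hn : 1 ≤ n) (hd : 1 ≤ d)
    (hkd : k ≤ d + 1) (hkn : k ≤ d ∨ 2 ≤ n) {W : Submodule ℝ (MvPolynomial (Fin d) ℝ)}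
    (hW : ∀ A h, IsSummand γ n A h → (k ≤ d ∨ 2 ≤ A.card) → dehom d ((∏ i ∈ A, X i) * h) ∈ W) :
    U γ Λ r n ≤ W := by
  rw [U_eq hn hkd hkn]
  refine sup_le (mulV_le (pad_gt hγ (ind_gt _)) fun hA h hh =>
    hW _ h ⟨le_rfl, hA, by rwa [Finset.sdiff_self]⟩ ?_) ?_
  · rw [card_mPlus hkd] at hA ⊢
    omega
  · refine iSup₂_le fun A hA => ?_
    obtain ⟨h1, h2⟩ := Finset.mem_filter.1 hA
    exact mulH_le (fun hS => (hr _ hS).1) fun hA h hh =>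
      hW A h ⟨(Finset.mem_ssubsets.1 h1).subset, hA, hh⟩ h2

lemma degLT_succ_le_sup (hγ : ∀ i, -1 < γ i) (hr : IsPivotChoice r) {n : ℕ} (hn : 1 ≤ n)
    (hkd : k ≤ d + 1) (hkn : k ≤ d ∨ 2 ≤ n) :
    degLT (Fin d) (n + 1) ≤ U γ Λ r n ⊔ degLT (Fin d) n := by
  intro p hp
  have h := baryProd_mul_mem (M := mPlus d k) (n := n) (fun A => pad γ (ind A))
    (fun A => pad_gt hγ (ind_gt A)) (fun S hS => (hr S hS).1) (W := U γ Λ r n ⊔ degLT (Fin d) n)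
    ?_ (fun A hA hAd => ?_) le_sup_right (fun A hA hAd => ?_) ∅ (Finset.empty_subset _)
    (Nat.zero_le _) p (by simpa using hp)
  · rwa [baryProd, Finset.prod_empty, one_mul] at h
  · exact le_sup_of_le_left (by rw [U_eq hn hkd hkn]; exact le_sup_left)
  · refine le_sup_of_le_left ?_
    rw [U_eq hn hkd hkn]
    refine le_sup_of_le_right (le_iSup₂_of_le A ?_ le_rfl)
    rw [Finset.mem_filter, Finset.mem_ssubsets]
    refine ⟨hA, ?_⟩
    have := Finset.card_sdiff_add_card_eq_card hA.subset
    rw [card_mPlus hkd] at this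
    omega
  · have := Finset.card_sdiff_add_card_eq_card hA.subset
    rw [card_mPlus hkd] at this
    omega

lemma pdiff_C {I : Finset (Fin d)} (hI : I.Nonempty) (s : ℝ) : pdiff I (C s) = 0 := by
  obtain ⟨i, hi⟩ := hI
  have h : pdiff I (dehom d (C s)) = 0 := by
    rw [pdiff_dehom, tangDeriv_eq_zero (i := i.castSucc) (pderiv_C) (pderiv_C)
      (mem_idxList.2 (Finset.mem_map_of_mem _ hi)), map_zero]
  rwa [show dehom d (C s) = C s from (dehom d).commutes s] at h

/-- For `k = d + 1`, a constant is seen by the values at the vertices only. -/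
lemma form_C_right (hd : 1 ≤ d) (γ : Fin (d + 1 - (d + 1)) → ℝ) (a : Fin (d + 1 - (d + 1)) → ℝ)
    (f : MvPolynomial (Fin d) ℝ) (s : ℝ) :
    form γ l a L Λ f (C s) = ∑ j, Λ j * (eval (vertex j) f * s) := by
  have hne : (mSet d (d + 1)).Nonempty := ⟨⟨0, hd⟩, by simp [mem_mSet]⟩
  have h0 : mixedForm γ L f (C s) = 0 := by
    rw [mixedForm, pdiff_C hne, Finset.sum_eq_zero, add_zero]
    · simp
    · intro I hI
      rw [pdiff_C (Finset.mem_filter.1 hI).2, faceIntegral]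
      simp
  rw [form, if_neg (by omega), if_neg (by omega), h0, zero_add]
  simp only [eval_C]

lemma sum_mul_eval_vertex_X (j : Fin d) :
    ∑ i, Λ i * eval (vertex i) (X j : MvPolynomial (Fin d) ℝ) = Λ j.succ := by
  rw [Fin.sum_univ_succ]
  simp [vertex, Pi.single_apply]

/-- The orthogonal polynomials are characterised by two properties of the space `U_n`: its elements
are orthogonal to lower degree, and together with the lower degrees they span. -/
lemma mem_U_iff_of_le {B : MvPolynomial (Fin d) ℝ →ₗ[ℝ] MvPolynomial (Fin d) ℝ →ₗ[ℝ] ℝ}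
    (hB : ∀ f, B f f = 0 → f = 0) {n : ℕ} {W : Submodule ℝ (MvPolynomial (Fin d) ℝ)}
    (hW : W ≤ degLT (Fin d) (n + 1)) (horth : ∀ p ∈ W, ∀ q ∈ degLT (Fin d) n, B p q = 0)
    (hspan : degLT (Fin d) (n + 1) ≤ W ⊔ degLT (Fin d) n) (p : MvPolynomial (Fin d) ℝ) :
    p ∈ W ↔ IsOrthogonalPoly (fun f g => B f g) n p := by
  constructor
  · exact fun hp => ⟨mem_degLT_succ.1 (hW hp), fun q hq =>
      horth p hp q (mem_degLT_of_totalDegree_lt hq)⟩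
  · rintro ⟨h1, h2⟩
    obtain ⟨u, hu, q, hq, rfl⟩ := Submodule.mem_sup.1 (hspan (mem_degLT_succ.2 h1))
    have hq0 : q = 0 := by
      cases n with
      | zero => exact mem_degLT_zero.1 hq
      | succ n =>
        have h3 : B (u + q) q = 0 := h2 q (Nat.lt_succ_of_le (mem_degLT_succ.1 hq))
        refine hB q ?_
        rwa [map_add, LinearMap.add_apply, horth u hu q hq, zero_add] at h3
    rwa [hq0, add_zero]

lemma mem_U_iff (hγ : ∀ i, -1 < γ i) (hd : 1 ≤ d) (hk : 1 ≤ k) (hkd : k ≤ d + 1)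
    (hr : IsPivotChoice r) (hip : IsInnerProduct (form γ l a L Λ)) (n : ℕ)
    (p : MvPolynomial (Fin d) ℝ) :
    p ∈ U γ Λ r n ↔ IsOrthogonalPoly (form γ l a L Λ) n p := by
  obtain ⟨B, hB⟩ := exists_bilin_eq_form (l := l) (a := a) (L := L) (Λ := Λ) hγ hd hk hkd
  have hBB : form γ l a L Λ = fun f g => B f g := funext₂ hB
  have hdef : ∀ f, B f f = 0 → f = 0 := fun f hf => by
    obtain ⟨core, hcore⟩ := hip
    exact core.definite f (by rw [hcore, hB, hf])
  rw [hBB]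
  rcases Nat.eq_zero_or_pos n with rfl | hn
  · rw [U, if_pos rfl]
    refine mem_U_iff_of_le hdef ?_ (fun p _ q hq => ?_) (fun p hp => ?_) p
    · rw [Submodule.span_singleton_le_iff_mem, mem_degLT_succ, totalDegree_one]
    · rw [mem_degLT_zero.1 hq, map_zero]
    · rw [totalDegree_eq_zero_iff_eq_C.1 (Nat.le_zero.1 (mem_degLT_succ.1 hp)), ← mul_one (C _),
        ← smul_eq_C_mul]
      exact Submodule.mem_sup_left (Submodule.smul_mem _ _ (Submodule.mem_span_singleton_self 1))
  by_cases hkn : k ≤ d ∨ 2 ≤ n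
  · refine mem_U_iff_of_le hdef (U_le hγ hr hn hd hkd hkn fun A h hh _ =>
      dehom_mem_degLT (IsHomogeneous.mem_degLT hh.isHomogeneous)) (fun p hp q hq => ?_)
      (degLT_succ_le_sup hγ hr hn hkd hkn) p
    have hle : U γ Λ r n ≤ LinearMap.ker (B.flip q) :=
      U_le hγ hr hn hd hkd hkn fun A h hh hA => by
        rw [LinearMap.mem_ker, LinearMap.flip_apply, ← hB]
        exact hh.form_eq_zero hγ hd hk hkd hA hq
    exact hle hp
  · obtain ⟨rfl, rfl⟩ : k = d + 1 ∧ n = 1 := by omega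
    rw [U, if_neg one_ne_zero, if_neg (by omega), if_pos rfl]
    -- the sum of the `Λ_j` is the square of the norm of the constant `1`
    have hΛ : ∑ i, Λ i ≠ 0 := fun h0 => by
      have h1 := form_C_right (l := l) (L := L) (Λ := Λ) hd γ a (C 1) 1
      simp only [eval_C, mul_one, h0] at h1
      rw [hB] at h1
      exact one_ne_zero ((C_1 (R := ℝ) (σ := Fin d)).symm.trans (hdef _ h1))
    refine mem_U_iff_of_le hdef ?_ (fun p hp q hq => ?_) ?_ p
    · rw [Submodule.span_le]
      rintro _ ⟨j, rfl⟩
      refine add_mem ?_ ?_ <;> rw [mem_degLT_succ]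
      · exact (totalDegree_X j).le
      · rw [totalDegree_C]
        exact zero_le_one
    · have hq' : q = C (coeff 0 q) := totalDegree_eq_zero_iff_eq_C.1
        (Nat.le_zero.1 (mem_degLT_succ.1 hq))
      suffices hle : Submodule.span ℝ (Set.range fun j : Fin d =>
          (X j + C (-(Λ j.succ / ∑ i, Λ i)) : MvPolynomial (Fin d) ℝ)) ≤
          LinearMap.ker (B.flip q) from hle hp
      rw [Submodule.span_le]
      rintro _ ⟨j, rfl⟩
      rw [SetLike.mem_coe, LinearMap.mem_ker, LinearMap.flip_apply, ← hB, hq', form_C_right hd]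
      simp only [map_add, ← mul_assoc, ← Finset.sum_mul, eval_C, mul_add, Finset.sum_add_distrib,
        sum_mul_eval_vertex_X]
      rw [mul_neg, mul_div_cancel₀ _ hΛ, add_neg_cancel, zero_mul]
    · refine restrictSupport_induction fun α (hα : α.degree < 2) => ?_
      rcases Nat.lt_or_ge α.degree 1 with h0 | h1
      · exact Submodule.mem_sup_right ((monomial_mem_restrictSupport ℝ).2 (Or.inl h0))
      · obtain ⟨j, hj⟩ : ∃ j, α j ≠ 0 := by
          by_contra! hne
          rw [show α = 0 from Finsupp.ext hne, map_zero] at h1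
          exact absurd h1 (by norm_num)
        have hle : Finsupp.single j 1 ≤ α := Finsupp.single_le_iff.2 (Nat.pos_of_ne_zero hj)
        obtain rfl : α = Finsupp.single j 1 := by
          rw [← tsub_add_cancel_of_le hle, map_add, Finsupp.degree_single] at hα
          have h0 : α - Finsupp.single j 1 = 0 := (Finsupp.degree_eq_zero_iff _).1 (by omega)
          rw [← tsub_add_cancel_of_le hle, h0, zero_add]
        have hX : (monomial (Finsupp.single j 1) 1 : MvPolynomial (Fin d) ℝ) =
            (X j + C (-(Λ j.succ / ∑ i, Λ i))) - C (-(Λ j.succ / ∑ i, Λ i)) := by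
          rw [add_sub_cancel_right]
          rfl
        rw [hX]
        refine sub_mem (Submodule.mem_sup_left (Submodule.subset_span ⟨j, rfl⟩))
          (Submodule.mem_sup_right (mem_degLT_succ.2 ?_))
        rw [totalDegree_C]

end OrthogonalSpaces

/-! ### The orthogonal decomposition for one negative parameter -/

section OneParameter

variable {d : ℕ} {γ : Fin (d + 1 - 1) → ℝ} {l : ℝ} {a : Fin (d + 1 - 1) → ℝ}
  {L : Finset (Fin d) → ℝ} {Λ : Fin (d + 1) → ℝ} {r : Finset (Fin (d + 1)) → Fin (d + 1)}

lemma mPlus_one : mPlus d 1 = {Fin.last d} := by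
  ext i
  simp only [mPlus, Finset.mem_filter, Finset.mem_univ, true_and, Finset.mem_singleton,
    Fin.ext_iff, Fin.val_last]
  omega

lemma U_one_eq (hd : 1 ≤ d) {n : ℕ} (hn : 1 ≤ n) : U γ Λ r n =
    mulV n (pad γ 1) {Fin.last d} ⊔ H n (pad γ 0) {Fin.last d} (r {Fin.last d}) := by
  have h0 : ind (∅ : Finset (Fin (d + 1))) = 0 := by
    ext i
    simp [ind]
  have h1 : mulH n (pad γ 0) ∅ {Fin.last d} r = H n (pad γ 0) {Fin.last d} (r {Fin.last d}) := by
    rw [mulH, Finset.card_empty, if_pos (Nat.zero_le _), Nat.sub_zero, baryProd, Finset.prod_empty,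
      LinearMap.mulLeft_one, Submodule.map_id]
  have h2 : ({Fin.last d} : Finset (Fin (d + 1))).ssubsets = {∅} := by
    ext A
    rw [Finset.mem_ssubsets, Finset.ssubset_singleton_iff, Finset.mem_singleton]
  rw [U, if_neg (by omega), if_pos hd, mPlus_one, h2]
  simp only [Finset.mem_singleton, iSup_iSup_eq_left, Finset.sdiff_empty, h0, h1]

/-- Integration by parts moves the derivatives to `h`, and `h` is annihilated by
`∑ y_i ∂_i^2 + b_i ∂_i`. -/
lemma form_mul_eq_zero (hγ : ∀ i, -1 < γ i) (hd : 1 ≤ d) {n : ℕ} (hn : 1 ≤ n)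
    {v h : MvPolynomial (Fin (d + 1)) ℝ} (hv : v.IsHomogeneous (n - 1))
    (hh : IsFaceOrth (pad γ 0) {Fin.last d} n h) :
    form γ l a L Λ (dehom d (X (Fin.last d) * v)) (dehom d h) = 0 := by
  obtain ⟨α, β, c, Λ', hform, -, ⟨C, -, hβ⟩, hkd, -⟩ :=
    exists_form_eq hγ le_rfl hd (by omega) l a L Λ
  obtain ⟨-, rfl⟩ := hkd hd
  have hβC : ∀ i, β i = C := fun i => by
    rw [hβ, dif_pos (show (i : ℕ) < d + 1 - 1 from i.2), if_pos rfl, mul_one]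
  set z := Fin.last d with hz
  set F := X z * v with hF
  set b := faceExp γ ∅ 1 with hb
  have hbz : b z = 1 := faceExp_last γ ∅ 1
  have hbi : ∀ i : Fin d, b i.castSucc = γ i + 1 := fun i => by
    rw [hb, faceExp_castSucc, dif_pos (show (i : ℕ) < d + 1 - 1 from i.2)]
    rfl
  have hbpos : ∀ i, 0 < b i := fun i => by
    induction i using Fin.lastCases with
    | last => rw [hbz]; exact one_pos
    | cast i => rw [hbi]; linarith [hγ i]
  have hzh : pderiv z h = 0 := hh.pderiv_eq_zero z (Finset.mem_singleton_self z)
  have hharm := sum_X_mul_pderiv_pderiv_eq_zero (b := b)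
    (fun p hp h0 => eq_zero_of_gammaMoment_self hbpos hp h0) hn hh.isHomogeneous
    (hh.orth b fun i hi => by
      induction i using Fin.lastCases with
      | last => exact absurd (Finset.mem_singleton_self z) hi
      | cast i =>
        rw [hbi, pad_castSucc (k := 1) (show (i : ℕ) < d + 1 - 1 from i.2)]
        rfl)
  rw [Fin.sum_univ_castSucc, ← hz, hzh, map_zero, mul_zero, smul_zero, add_zero, add_zero] at hharm
  have hFn : F.IsHomogeneous n := by
    have := (isHomogeneous_X ℝ z).mul hv
    rwa [Nat.add_sub_cancel' hn] at this
  have hterm : ∀ i : Fin d, simplexMoment b (X i.castSucc * (pderiv i.castSucc F - pderiv z F) *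
      (pderiv i.castSucc h - pderiv z h)) =
        -gammaMoment b (F * (X i.castSucc * pderiv i.castSucc (pderiv i.castSucc h) +
          b i.castSucc • pderiv i.castSucc h)) /
          (ascPochhammer ℝ (n + (n - 1))).eval (∑ i, b i) := fun i => by
    have hhom : (X i.castSucc * (pderiv i.castSucc F - pderiv z F) *
        pderiv i.castSucc h).IsHomogeneous (n + (n - 1)) := by
      rw [mul_sub]
      exact ((IsHomogeneous.X_mul_pderiv hFn _ _).sub (IsHomogeneous.X_mul_pderiv hFn _ _)).mul
        hh.isHomogeneous.pderiv
    rw [hzh, sub_zero, simplexMoment_of_isHomogeneous b hhom, gammaMoment_X_mul_sub_pderiv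
      (Fin.castSucc_lt_last i).ne hbz (dvd_mul_right _ _), pderiv_pderiv_comm z, hzh, map_zero,
      sub_zero]
  rw [hform, momentForm, mixedIdx_one, Finset.sum_empty, zero_add, mul_assoc (X z),
    simplexMoment_X_mul, faceExp_last, zero_div, zero_mul, mul_zero, add_zero,
    Finset.sum_congr rfl fun i _ => by rw [hβC i, hterm i]]
  simp only [Pi.zero_apply, zero_mul, Finset.sum_const_zero, add_zero]
  rw [← Finset.mul_sum, ← Finset.sum_div, Finset.sum_neg_distrib, ← map_sum, ← Finset.mul_sum,
    hharm, mul_zero, map_zero, neg_zero, zero_div, mul_zero]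

lemma form_mulV_H_eq_zero (hγ : ∀ i, -1 < γ i) (hd : 1 ≤ d) (hr : IsPivotChoice r) {n : ℕ}
    (hn : 1 ≤ n) {f g : MvPolynomial (Fin d) ℝ} (hf : f ∈ mulV n (pad γ 1) {Fin.last d})
    (hg : g ∈ H n (pad γ 0) {Fin.last d} (r {Fin.last d})) : form γ l a L Λ f g = 0 := by
  obtain ⟨B, hB⟩ := exists_bilin_eq_form (l := l) (a := a) (L := L) (Λ := Λ) hγ hd le_rfl (by omega)
  have h1 : mulV n (pad γ 1) {Fin.last d} ≤ LinearMap.ker (B.flip g) := by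
    refine mulV_le (pad_gt hγ fun i => by norm_num) fun _ v hv => ?_
    rw [Finset.prod_singleton]
    have h2 : H n (pad γ 0) {Fin.last d} (r {Fin.last d}) ≤
        LinearMap.ker (B (dehom d (X (Fin.last d) * v))) :=
      H_le (fun hS => (hr _ hS).1) fun h hh => by
        rw [LinearMap.mem_ker, ← hB]
        exact form_mul_eq_zero hγ hd hn (by simpa using hv.isHomogeneous) hh
    exact h2 hg
  rw [hB]
  exact h1 hf

lemma disjoint_mulV_H (hγ : ∀ i, -1 < γ i) (hd : 1 ≤ d) (hr : IsPivotChoice r) {n : ℕ}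
    (hn : 1 ≤ n) :
    Disjoint (mulV n (pad γ 1) {Fin.last d}) (H n (pad γ 0) {Fin.last d} (r {Fin.last d})) := by
  rw [Submodule.disjoint_def]
  intro p hp hp'
  obtain ⟨core, hcore⟩ := isInnerProduct_form (k := 1) (l := 1) (a := 0) (L := 0) (Λ := 0) hγ hd
    le_rfl (by omega) (fun _ => one_pos) (fun h => absurd h (by norm_num))
    (fun I hI hIm => absurd (mem_mixedIdx.2 ⟨hIm.subset, hI⟩)
      (by rw [mixedIdx_one]; exact Finset.notMem_empty I))
    (fun _ => le_rfl) (fun h => absurd h (by omega))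
  exact core.definite p (by rw [hcore]; exact form_mulV_H_eq_zero hγ hd hr hn hp hp')

end OneParameter

end SimplexSobolev

end

theorem mainTheorem2 (d k : ℕ) (hd : 1 ≤ d) (hk : 1 ≤ k) (hkd : k ≤ d + 1)
    (γ : Fin (d + 1 - k) → ℝ) (hγ : ∀ i, -1 < γ i)
    (l : ℝ) (a : Fin (d + 1 - k) → ℝ) (L : Finset (Fin d) → ℝ) (Λ : Fin (d + 1) → ℝ)
    (hl : 0 ≤ l) (ha : ∀ i, 0 ≤ a i) (hL : ∀ I, 0 ≤ L I) (hΛ : ∀ j, 0 ≤ Λ j)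
    (r : Finset (Fin (d + 1)) → Fin (d + 1)) (hr : IsPivotChoice r) :
    -- (i)
    ((k ≤ d → 0 < l) → (2 ≤ k → ∀ i, 0 < a i) →
        (∀ I : Finset (Fin d), I.Nonempty → I ⊂ mSet d k → 0 < L I) →
        (k = d + 1 → ∃ j, 0 < Λ j) →
        IsInnerProduct (form γ l a L Λ)) ∧
    -- (ii)
    (IsInnerProduct (form γ l a L Λ) →
        ∀ (n : ℕ) (p : MvPolynomial (Fin d) ℝ),
          p ∈ U γ Λ r n ↔ IsOrthogonalPoly (form γ l a L Λ) n p) ∧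
    -- (iii)
    (k = 1 → ∀ n : ℕ, 1 ≤ n →
        U γ Λ r n = mulV n (pad γ 1) {Fin.last d} ⊔ H n (pad γ 0) {Fin.last d} (r {Fin.last d}) ∧
        Disjoint (mulV n (pad γ 1) {Fin.last d}) (H n (pad γ 0) {Fin.last d} (r {Fin.last d})) ∧
        ∀ f ∈ mulV n (pad γ 1) {Fin.last d}, ∀ g ∈ H n (pad γ 0) {Fin.last d} (r {Fin.last d}),
          form γ l a L Λ f g = 0) := by
  refine ⟨fun hl' ha' hL' hΛ' => isInnerProduct_form hγ hd hk hkd hl' ha' hL' hΛ hΛ',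
    fun hip n p => mem_U_iff hγ hd hk hkd hr hip n p, ?_⟩
  rintro rfl n hn
  exact ⟨U_one_eq hd hn, disjoint_mulV_H hγ hd hr hn,
    fun f hf g hg => form_mulV_H_eq_zero hγ hd hr hn hf hg⟩
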